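/- **Notation.** Let $p\ge 1$, $K=\mathbb C^p$, $H=K\otimes L^2(0,\infty)$ (square integrable $K$-valued functions), and $L^2_+(0,\infty)$ the measurable $f$ with $\int_0^\infty(1-e^{-x})|f(x)|^2dx<\infty$. Define $\Lambda:B(K)\to B(H)$ by $(\Lambda(A)F)(x)=e^{-x}AF(x)$, and write $I-\Lambda$ for $I-\Lambda(I)$. Let $\mathfrak A(K)=\{(I-\Lambda)^{1/2}B(I-\Lambda)^{1/2}:B\in B(H)\}$. A *$b$-weight map* is a linear map $\omega:\mathfrak A(K)\to B(K)$ such that $B\mapsto\omega((I-\Lambda)^{1/2}B(I-\Lambda)^{1/2})$ is $\sigma$-weakly continuous; it is *bounded* if it is bounded for the operator norms. Let $E(t,\infty)$ be the projection of $H$ onto functions supported in $[t,\infty)$ and $\omega|_t(A)=\omega(E(t,\infty)AE(t,\infty))$ for $A\in B(H)$, $t>0$. For bounded $\eta$, $\eta\Lambda(A)=\lim_{t\to0+}\eta|_t(\Lambda(A))$ (the value at $\Lambda(A)$ of the normal extension of $\eta$ to $B(H)$). For linear maps, $\phi\ge\chi$ means that $\phi-\chi$ is completely positive. A linear map $\phi$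 of $B(K)$ into itself is *conditionally negative* if $\phi(A^*)=\phi(A)^*$ for all $A$, and $\sum_{i,j}(f_i,\phi(A_i^*A_j)f_j)\le 0$ for all finite families $A_i\in B(K)$, $f_i\in K$ with $\sum_iA_if_i=0$. A *$q$-weight map* is a completely positive $b$-weight map $\omega$ such that for every $t>0$ the map $\iota+\omega|_t\Lambda$ of $B(K)$ is invertible and $\pi_t^\#=(\iota+\omega|_t\Lambda)^{-1}\omega|_t$ is a normal completely positive contraction of $B(H)$ into $B(K)$. It has *index zero* if $\pi_t^\#(E(s,\infty)AE(s,\infty))\to0$ as $t\to0+$ for all $s>0$, $A\in B(H)$ (its normal spine is zero). A $q$-weight map $\omega'$, with corresponding maps $\pi_t'^\#$, is a *$q$-subordinate* of $\omega$ if $\pi_t^\#\ge\pi_t'^\#$ for all $t>0$. **Theorem.** Let $\omega$ be a $q$-weight map over $\mathbb C^p$ of index zero whose range is $B(\mathbb C^p)$, written $\omega=\psi^{-1}\vartheta$ with $\psi$ a coefficient map of $\omega$ and $\vartheta$ the corresponding limiting $b$-weight map. That is, $\psi:B(\mathbb C^p)\to B(\mathbb C^p)$ is linear, invertible and conditionally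 negative with completely positive inverse; $$\vartheta_{ij}(A)=\sum_{k\in J}\big((g_{ik}+h_{ik}),A(g_{jk}+h_{jk})\big)\qquad(A\in\mathfrak A(\mathbb C^p))$$ with $J$ countable, $(g_{ik})_j=\delta_{ij}g_k$, $g_k\in L^2_+(0,\infty)$, $h_{ik}\in\mathbb C^p\otimes L^2(0,\infty)$, $\sum_i(h_{ik})_i=0$, $\sum_k(g_k,(I-\Lambda)g_k)<\infty$ and $\sum_k\|h_{ik}\|^2<\infty$; $w_t=\sum_k\int_t^\infty e^{-x}|g_k(x)|^2dx\to\infty$ as $t\to0+$; $\psi(I)\ge\vartheta(I-\Lambda)$; and $\psi+\rho_\vartheta\Lambda$ is conditionally negative, where $(\rho_\vartheta)_{ij}(A)=\sum_k(h_{ik},Ah_{jk})$. (a) Let $\eta$ be a bounded completely positive $b$-weight map with $\vartheta\ge\eta$. Then the limit $\eta\Lambda$ exists, and if $\psi'$ is a linear map of $B(\mathbb C^p)$ into itself such that $$\psi'\ge\psi+\eta\Lambda\quad\text{and}\quad\psi'+\rho_\vartheta\Lambda-\eta\Lambda\ \text{ is conditionally negative},$$ then $\psi'$ is invertible and $\omega'=\psi'^{-1}(\vartheta-\eta)$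 is a $q$-subordinate of $\omega$. (b) Conversely, for every non-zero $q$-subordinate $\omega'$ of $\omega$ there are a bounded completely positive $b$-weight map $\eta$ with $\vartheta\ge\eta$ and an invertible linear map $\psi'$ satisfying the two conditions in (a) such that $\omega'=\psi'^{-1}(\vartheta-\eta)$. -/

import Mathlib

open MeasureTheory Filter Topology
open scoped ComplexOrder InnerProductSpace

noncomputable section

namespace QWeight

/-! ### The Hilbert spaces -/

/-- The coefficient space `K = ℂ^p`. -/
abbrev K (p : ℕ) := EuclideanSpace ℂ (Fin p)

/-- Lebesgue measure on `(0, ∞)`. -/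
def halfLine : Measure ℝ := volume.restrict (Set.Ioi 0)

/-- `H = K ⊗ L²(0, ∞)`, realised as the space of square integrable `K`-valued functions. -/
abbrev H (p : ℕ) := Lp (K p) 2 halfLine

/-- `B(K)`. -/
abbrev BK (p : ℕ) := K p →L[ℂ] K p

/-- `B(H)`. -/
abbrev BH (p : ℕ) := H p →L[ℂ] H p

/-! ### Multiplication operators, `Λ`, the cut-off projections -/

/-- The operator on `H` of multiplication by the essentially bounded scalar function `m`. -/
def mulOp (p : ℕ) (m : ℝ → ℂ) (hm : MemLp m ⊤ halfLine) : BH p :=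
  (ContinuousLinearMap.lsmul ℂ ℂ : ℂ →L[ℂ] K p →L[ℂ] K p).holderL halfLine ⊤ 2 2 hm.toLp

theorem coeFn_mulOp {p : ℕ} {m : ℝ → ℂ} (hm : MemLp m ⊤ halfLine) (F : H p) :
    mulOp p m hm F =ᵐ[halfLine] fun x => m x • F x := by
  have h1 := (ContinuousLinearMap.lsmul ℂ ℂ : ℂ →L[ℂ] K p →L[ℂ] K p).coeFn_holder
    (r := 2) (hm.toLp) F
  filter_upwards [h1, hm.coeFn_toLp] with x hx hx'
  simp only [mulOp, ContinuousLinearMap.holderL_apply_apply]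
  rw [hx, hx']
  rfl

theorem ae_pos : ∀ᵐ x ∂halfLine, 0 < x := by
  unfold halfLine
  filter_upwards [ae_restrict_mem measurableSet_Ioi] with x hx using hx

/-- `x ↦ e^{-x}`. -/
def expFn (x : ℝ) : ℂ := (Real.exp (-x) : ℝ)

/-- `x ↦ (1 - e^{-x})^{1/2}`. -/
def sqrtFn (x : ℝ) : ℂ := (Real.sqrt (1 - Real.exp (-x)) : ℝ)

/-- The indicator function of `(t, ∞)`. -/
def cutFn (t : ℝ) (x : ℝ) : ℂ := (Set.Ioi t).indicator (fun _ => 1) x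

/-- The function `x ↦ (1 - e^{-x})^{-1/2}` on `(t, ∞)`, extended by zero. -/
def invSqrtFn (t : ℝ) (x : ℝ) : ℂ :=
  (Set.Ioi t).indicator (fun y => (((Real.sqrt (1 - Real.exp (-y)))⁻¹ : ℝ) : ℂ)) x

theorem memLp_expFn : MemLp expFn ⊤ halfLine := by
  refine memLp_top_of_bound (by unfold expFn; fun_prop) 1 ?_
  filter_upwards [ae_pos] with x hx
  simp only [expFn, Complex.norm_real, Real.norm_eq_abs, Real.abs_exp]
  exact Real.exp_le_one_iff.2 (by linarith)

theorem memLp_sqrtFn : MemLp sqrtFn ⊤ halfLine := by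
  refine memLp_top_of_bound (by unfold sqrtFn; fun_prop) 1 ?_
  filter_upwards [ae_pos] with x hx
  simp only [sqrtFn, Complex.norm_real, Real.norm_eq_abs, abs_of_nonneg (Real.sqrt_nonneg _)]
  exact Real.sqrt_le_one.2 (by linarith [Real.exp_pos (-x)])

theorem memLp_cutFn (t : ℝ) : MemLp (cutFn t) ⊤ halfLine := by
  refine memLp_top_of_bound
    ((measurable_const.indicator measurableSet_Ioi).aestronglyMeasurable) 1 (ae_of_all _ ?_)
  intro x
  unfold cutFn
  by_cases hx : x ∈ Set.Ioi t <;> simp [hx]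

theorem memLp_invSqrtFn {t : ℝ} (ht : 0 < t) : MemLp (invSqrtFn t) ⊤ halfLine := by
  have hm : Measurable fun y : ℝ => (((Real.sqrt (1 - Real.exp (-y)))⁻¹ : ℝ) : ℂ) := by
    fun_prop
  refine memLp_top_of_bound ((hm.indicator measurableSet_Ioi).aestronglyMeasurable)
    (Real.sqrt (1 - Real.exp (-t)))⁻¹ (ae_of_all _ ?_)
  intro x
  have h0 : 0 < 1 - Real.exp (-t) := by
    have := Real.exp_lt_one_iff.2 (show -t < 0 by linarith)
    linarith
  unfold invSqrtFn
  by_cases hx : x ∈ Set.Ioi t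
  · rw [Set.indicator_of_mem hx, Complex.norm_real, Real.norm_eq_abs,
      abs_of_nonneg (inv_nonneg.2 (Real.sqrt_nonneg _))]
    have hx' : t < x := hx
    have h1 : Real.exp (-x) ≤ Real.exp (-t) := Real.exp_le_exp.2 (by linarith)
    exact inv_anti₀ (Real.sqrt_pos.2 h0) (Real.sqrt_le_sqrt (by linarith))
  · rw [Set.indicator_of_notMem hx, norm_zero]
    positivity

/-- The map `Λ : B(K) → B(H)`, `(Λ(A)F)(x) = e^{-x} A F(x)`. -/
def Lam (p : ℕ) : BK p →ₗ[ℂ] BH p where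
  toFun A := mulOp p expFn memLp_expFn * A.compLpL 2 halfLine
  map_add' A B := by rw [ContinuousLinearMap.add_compLpL, mul_add]
  map_smul' c A := by
    rw [ContinuousLinearMap.smul_compLpL, mul_smul_comm, RingHom.id_apply]

/-- The positive square root `(I - Λ)^{1/2}`, i.e. multiplication by `(1 - e^{-x})^{1/2}`. -/
def sqrtOp (p : ℕ) : BH p := mulOp p sqrtFn memLp_sqrtFn

/-- The projection `E(t, ∞)` onto the functions supported in `[t, ∞)`. -/
def cutProj (p : ℕ) (t : ℝ) : BH p := mulOp p (cutFn t) (memLp_cutFn t)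

theorem sqrtOp_mul_sqrtOp (p : ℕ) : sqrtOp p * 1 * sqrtOp p = 1 - Lam p 1 := by
  ext1 F
  apply Lp.ext
  rw [mul_one]
  have e1 := coeFn_mulOp memLp_sqrtFn (mulOp p sqrtFn memLp_sqrtFn F)
  have e2 := coeFn_mulOp memLp_sqrtFn F
  have e3 := coeFn_mulOp memLp_expFn ((1 : BK p).compLpL 2 halfLine F)
  have e4 := (1 : BK p).coeFn_compLpL (p := 2) (μ := halfLine) F
  have e5 := Lp.coeFn_sub F (mulOp p expFn memLp_expFn ((1 : BK p).compLpL 2 halfLine F))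
  change mulOp p sqrtFn memLp_sqrtFn (mulOp p sqrtFn memLp_sqrtFn F) =ᵐ[halfLine]
    (F - mulOp p expFn memLp_expFn ((1 : BK p).compLpL 2 halfLine F) : H p)
  filter_upwards [e1, e2, e3, e4, e5, ae_pos] with x h1 h2 h3 h4 h5 hx
  rw [h1, h2, h5, Pi.sub_apply, h3, h4, smul_smul]
  have hs : sqrtFn x * sqrtFn x = 1 - expFn x := by
    unfold sqrtFn expFn
    rw [← Complex.ofReal_mul, Real.mul_self_sqrt]
    · push_cast; rfl
    · have := Real.exp_lt_one_iff.2 (show -x < 0 by linarith)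
      linarith
  rw [hs, sub_smul, one_smul]
  rfl

/-! ### The space `𝔄(K)` and `b`-weight maps -/

/-- `𝔄(K)`: the operators on `H` of the form `(I - Λ)^{1/2} B (I - Λ)^{1/2}`, `B ∈ B(H)`. -/
def frakA (p : ℕ) : Submodule ℂ (BH p) :=
  LinearMap.range (LinearMap.mulLeftRight ℂ (sqrtOp p, sqrtOp p))

/-- The map `B ↦ (I - Λ)^{1/2} B (I - Λ)^{1/2}` from `B(H)` onto `𝔄(K)`. -/
def toA (p : ℕ) : BH p →ₗ[ℂ] frakA p :=
  (LinearMap.mulLeftRight ℂ (sqrtOp p, sqrtOp p)).rangeRestrict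

/-- `I - Λ` as an element of `𝔄(K)`. -/
def oneSubLam (p : ℕ) : frakA p :=
  ⟨1 - Lam p 1, ⟨1, by rw [LinearMap.mulLeftRight_apply]; exact sqrtOp_mul_sqrtOp p⟩⟩

theorem cut_mem (p : ℕ) {t : ℝ} (ht : 0 < t) (A : BH p) :
    LinearMap.mulLeftRight ℂ (cutProj p t, cutProj p t) A ∈ frakA p := by
  have hfac : ∀ x, 0 < x → sqrtFn x * invSqrtFn t x = cutFn t x := by
    intro x hx
    unfold sqrtFn invSqrtFn cutFn
    by_cases hxt : x ∈ Set.Ioi t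
    · rw [Set.indicator_of_mem hxt, Set.indicator_of_mem hxt, ← Complex.ofReal_mul,
        mul_inv_cancel₀, Complex.ofReal_one]
      have := Real.exp_lt_one_iff.2 (show -x < 0 by linarith)
      exact (Real.sqrt_pos.2 (by linarith)).ne'
    · rw [Set.indicator_of_notMem hxt, Set.indicator_of_notMem hxt, mul_zero]
  have hl : cutProj p t = sqrtOp p * mulOp p (invSqrtFn t) (memLp_invSqrtFn ht) := by
    ext1 F
    apply Lp.ext
    have e1 := coeFn_mulOp memLp_sqrtFn (mulOp p (invSqrtFn t) (memLp_invSqrtFn ht) F)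
    have e2 := coeFn_mulOp (memLp_invSqrtFn ht) F
    have e3 := coeFn_mulOp (memLp_cutFn t) F
    change mulOp p (cutFn t) (memLp_cutFn t) F =ᵐ[halfLine]
      mulOp p sqrtFn memLp_sqrtFn (mulOp p (invSqrtFn t) (memLp_invSqrtFn ht) F)
    filter_upwards [e1, e2, e3, ae_pos] with x h1 h2 h3 hx
    rw [h1, h2, h3, smul_smul, hfac x hx]
  have hr : cutProj p t = mulOp p (invSqrtFn t) (memLp_invSqrtFn ht) * sqrtOp p := by
    ext1 F
    apply Lp.ext
    have e1 := coeFn_mulOp (memLp_invSqrtFn ht) (mulOp p sqrtFn memLp_sqrtFn F)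
    have e2 := coeFn_mulOp memLp_sqrtFn F
    have e3 := coeFn_mulOp (memLp_cutFn t) F
    change mulOp p (cutFn t) (memLp_cutFn t) F =ᵐ[halfLine]
      mulOp p (invSqrtFn t) (memLp_invSqrtFn ht) (mulOp p sqrtFn memLp_sqrtFn F)
    filter_upwards [e1, e2, e3, ae_pos] with x h1 h2 h3 hx
    rw [h1, h2, h3, smul_smul, mul_comm, hfac x hx]
  refine ⟨mulOp p (invSqrtFn t) (memLp_invSqrtFn ht) * A *
    mulOp p (invSqrtFn t) (memLp_invSqrtFn ht), ?_⟩
  rw [LinearMap.mulLeftRight_apply, LinearMap.mulLeftRight_apply]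
  conv_rhs => rw [hr]
  conv_rhs => enter [1, 1]; rw [← hr, hl]
  simp only [mul_assoc]

open scoped Classical in
/-- The cut-off `A ↦ A|_t = E(t,∞) A E(t,∞)`, as a map `B(H) → 𝔄(K)`, for `t > 0`
(and, by convention, `0` for `t ≤ 0`, a case that is never used). -/
def cut (p : ℕ) (t : ℝ) : BH p →ₗ[ℂ] frakA p :=
  if ht : 0 < t then
    LinearMap.codRestrict (frakA p) (LinearMap.mulLeftRight ℂ (cutProj p t, cutProj p t))
      (cut_mem p ht)
  else 0

/-- Linear maps of `𝔄(K)` into `B(K)`. -/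
abbrev WeightMap (p : ℕ) := frakA p →ₗ[ℂ] BK p

/-- A linear map `φ : B(H) → B(K)` is normal (`σ`-weakly continuous) when every functional
`A ↦ (f, φ(A) g)` is of the form `A ↦ ∑ₖ (Fₖ, A Gₖ)` with `∑ ‖Fₖ‖² < ∞`, `∑ ‖Gₖ‖² < ∞`. -/
def IsNormalMap {p : ℕ} (φ : BH p →ₗ[ℂ] BK p) : Prop :=
  ∀ f g : K p, ∃ F G : ℕ → H p,
    (Summable fun k => ‖F k‖ ^ 2) ∧ (Summable fun k => ‖G k‖ ^ 2) ∧
    ∀ A : BH p, HasSum (fun k => ⟪F k, A (G k)⟫_ℂ) ⟪f, φ A g⟫_ℂ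

/-- Membership in `B(K) ⊗ 𝔄(K)_*`: the map `B ↦ ω((I - Λ)^{1/2} B (I - Λ)^{1/2})` is
`σ`-weakly continuous. -/
def IsBWeightMap {p : ℕ} (ω : WeightMap p) : Prop := IsNormalMap (ω ∘ₗ toA p)

/-- Boundedness with respect to the ordinary operator norms. -/
def IsBoundedMap {p : ℕ} (ω : WeightMap p) : Prop :=
  ∃ C : ℝ, ∀ A : frakA p, ‖ω A‖ ≤ C * ‖(A : BH p)‖

/-- `ω|_t : B(H) → B(K)`, `ω|_t(A) = ω(E(t,∞) A E(t,∞))`. -/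
def restr {p : ℕ} (ω : WeightMap p) (t : ℝ) : BH p →ₗ[ℂ] BK p := ω ∘ₗ cut p t

/-! ### Complete positivity and conditional negativity -/

section positivity

variable {E F : Type*} [NormedAddCommGroup E] [InnerProductSpace ℂ E]
  [NormedAddCommGroup F] [InnerProductSpace ℂ F]

/-- Positivity of a matrix of operators on `E`, as an operator on the `n`-fold sum of `E`. -/
def IsPosMatrix {n : ℕ} (A : Fin n → Fin n → (E →L[ℂ] E)) : Prop :=
  ∀ x : Fin n → E, 0 ≤ ∑ i, ∑ j, ⟪x i, A i j (x j)⟫_ℂ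

/-- Complete positivity of a linear map `B(E) → B(F)`. -/
def IsCP (φ : (E →L[ℂ] E) →ₗ[ℂ] (F →L[ℂ] F)) : Prop :=
  ∀ (n : ℕ) (A : Fin n → Fin n → (E →L[ℂ] E)), IsPosMatrix A →
    IsPosMatrix fun i j => φ (A i j)

/-- Complete positivity of a linear map defined on a linear space `V` of operators on `E`. -/
def IsCPOn {V : Submodule ℂ (E →L[ℂ] E)} (φ : V →ₗ[ℂ] (F →L[ℂ] F)) : Prop :=
  ∀ (n : ℕ) (A : Fin n → Fin n → V), IsPosMatrix (fun i j => (A i j : E →L[ℂ] E)) →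
    IsPosMatrix fun i j => φ (A i j)

end positivity

/-- Conditionally (completely) positive maps of `B(K)` into itself. -/
def IsCondPos {p : ℕ} (φ : Module.End ℂ (BK p)) : Prop :=
  (∀ A : BK p, φ (star A) = star (φ A)) ∧
  ∀ (n : ℕ) (A : Fin n → BK p) (f : Fin n → K p), ∑ i, A i (f i) = 0 →
    0 ≤ ∑ i, ∑ j, ⟪f i, φ (star (A i) * A j) (f j)⟫_ℂ

/-- Conditionally negative maps of `B(K)` into itself. -/
def IsCondNeg {p : ℕ} (φ : Module.End ℂ (BK p)) : Prop := IsCondPos (-φ)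

/-! ### `q`-weight maps -/

/-- `ι + ω|_t Λ`. -/
def oneAddRestrLam {p : ℕ} (ω : WeightMap p) (t : ℝ) : Module.End ℂ (BK p) :=
  1 + restr ω t ∘ₗ Lam p

/-- The generalized boundary representation `π_t^# = (ι + ω|_t Λ)^{-1} ω|_t`. -/
def bdryRep {p : ℕ} (ω : WeightMap p) (t : ℝ) : BH p →ₗ[ℂ] BK p :=
  Ring.inverse (oneAddRestrLam ω t) ∘ₗ restr ω t

/-- `q`-weight maps over `K`. -/
structure IsQWeightMap {p : ℕ} (ω : WeightMap p) : Prop where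
  bweight : IsBWeightMap ω
  cp : IsCPOn ω
  invertible : ∀ t > 0, IsUnit (oneAddRestrLam ω t)
  bdryRep_cp : ∀ t > 0, IsCP (bdryRep ω t)
  bdryRep_contractive : ∀ t > 0, ∀ A, ‖bdryRep ω t A‖ ≤ ‖A‖
  bdryRep_normal : ∀ t > 0, IsNormalMap (bdryRep ω t)

/-- `π` is the normal spine of `ω`: it is a normal completely positive map and, for every `s > 0`
and `A`, `π_t^#|_s(A) → π|_s(A)` as `t → 0+`. -/
structure IsNormalSpine {p : ℕ} (ω : WeightMap p) (π : BH p →ₗ[ℂ] BK p) : Prop where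
  normal : IsNormalMap π
  cp : IsCP π
  tendsto : ∀ s > 0, ∀ A : BH p,
    Tendsto (fun t => bdryRep ω t (cutProj p s * A * cutProj p s)) (𝓝[>] 0)
      (𝓝 (π (cutProj p s * A * cutProj p s)))

/-- `ω` has index zero: its normal spine is zero. -/
def IsIndexZero {p : ℕ} (ω : WeightMap p) : Prop := IsNormalSpine ω 0

/-- `ω'` is a `q`-subordinate of `ω`. -/
structure IsQSubordinate {p : ℕ} (ω' ω : WeightMap p) : Prop where
  left : IsQWeightMap ω'
  right : IsQWeightMap ω
  sub_cp : ∀ t > 0, IsCP (bdryRep ω t - bdryRep ω' t)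

/-! ### Coefficient maps and limiting `b`-weight maps -/

/-- Functions `g_k` and `h_{ik}` for `i = 1, …, p` and `k ∈ J`, with `g_k ∈ L²_+(0,∞)`,
`h_{ik} ∈ ℂ^p ⊗ L²(0,∞)`, `∑_i (h_{ik})_i = 0`, `∑_k (g_k, (I - Λ) g_k) < ∞` and
`∑_k ‖h_{ik}‖² < ∞`. -/
structure Kernel (p : ℕ) (J : Type) where
  g : J → ℝ → ℂ
  h : Fin p → J → H p
  g_memLp : ∀ k, MemLp (fun x => sqrtFn x * g k x) 2 halfLine
  g_summable : Summable fun k => ∫ x, (1 - Real.exp (-x)) * ‖g k x‖ ^ 2 ∂halfLine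
  h_trace : ∀ k, ∀ᵐ x ∂halfLine, ∑ i, h i k x i = 0
  h_summable : ∀ i, Summable fun k => ‖h i k‖ ^ 2

namespace Kernel

variable {p : ℕ} {J : Type} (D : Kernel p J)

/-- The element `(I - Λ)^{1/2} (g_{ik} + h_{ik})` of `H`, where `(g_{ik})_j = δ_{ij} g_k`. -/
def vec (i : Fin p) (k : J) : H p :=
  (ContinuousLinearMap.toSpanSingleton ℂ (EuclideanSpace.single i (1 : ℂ) : K p)).compLp
    (D.g_memLp k).toLp + sqrtOp p (D.h i k)

/-- `ϑ_{ij}(A) = ∑_k ((g_{ik} + h_{ik}), A (g_{jk} + h_{jk}))` for `A ∈ 𝔄(K)`. Here, for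
`A = (I - Λ)^{1/2} B (I - Λ)^{1/2}` and `F, G ∈ K ⊗ L²_+(0,∞)`, the expression `(F, A G)` is
`((I - Λ)^{1/2} F, B (I - Λ)^{1/2} G)`. -/
def Represents (ϑ : WeightMap p) : Prop :=
  ∀ (B : BH p) (i j : Fin p),
    HasSum (fun k => ⟪D.vec i k, B (D.vec j k)⟫_ℂ)
      ⟪(EuclideanSpace.single i (1 : ℂ) : K p),
        ϑ (toA p B) (EuclideanSpace.single j (1 : ℂ))⟫_ℂ

/-- `w_t = ∑_k (g_k, Λ|_t g_k)`. -/
def w (t : ℝ) : ℝ := ∑' k, ∫ x in Set.Ioi t, Real.exp (-x) * ‖D.g k x‖ ^ 2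

theorem summable_inner (A : BH p) (i j : Fin p) :
    Summable fun k => ⟪D.h i k, A (D.h j k)⟫_ℂ := by
  refine Summable.of_norm_bounded
    (((D.h_summable i).add (D.h_summable j)).mul_left ‖A‖) fun k => ?_
  have h1 : ‖⟪D.h i k, A (D.h j k)⟫_ℂ‖ ≤ ‖D.h i k‖ * (‖A‖ * ‖D.h j k‖) :=
    (norm_inner_le_norm _ _).trans
      (mul_le_mul_of_nonneg_left (A.le_opNorm _) (norm_nonneg _))
  nlinarith [norm_nonneg A, norm_nonneg (D.h i k), norm_nonneg (D.h j k),
    mul_nonneg (norm_nonneg A) (sq_nonneg (‖D.h i k‖ - ‖D.h j k‖)),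
    mul_nonneg (norm_nonneg A) (sq_nonneg (‖D.h i k‖ + ‖D.h j k‖))]

/-- The bounded map `ρ = ρ_ϑ`, `ρ_{ij}(A) = ∑_k (h_{ik}, A h_{jk})`, defined on all of `B(H)`. -/
def rho : BH p →ₗ[ℂ] BK p where
  toFun A := Matrix.toEuclideanCLM (𝕜 := ℂ)
    (Matrix.of fun i j => ∑' k, ⟪D.h i k, A (D.h j k)⟫_ℂ)
  map_add' A B := by
    rw [← map_add]
    congr 1
    ext i j
    simp only [Matrix.of_apply, Matrix.add_apply, add_apply, inner_add_right]
    exact (D.summable_inner A i j).tsum_add (D.summable_inner B i j)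
  map_smul' c A := by
    rw [RingHom.id_apply, ← map_smul]
    congr 1
    ext i j
    simp only [Matrix.of_apply, Matrix.smul_apply, smul_apply,
      inner_smul_right, smul_eq_mul]
    exact tsum_mul_left

end Kernel

/-- `ω = ψ^{-1} ϑ` with `ψ` a coefficient map of `ω` and `ϑ` the corresponding limiting
`b`-weight map, where `ϑ` is given by the kernel `D` (so that `ρ_ϑ = D.rho`). -/
structure IsCoefficientPair {p : ℕ} {J : Type} (ω : WeightMap p) (ψ : Module.End ℂ (BK p))
    (ϑ : WeightMap p) (D : Kernel p J) : Prop where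
  invertible : IsUnit ψ
  condNeg : IsCondNeg ψ
  inverse_cp : IsCP (Ring.inverse ψ)
  eq : ω = Ring.inverse ψ ∘ₗ ϑ
  represents : D.Represents ϑ
  tendsto_w : Tendsto D.w (𝓝[>] 0) atTop
  le_one : ϑ (oneSubLam p) ≤ ψ 1
  condNeg_add : IsCondNeg (ψ + D.rho ∘ₗ Lam p)

/-- `T = ηΛ` for a bounded `b`-weight map `η`. Since `Λ(A)` need not lie in `𝔄(K)`, `ηΛ(A)` is the
value at `Λ(A)` of the normal extension of `η` to `B(H)`, which is the limit of
`η(E(t,∞) Λ(A) E(t,∞))` as `t → 0+`. -/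
def IsCompLam {p : ℕ} (η : WeightMap p) (T : Module.End ℂ (BK p)) : Prop :=
  ∀ A : BK p, Tendsto (fun t => restr η t (Lam p A)) (𝓝[>] 0) (𝓝 (T A))

/-- `η` is a bounded completely positive `b`-weight map with `ϑ ≥ η`. -/
structure IsBoundedSubweight {p : ℕ} (η ϑ : WeightMap p) : Prop where
  bweight : IsBWeightMap η
  bounded : IsBoundedMap η
  cp : IsCPOn η
  sub_cp : IsCPOn (ϑ - η)

end QWeight

end

/-! ### Positive matrices of operators and completely positive maps. -/

namespace QWeight

section positivity

variable {E F G : Type*} [NormedAddCommGroup E] [InnerProductSpace ℂ E]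
  [NormedAddCommGroup F] [InnerProductSpace ℂ F] [NormedAddCommGroup G] [InnerProductSpace ℂ G]

/-! Put `L_t = ψ + ϑ|_tΛ`. Cancelling `ψ⁻¹` gives `π_t^# = L_t⁻¹ ϑ|_t`, and likewise `π'_t^# =
L'_t⁻¹ (ϑ - η)|_t` with `L'_t = ψ' + (ϑ - η)|_tΛ`. Everything rests on a minimum principle
(`CondNeg.isPosMatrix_of_map`): a conditionally negative `L` that dominates an invertible map with
completely positive inverse is invertible with completely positive inverse
(`CondNeg.isUnit_and_isCP_inverse`).

Conditional negativity of `L_t` and `L'_t` is read off from the kernel. On a family with `∑ A_i f_i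
= 0` the vectors `f_i ⊗ g_k` cancel, so there `ϑ|_tΛ` has the quadratic form of the cut-off of
`ρ_ϑ`, which tends to that of `ρ_ϑΛ` (`Kernel.isReduced`). As the form of `(ϑ - η)|_tΛ` increases
when `t` decreases, the second condition of (a) makes `L'_t` conditionally negative for every `t`.
The first condition gives `L'_t ≥ L_t`, hence `L_t⁻¹ ≥ L'_t⁻¹`, and `π_t^# - π'_t^# = (L_t⁻¹ -
L'_t⁻¹) ϑ|_t + L'_t⁻¹ η|_t` is completely positive. Contractivity of `π'_t^#` is inherited from
`π_t^#`.

For (b), `w_t⁻¹ ϑ|_tΛ → ι`, so `w_t (ι + ω|_tΛ)⁻¹ → ψ`. Let `N_t = w_t (ι + ω'|_tΛ)⁻¹ = w_t (ι -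
π'_t^#Λ)`; it is conditionally negative, and it exceeds `w_t (ι + ω|_tΛ)⁻¹` by the completely
positive `C_t = w_t (π_t^# - π'_t^#)Λ`. If `C_t` were unbounded, its normalised limit would be both
completely positive and conditionally negative, hence a non-zero multiple of `ι`
(`IsCP.exists_eq_smul_one`), and this forces `ω' = 0`. So along an ultrafilter `N_t → ψ'`; set `η =
ϑ - ψ'ω'`. Every required property of `η` and `ψ'` is the limit of the corresponding property of
`w_t π_t^#` and `w_t π'_t^#`. -/

theorem zero_le_inner_self (v : E) : 0 ≤ ⟪v, v⟫_ℂ :=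
  Complex.le_def.2 ⟨inner_self_nonneg (𝕜 := ℂ), (inner_self_im (𝕜 := ℂ) v).symm⟩

theorem IsPosMatrix.add {n : ℕ} {A B : Fin n → Fin n → (E →L[ℂ] E)} (hA : IsPosMatrix A)
    (hB : IsPosMatrix B) : IsPosMatrix fun i j => A i j + B i j := by
  intro x
  have := add_nonneg (hA x) (hB x)
  simpa only [add_apply, inner_add_right, Finset.sum_add_distrib] using this

theorem IsPosMatrix.smul {n : ℕ} {A : Fin n → Fin n → (E →L[ℂ] E)} (hA : IsPosMatrix A)
    {c : ℝ} (hc : 0 ≤ c) : IsPosMatrix fun i j => (c : ℂ) • A i j := by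
  intro x
  have := mul_nonneg (Complex.zero_le_real.2 hc) (hA x)
  simpa only [smul_apply, inner_smul_right, Finset.mul_sum] using this

theorem IsPosMatrix.of_tendsto {n : ℕ} {α : Type*} {l : Filter α} [l.NeBot]
    {A : α → Fin n → Fin n → (E →L[ℂ] E)} {B : Fin n → Fin n → (E →L[ℂ] E)}
    (hA : ∀ᶠ t in l, IsPosMatrix (A t)) (h : ∀ i j, Tendsto (fun t => A t i j) l (𝓝 (B i j))) :
    IsPosMatrix B := by
  intro x
  refine ge_of_tendsto (x := l) (f := fun t => ∑ i, ∑ j, ⟪x i, A t i j (x j)⟫_ℂ) ?_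
    (hA.mono fun t ht => ht x)
  refine tendsto_finsetSum _ fun i _ => tendsto_finsetSum _ fun j _ => ?_
  exact tendsto_const_nhds.inner (((ContinuousLinearMap.apply ℂ E (x j)).continuous.tendsto _).comp
    (h i j))

theorem IsPosMatrix.conj_star [CompleteSpace E] {n : ℕ}
    {A : Fin n → Fin n → (E →L[ℂ] E)} (hA : IsPosMatrix A) (V : E →L[ℂ] E) :
    IsPosMatrix fun i j => star V * A i j * V := by
  intro x
  simpa only [mul_assoc, mul_apply_eq_comp, ContinuousLinearMap.star_eq_adjoint,
    ContinuousLinearMap.adjoint_inner_right] using hA fun i => V (x i)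

theorem isPosMatrix_star_mul [CompleteSpace E] {n : ℕ} (A : Fin n → (E →L[ℂ] E)) :
    IsPosMatrix fun i j => star (A i) * A j := by
  intro x
  have : ∑ i, ∑ j, ⟪x i, (star (A i) * A j) (x j)⟫_ℂ
      = ⟪∑ i, A i (x i), ∑ i, A i (x i)⟫_ℂ := by
    simp only [sum_inner, inner_sum, mul_apply_eq_comp,
      ContinuousLinearMap.star_eq_adjoint, ContinuousLinearMap.adjoint_inner_right]
    rw [Finset.sum_comm]
  rw [this]
  exact zero_le_inner_self _

variable {V : Submodule ℂ (E →L[ℂ] E)}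

theorem IsCP.isCPOn_comp {φ : (F →L[ℂ] F) →ₗ[ℂ] (G →L[ℂ] G)} (hφ : IsCP φ)
    {χ : V →ₗ[ℂ] (F →L[ℂ] F)} (hχ : IsCPOn χ) : IsCPOn (φ ∘ₗ χ) :=
  fun n A hA => hφ n _ (hχ n A hA)

theorem IsCP.comp {φ : (F →L[ℂ] F) →ₗ[ℂ] (G →L[ℂ] G)} (hφ : IsCP φ)
    {χ : (E →L[ℂ] E) →ₗ[ℂ] (F →L[ℂ] F)} (hχ : IsCP χ) : IsCP (φ ∘ₗ χ) :=
  fun n A hA => hφ n _ (hχ n A hA)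

theorem IsCP.zero : IsCP (0 : (E →L[ℂ] E) →ₗ[ℂ] (F →L[ℂ] F)) := by
  intro n A _ x
  simp

theorem IsCP.add {φ χ : (E →L[ℂ] E) →ₗ[ℂ] (F →L[ℂ] F)} (hφ : IsCP φ) (hχ : IsCP χ) :
    IsCP (φ + χ) := fun n A hA => (hφ n A hA).add (hχ n A hA)

theorem IsCP.smul {φ : (E →L[ℂ] E) →ₗ[ℂ] (F →L[ℂ] F)} (hφ : IsCP φ) {c : ℝ} (hc : 0 ≤ c) :
    IsCP ((c : ℂ) • φ) := fun n A hA => (hφ n A hA).smul hc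

theorem IsCP.congr {φ χ : (E →L[ℂ] E) →ₗ[ℂ] (F →L[ℂ] F)} (hφ : IsCP φ) (h : ∀ A, φ A = χ A) :
    IsCP χ := LinearMap.ext h ▸ hφ

theorem IsCP.of_tendsto {α : Type*} {l : Filter α} [l.NeBot]
    {φ : α → (E →L[ℂ] E) →ₗ[ℂ] (F →L[ℂ] F)} {χ : (E →L[ℂ] E) →ₗ[ℂ] (F →L[ℂ] F)}
    (hφ : ∀ᶠ t in l, IsCP (φ t)) (h : ∀ A, Tendsto (fun t => φ t A) l (𝓝 (χ A))) : IsCP χ :=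
  fun n A hA => IsPosMatrix.of_tendsto (hφ.mono fun _ ht => ht n A hA) fun i j => h (A i j)

theorem IsCPOn.add {φ χ : V →ₗ[ℂ] (F →L[ℂ] F)} (hφ : IsCPOn φ) (hχ : IsCPOn χ) :
    IsCPOn (φ + χ) := fun n A hA => (hφ n A hA).add (hχ n A hA)

/-- A polarisation step: `z = 1` and `z = i` force `b` to be the conjugate of `a`, and the phase `z
= -a/|a|` makes the cross terms as negative as possible. -/
theorem conj_of_forall_add_nonneg {a b S : ℂ}
    (h : ∀ z : ℂ, ‖z‖ = 1 → 0 ≤ S + ((starRingEnd ℂ z) * a + z * b)) (hS : S.im = 0) :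
    b = starRingEnd ℂ a ∧ 2 * ‖a‖ ≤ S.re := by
  have h1 := (Complex.le_def.1 (h 1 (by simp))).2
  have h2 := (Complex.le_def.1 (h Complex.I (by simp))).2
  simp at h1 h2
  have hb : b = starRingEnd ℂ a := by
    apply Complex.ext <;> simp <;> linarith
  refine ⟨hb, ?_⟩
  by_cases ha : a = 0
  · have := (Complex.le_def.1 (h 1 (by simp))).1
    simp [hb, ha] at this ⊢
    linarith
  have hn : ‖a‖ ≠ 0 := norm_ne_zero_iff.2 ha
  have h3 := (Complex.le_def.1 (h (-(a / ‖a‖)) (by simp [hn]))).1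
  have e1 : (starRingEnd ℂ (-(a / ‖a‖)) * a) = -(‖a‖ : ℂ) := by
    rw [map_neg, map_div₀, Complex.conj_ofReal, neg_mul, div_mul_eq_mul_div, mul_comm,
      Complex.mul_conj, Complex.normSq_eq_norm_sq]
    have : (‖a‖ : ℂ) ≠ 0 := by exact_mod_cast hn
    push_cast
    field_simp
  have e2 : (-(a / ‖a‖)) * b = -(‖a‖ : ℂ) := by
    rw [hb, neg_mul, div_mul_eq_mul_div, Complex.mul_conj, Complex.normSq_eq_norm_sq]
    have : (‖a‖ : ℂ) ≠ 0 := by exact_mod_cast hn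
    push_cast
    field_simp
  rw [e1, e2] at h3
  simp at h3
  linarith

/-- The off-diagonal entries of a positive matrix are adjoint to each other and dominated by the
diagonal. -/
theorem IsPosMatrix.offDiag {A : Fin 2 → Fin 2 → (E →L[ℂ] E)} (hA : IsPosMatrix A) (x y : E) :
    ⟪y, A 1 0 x⟫_ℂ = starRingEnd ℂ ⟪x, A 0 1 y⟫_ℂ ∧
      2 * ‖⟪x, A 0 1 y⟫_ℂ‖ ≤ (⟪x, A 0 0 x⟫_ℂ + ⟪y, A 1 1 y⟫_ℂ).re := by
  have h0 := hA ![x, 0]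
  have h1 := hA ![0, y]
  simp [Fin.sum_univ_two] at h0 h1
  refine conj_of_forall_add_nonneg (fun z hz => ?_) ?_
  · have h := hA ![z • x, y]
    have hzz : starRingEnd ℂ z * z = 1 := by
      rw [mul_comm, Complex.mul_conj, Complex.normSq_eq_norm_sq, hz]; simp
    simp [Fin.sum_univ_two] at h
    convert h using 1
    linear_combination (-⟪x, A 0 0 x⟫_ℂ) * hzz
  · have := (Complex.le_def.1 h0).2
    have := (Complex.le_def.1 h1).2
    simp at *
    linarith

/-- Test vectors with the same image under `σ` are added up. Since `σ` need be neither injective nor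
monotone, any pair of indices reduces to the `2 × 2` case. -/
theorem IsPosMatrix.submatrix {m n : ℕ} {A : Fin n → Fin n → (E →L[ℂ] E)} (hA : IsPosMatrix A)
    (σ : Fin m → Fin n) : IsPosMatrix fun i j => A (σ i) (σ j) := by
  intro x
  have h := hA fun k => ∑ i with σ i = k, x i
  have : ∑ k, ∑ l, ⟪∑ i with σ i = k, x i, A k l (∑ j with σ j = l, x j)⟫_ℂ =
      ∑ i, ∑ j, ⟪x i, A (σ i) (σ j) (x j)⟫_ℂ := by
    have h1 : ∀ k, ∑ l, ⟪∑ i with σ i = k, x i, A k l (∑ j with σ j = l, x j)⟫_ℂ =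
        ∑ i with σ i = k, ∑ j, ⟪x i, A (σ i) (σ j) (x j)⟫_ℂ := by
      intro k
      rw [Finset.sum_congr rfl fun l _ => sum_inner _ _ _, Finset.sum_comm]
      refine Finset.sum_congr rfl fun i hi => ?_
      rw [← Finset.sum_fiberwise Finset.univ σ]
      refine Finset.sum_congr rfl fun l _ => ?_
      rw [map_sum, inner_sum]
      refine Finset.sum_congr rfl fun j hj => ?_
      rw [(Finset.mem_filter.1 hi).2, (Finset.mem_filter.1 hj).2]
    rw [Finset.sum_congr rfl fun k _ => h1 k, Finset.sum_fiberwise]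
  rwa [this] at h

theorem IsPosMatrix.star_apply [CompleteSpace E] {n : ℕ} {A : Fin n → Fin n → (E →L[ℂ] E)}
    (hA : IsPosMatrix A) (i j : Fin n) : star (A i j) = A j i := by
  ext x
  refine ext_inner_left ℂ fun y => ?_
  have h := ((hA.submatrix ![j, i]).offDiag y x).1
  simp only [Matrix.cons_val_zero, Matrix.cons_val_one] at h
  rw [ContinuousLinearMap.star_eq_adjoint, ContinuousLinearMap.adjoint_inner_right,
    ← inner_conj_symm, h, Complex.conj_conj]

/-- The positive `2 × 2` matrix through which complete positivity controls the value at a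
non-positive `B`: its image under the map yields both compatibility with adjoints and norm bounds.
-/
theorem isPosMatrix_norm [CompleteSpace E] (B : E →L[ℂ] E) :
    IsPosMatrix ![![((‖B‖ : ℝ) : ℂ) • (1 : E →L[ℂ] E), B],
      ![star B, ((‖B‖ : ℝ) : ℂ) • (1 : E →L[ℂ] E)]] := by
  intro x
  simp only [Fin.sum_univ_two, Matrix.cons_val_zero, Matrix.cons_val_one,
    smul_apply, one_apply_eq_self, inner_smul_right,
    ContinuousLinearMap.star_eq_adjoint, ContinuousLinearMap.adjoint_inner_right]
  rw [← inner_conj_symm (B (x 1)) (x 0), inner_self_eq_norm_sq_to_K, inner_self_eq_norm_sq_to_K]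
  have h1 : |(⟪x 0, B (x 1)⟫_ℂ).re| ≤ ‖x 0‖ * (‖B‖ * ‖x 1‖) :=
    (Complex.abs_re_le_norm _).trans ((norm_inner_le_norm _ _).trans
      (mul_le_mul_of_nonneg_left (B.le_opNorm _) (norm_nonneg _)))
  have h2 := (abs_le.1 h1).1
  generalize ⟪x 0, B (x 1)⟫_ℂ = a at h1 h2 ⊢
  have h3 : 0 ≤ ‖B‖ * (‖x 0‖ - ‖x 1‖) ^ 2 := by positivity
  have h4 : 0 ≤ ‖B‖ * (‖x 0‖ ^ 2 + ‖x 1‖ ^ 2) := by positivity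
  rw [Complex.le_def]
  constructor
  · simp [← Complex.ofReal_pow]
    nlinarith
  · simp [← Complex.ofReal_pow]

theorem IsCP.inner_star [CompleteSpace E] {φ : (E →L[ℂ] E) →ₗ[ℂ] (F →L[ℂ] F)} (hφ : IsCP φ)
    (B : E →L[ℂ] E) (x y : F) :
    ⟪y, φ (star B) x⟫_ℂ = starRingEnd ℂ ⟪x, φ B y⟫_ℂ ∧
      2 * ‖⟪x, φ B y⟫_ℂ‖ ≤ ‖B‖ * (⟪x, φ 1 x⟫_ℂ + ⟪y, φ 1 y⟫_ℂ).re := by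
  have := (hφ 2 _ (isPosMatrix_norm B)).offDiag x y
  simp at this ⊢
  refine ⟨this.1, this.2.trans (le_of_eq ?_)⟩
  ring

theorem IsCP.star_apply [CompleteSpace E] [CompleteSpace F]
    {φ : (E →L[ℂ] E) →ₗ[ℂ] (F →L[ℂ] F)} (hφ : IsCP φ) (B : E →L[ℂ] E) :
    φ (star B) = star (φ B) := by
  ext x
  refine ext_inner_left ℂ fun y => ?_
  rw [(hφ.inner_star B x y).1, ContinuousLinearMap.star_eq_adjoint,
    ContinuousLinearMap.adjoint_inner_right, inner_conj_symm]

theorem IsCP.inner_nonneg {φ : (E →L[ℂ] E) →ₗ[ℂ] (F →L[ℂ] F)} (hφ : IsCP φ) {B : E →L[ℂ] E}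
    (hB : ∀ x, 0 ≤ ⟪x, B x⟫_ℂ) (x : F) : 0 ≤ ⟪x, φ B x⟫_ℂ := by
  have := hφ 1 (fun _ _ => B) (fun x => by simpa using hB (x 0)) fun _ => x
  simpa using this

/-- A completely positive map dominated by `χ` is bounded by `‖χ 1‖`. -/
theorem IsCP.norm_apply_le [CompleteSpace E] {φ χ : (E →L[ℂ] E) →ₗ[ℂ] (F →L[ℂ] F)}
    (hφ : IsCP φ) (hχ : IsCP (χ - φ)) (B : E →L[ℂ] E) : ‖φ B‖ ≤ ‖χ 1‖ * ‖B‖ := by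
  have hle : ∀ x : F, ‖x‖ = 1 → (⟪x, φ 1 x⟫_ℂ).re ≤ ‖χ 1‖ := by
    intro x hx
    have h := (Complex.le_def.1 (hχ.inner_nonneg (B := 1) (fun x => by simp) x)).1
    simp only [LinearMap.sub_apply, sub_apply, inner_sub_right,
      Complex.sub_re, Complex.zero_re] at h
    have h2 : (⟪x, χ 1 x⟫_ℂ).re ≤ ‖χ 1‖ := by
      refine (Complex.re_le_norm _).trans ((norm_inner_le_norm _ _).trans ?_)
      have := (χ 1).le_opNorm x
      rw [hx] at this ⊢
      linarith
    linarith
  refine ContinuousLinearMap.opNorm_le_of_unit_norm (by positivity) fun y hy => ?_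
  by_cases h0 : φ B y = 0
  · rw [h0, norm_zero]; positivity
  have hn : ‖φ B y‖ ≠ 0 := norm_ne_zero_iff.2 h0
  -- The unit vector in the direction of `φ B y`, so that the off-diagonal estimate at `(x, y)`
  -- bounds the full norm.
  set x : F := ((‖φ B y‖⁻¹ : ℝ) : ℂ) • φ B y with hxdef
  have hx : ‖x‖ = 1 := by
    rw [hxdef, norm_smul, Complex.norm_real, norm_inv, norm_norm, inv_mul_cancel₀ hn]
  have h := (hφ.inner_star B x y).2
  have hxy : ‖⟪x, φ B y⟫_ℂ‖ = ‖φ B y‖ := by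
    rw [hxdef, inner_smul_left, inner_self_eq_norm_sq_to_K, Complex.conj_ofReal]
    simp only [norm_mul, Complex.norm_real, norm_inv, norm_norm, Complex.coe_algebraMap, norm_pow]
    field_simp
  rw [hxy, Complex.add_re] at h
  have h1 := hle x hx
  have h2 := hle y hy
  nlinarith [mul_le_mul_of_nonneg_left h1 (norm_nonneg B),
    mul_le_mul_of_nonneg_left h2 (norm_nonneg B)]

end positivity

end QWeight

/-! ### Conditionally negative maps and null vectors of positive matrices. -/

namespace QWeight

section condNeg

variable {E : Type*} [NormedAddCommGroup E] [InnerProductSpace ℂ E] [FiniteDimensional ℂ E]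

/-- Conditional negativity of a linear map of `B(E)` into itself, for a finite-dimensional Hilbert
space `E`. -/
def CondNeg (φ : Module.End ℂ (E →L[ℂ] E)) : Prop :=
  (∀ A, φ (star A) = star (φ A)) ∧ ∀ (n : ℕ) (A : Fin n → (E →L[ℂ] E)) (f : Fin n → E),
    ∑ i, A i (f i) = 0 → ∑ i, ∑ j, ⟪f i, φ (star (A i) * A j) (f j)⟫_ℂ ≤ 0

theorem neg_condition_iff (φ : Module.End ℂ (E →L[ℂ] E)) (A : E →L[ℂ] E) :
    (-φ) (star A) = star ((-φ) A) ↔ φ (star A) = star (φ A) := by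
  rw [LinearMap.neg_apply, LinearMap.neg_apply, star_neg, neg_inj]

theorem isCondNeg_iff {p : ℕ} {φ : Module.End ℂ (BK p)} : IsCondNeg φ ↔ CondNeg φ := by
  have h2 : ∀ (n : ℕ) (A : Fin n → BK p) (f : Fin n → K p),
      ∑ i, ∑ j, ⟪f i, (-φ) (star (A i) * A j) (f j)⟫_ℂ =
      -∑ i, ∑ j, ⟪f i, φ (star (A i) * A j) (f j)⟫_ℂ := by
    intro n A f
    simp only [LinearMap.neg_apply, neg_apply, inner_neg_right, Finset.sum_neg_distrib]
  refine and_congr (forall_congr' fun A => neg_condition_iff φ A) (forall_congr' fun n => forall_congr' fun A =>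
    forall_congr' fun f => imp_congr_right fun _ => ?_)
  rw [h2]
  exact neg_nonneg

theorem CondNeg.smul {φ : Module.End ℂ (E →L[ℂ] E)} (hφ : CondNeg φ) {c : ℝ} (hc : 0 ≤ c) :
    CondNeg ((c : ℂ) • φ) := by
  refine ⟨fun A => by simp [hφ.1, star_smul], fun n A f h => ?_⟩
  have := mul_nonpos_of_nonneg_of_nonpos (Complex.zero_le_real.2 hc) (hφ.2 n A f h)
  simpa only [LinearMap.smul_apply, smul_apply, inner_smul_right, Finset.mul_sum] using this

theorem tendsto_sum_inner {F : Type*} [NormedAddCommGroup F] [InnerProductSpace ℂ F]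
    {α : Type*} {l : Filter α} {n : ℕ} {A : α → Fin n → Fin n → (F →L[ℂ] F)}
    {B : Fin n → Fin n → (F →L[ℂ] F)} (h : ∀ i j, Tendsto (fun t => A t i j) l (𝓝 (B i j)))
    (f : Fin n → F) :
    Tendsto (fun t => ∑ i, ∑ j, ⟪f i, A t i j (f j)⟫_ℂ) l (𝓝 (∑ i, ∑ j, ⟪f i, B i j (f j)⟫_ℂ)) :=
  tendsto_finsetSum _ fun i _ => tendsto_finsetSum _ fun j _ =>
    tendsto_const_nhds.inner (((ContinuousLinearMap.apply ℂ F (f j)).continuous.tendsto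
      _).comp (h i j))

theorem CondNeg.of_tendsto {α : Type*} {l : Filter α} [l.NeBot]
    {φ : α → Module.End ℂ (E →L[ℂ] E)} {χ : Module.End ℂ (E →L[ℂ] E)}
    (hφ : ∀ᶠ t in l, CondNeg (φ t)) (h : ∀ A, Tendsto (fun t => φ t A) l (𝓝 (χ A))) :
    CondNeg χ := by
  refine ⟨fun A => tendsto_nhds_unique ((h (star A)).congr' (hφ.mono fun t ht => ht.1 A))
    (h A).star, fun n A f hf => ?_⟩
  exact le_of_tendsto (tendsto_sum_inner (fun i j => h (star (A i) * A j)) f)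
    (hφ.mono fun t ht => ht.2 n A f hf)

theorem CondNeg.sub_cp {φ χ : Module.End ℂ (E →L[ℂ] E)} (hφ : CondNeg φ) (hχ : IsCP χ) :
    CondNeg (φ - χ) := by
  refine ⟨fun A => by simp [hφ.1, hχ.star_apply], fun n A f h => ?_⟩
  have := sub_nonpos_of_le ((hφ.2 n A f h).trans (hχ n _ (isPosMatrix_star_mul A) f))
  simpa only [LinearMap.sub_apply, sub_apply, inner_sub_right, Finset.sum_sub_distrib] using this

theorem sum_inner_star_mul {n : ℕ} (A : Fin n → (E →L[ℂ] E)) (f : Fin n → E) :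
    ∑ i, ∑ j, ⟪f i, (star (A i) * A j) (f j)⟫_ℂ = ⟪∑ i, A i (f i), ∑ i, A i (f i)⟫_ℂ := by
  simp only [sum_inner, inner_sum, mul_apply_eq_comp,
    ContinuousLinearMap.star_eq_adjoint, ContinuousLinearMap.adjoint_inner_right]
  rw [Finset.sum_comm]

theorem condNeg_one : CondNeg (1 : Module.End ℂ (E →L[ℂ] E)) := by
  refine ⟨fun A => rfl, fun n A f hf => ?_⟩
  simp only [Module.End.one_apply]
  rw [sum_inner_star_mul, hf, inner_zero_left]

/-- A positive matrix of operators is a finite sum of matrices of rank one operators. -/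
theorem IsPosMatrix.exists_eq_sum {n : ℕ} {A : Fin n → Fin n → (E →L[ℂ] E)}
    (hA : IsPosMatrix A) : ∃ (m : ℕ) (u : Fin m → Fin n → E), ∀ i j,
      A i j = ∑ r, InnerProductSpace.rankOne ℂ (u r i) (u r j) := by
  classical
  let e := stdOrthonormalBasis ℂ E
  -- All matrix elements collected into one scalar positive semidefinite matrix, whose decomposition
  -- into rank one terms is then translated back.
  let M : Matrix (Fin n × Fin (Module.finrank ℂ E)) (Fin n × Fin (Module.finrank ℂ E)) ℂ :=
    Matrix.of fun x y => ⟪e x.2, A x.1 y.1 (e y.2)⟫_ℂ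
  have hM : M.PosSemidef := by
    refine .of_dotProduct_mulVec_nonneg (Matrix.IsHermitian.ext fun x y => ?_) fun x => ?_
    · change star ⟪e y.2, A y.1 x.1 (e x.2)⟫_ℂ = ⟪e x.2, A x.1 y.1 (e y.2)⟫_ℂ
      rw [← hA.star_apply y.1 x.1, ContinuousLinearMap.star_eq_adjoint,
        ContinuousLinearMap.adjoint_inner_right, ← inner_conj_symm]
      exact star_star _
    · refine (hA fun i => ∑ a, x (i, a) • e a).trans (le_of_eq ?_)
      simp only [Matrix.mulVec, dotProduct, Fintype.sum_prod_type, Finset.mul_sum, Pi.star_apply,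
        map_sum, map_smul, sum_inner, inner_sum, inner_smul_left, inner_smul_right]
      refine Finset.sum_congr rfl fun i _ => ?_
      conv_lhs => rw [Finset.sum_comm]; enter [2, a]; rw [Finset.sum_comm]
      rw [Finset.sum_comm]
      refine Finset.sum_congr rfl fun y _ => ?_
      rw [Finset.sum_comm]
      refine Finset.sum_congr rfl fun j _ => Finset.sum_congr rfl fun b _ => ?_
      simp only [M, Matrix.of_apply, starRingEnd_apply]
      ring
  obtain ⟨m, v, hv⟩ := Matrix.posSemidef_iff_eq_sum_vecMulVec.1 hM
  have hu : ∀ r i a, ⟪e a, ∑ a, v r (i, a) • e a⟫_ℂ = v r (i, a) := by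
    intro r i a
    simp [e.inner_eq_ite]
  refine ⟨m, fun r i => ∑ a, v r (i, a) • e a, fun i j => ?_⟩
  refine ContinuousLinearMap.coe_injective (e.toBasis.ext fun b => ?_)
  refine e.repr.injective (PiLp.ext fun a => ?_)
  rw [e.repr_apply_apply, e.repr_apply_apply]
  have h := congrFun (congrFun hv (i, a)) (j, b)
  simp only [Matrix.sum_apply, Matrix.vecMulVec_apply, Pi.star_apply, M, Matrix.of_apply] at h
  rw [e.coe_toBasis, ContinuousLinearMap.coe_coe, ContinuousLinearMap.coe_coe, h, sum_apply,
    inner_sum]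
  refine Finset.sum_congr rfl fun r _ => ?_
  rw [InnerProductSpace.rankOne_apply, inner_smul_right, hu, ← inner_conj_symm, hu, mul_comm]
  rfl

/-- Puts rank one matrices into the form `A_i^* A_j` in which conditional negativity is stated; the
auxiliary unit vector `e` is arbitrary. -/
theorem rankOne_eq_star_mul {e : E} (he : ‖e‖ = 1) (u v : E) :
    InnerProductSpace.rankOne ℂ u v = star (InnerProductSpace.rankOne ℂ e u) *
      InnerProductSpace.rankOne ℂ e v := by
  rw [ContinuousLinearMap.star_eq_adjoint, InnerProductSpace.adjoint_rankOne]
  ext x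
  simp [InnerProductSpace.rankOne_apply, inner_self_eq_norm_sq_to_K, he]

/-- A conditionally negative map is nonpositive on the null vectors of a positive matrix. -/
theorem CondNeg.sum_inner_nonpos {φ : Module.End ℂ (E →L[ℂ] E)} (hφ : CondNeg φ) {n : ℕ}
    {A : Fin n → Fin n → (E →L[ℂ] E)} (hA : IsPosMatrix A) {f : Fin n → E}
    (hf : ∑ i, ∑ j, ⟪f i, A i j (f j)⟫_ℂ = 0) :
    ∑ i, ∑ j, ⟪f i, φ (A i j) (f j)⟫_ℂ ≤ 0 := by
  obtain ⟨m, u, hu⟩ := hA.exists_eq_sum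
  by_cases hE : Nontrivial E
  swap
  · rw [not_nontrivial_iff_subsingleton] at hE
    simp [Subsingleton.elim (f _) 0]
  obtain ⟨e, he⟩ := exists_norm_eq E zero_le_one
  have hsum : ∀ (χ : Module.End ℂ (E →L[ℂ] E)), ∑ i, ∑ j, ⟪f i, χ (A i j) (f j)⟫_ℂ =
      ∑ r, ∑ i, ∑ j, ⟪f i, χ (star (InnerProductSpace.rankOne ℂ e (u r i)) *
        InnerProductSpace.rankOne ℂ e (u r j)) (f j)⟫_ℂ := by
    intro χ
    simp only [← rankOne_eq_star_mul he, hu, map_sum, sum_apply, inner_sum]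
    conv_rhs => rw [Finset.sum_comm]; enter [2, i]; rw [Finset.sum_comm]
  have h1 := hsum 1
  simp only [Module.End.one_apply, hf, sum_inner_star_mul] at h1
  -- The vanishing total is a sum of squared norms, so `f` satisfies the constraint of conditional
  -- negativity for each rank one term separately.
  have h2 := (Finset.sum_eq_zero_iff_of_nonneg fun r _ => zero_le_inner_self _).1 h1.symm
  rw [hsum]
  exact Finset.sum_nonpos fun r hr => hφ.2 n _ f (inner_self_eq_zero.1 (h2 r hr))

end condNeg
end QWeight

/-! ### The minimum principle and completely positive inverses. -/

namespace QWeight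

section inverse

variable {E : Type*} [NormedAddCommGroup E] [InnerProductSpace ℂ E]

theorem sum_inner_add_smul_diag {n : ℕ} (Z : Fin n → Fin n → (E →L[ℂ] E)) (X : E →L[ℂ] E) (s : ℝ)
    (u : Fin n → E) :
    ∑ i, ∑ j, ⟪u i, (Z i j + (s : ℂ) • (if i = j then X else 0)) (u j)⟫_ℂ =
      ∑ i, ∑ j, ⟪u i, Z i j (u j)⟫_ℂ + s * ∑ i, ⟪u i, X (u i)⟫_ℂ := by
  simp only [add_apply, smul_apply, inner_add_right, inner_smul_right, Finset.sum_add_distrib,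
    Finset.mul_sum]
  congr 1
  refine Finset.sum_congr rfl fun i _ => ?_
  rw [Finset.sum_eq_single i] <;> simp +contextual [eq_comm]

theorem sum_inner_smul {n : ℕ} (Z : Fin n → Fin n → (E →L[ℂ] E)) (c : ℝ) (u : Fin n → E) :
    ∑ i, ∑ j, ⟪((c : ℂ) • u) i, Z i j (((c : ℂ) • u) j)⟫_ℂ =
      ((c ^ 2 : ℝ) : ℂ) * ∑ i, ∑ j, ⟪u i, Z i j (u j)⟫_ℂ := by
  simp only [Pi.smul_apply, map_smul, inner_smul_left, inner_smul_right, Finset.mul_sum,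
    Complex.conj_ofReal]
  refine Finset.sum_congr rfl fun i _ => Finset.sum_congr rfl fun j _ => ?_
  push_cast
  ring

theorem map_inverse_apply {φ : Module.End ℂ (E →L[ℂ] E)} (hφ : IsUnit φ) (A : E →L[ℂ] E) :
    φ (Ring.inverse φ A) = A := by
  rw [← Module.End.mul_apply, Ring.mul_inverse_cancel _ hφ, Module.End.one_apply]

theorem inverse_map_apply {φ : Module.End ℂ (E →L[ℂ] E)} (hφ : IsUnit φ) (A : E →L[ℂ] E) :
    Ring.inverse φ (φ A) = A := by
  rw [← Module.End.mul_apply, Ring.inverse_mul_cancel _ hφ, Module.End.one_apply]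

/-- Inversion reverses the order on maps with completely positive inverse. -/
theorem IsCP.inverse_sub_inverse {φ χ : Module.End ℂ (E →L[ℂ] E)} (hφ : IsUnit φ) (hχ : IsUnit χ)
    (hφcp : IsCP (Ring.inverse φ)) (hχcp : IsCP (Ring.inverse χ)) (h : IsCP (χ - φ)) :
    IsCP (Ring.inverse φ - Ring.inverse χ) := by
  have : Ring.inverse φ - Ring.inverse χ = Ring.inverse φ ∘ₗ (χ - φ) ∘ₗ Ring.inverse χ := by
    ext1 A
    simp [map_inverse_apply hχ, inverse_map_apply hφ]
  rw [this]
  exact hφcp.comp (h.comp hχcp)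

variable [FiniteDimensional ℂ E]

/-- A minimum principle for conditionally negative maps. -/
theorem CondNeg.isPosMatrix_of_map {L : Module.End ℂ (E →L[ℂ] E)} (hL : CondNeg L)
    {X : E →L[ℂ] E} (hX0 : ∀ x, 0 ≤ ⟪x, X x⟫_ℂ) (hX : ∀ x, x ≠ 0 → 0 < (⟪x, X x⟫_ℂ).re)
    (hLX : ∀ x, ‖x‖ ^ 2 ≤ (⟪x, L X x⟫_ℂ).re) {n : ℕ} {Z : Fin n → Fin n → (E →L[ℂ] E)}
    (hZ : ∀ i j, star (Z i j) = Z j i)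
    (hLZ : ∀ v : Fin n → E, 0 ≤ (∑ i, ∑ j, ⟪v i, L (Z i j) (v j)⟫_ℂ).re) : IsPosMatrix Z := by
  set a : (Fin n → E) → ℂ := fun v => ∑ i, ∑ j, ⟪v i, Z i j (v j)⟫_ℂ with ha
  set b : (Fin n → E) → ℂ := fun v => ∑ i, ⟪v i, X (v i)⟫_ℂ with hb
  have ha_im : ∀ v, (a v).im = 0 := by
    intro v
    rw [← Complex.conj_eq_iff_im, ha]
    simp only [map_sum, inner_conj_symm]
    rw [Finset.sum_comm]
    refine Finset.sum_congr rfl fun i _ => Finset.sum_congr rfl fun j _ => ?_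
    rw [← hZ j i, ContinuousLinearMap.star_eq_adjoint, ContinuousLinearMap.adjoint_inner_right]
  have hb0 : ∀ v, 0 ≤ b v := fun v => Finset.sum_nonneg fun i _ => hX0 _
  have hbpos : ∀ v, v ≠ 0 → 0 < (b v).re := by
    intro v hv
    obtain ⟨i, hi⟩ := Function.ne_iff.1 hv
    simp only [hb, Complex.re_sum]
    exact Finset.sum_pos' (fun i _ => (Complex.le_def.1 (hX0 _)).1) ⟨i, Finset.mem_univ _, hX _ hi⟩
  have hbsmul : ∀ (c : ℝ) v, b ((c : ℂ) • v) = ((c ^ 2 : ℝ) : ℂ) * b v := by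
    intro c v
    simp only [hb, Pi.smul_apply, map_smul, inner_smul_left, inner_smul_right, Finset.mul_sum,
      Complex.conj_ofReal]
    refine Finset.sum_congr rfl fun i _ => ?_
    push_cast
    ring
  have hasmul : ∀ (c : ℝ) v, a ((c : ℂ) • v) = ((c ^ 2 : ℝ) : ℂ) * a v := sum_inner_smul Z
  have hac : Continuous a := by
    simp only [ha]
    fun_prop
  have hbc : Continuous b := by
    simp only [hb]
    fun_prop
  intro v₀
  refine Complex.le_def.2 ⟨?_, (ha_im v₀).symm⟩
  by_contra hneg
  rw [not_le, Complex.zero_re] at hneg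
  change (a v₀).re < 0 at hneg
  have hv₀ : v₀ ≠ 0 := by
    rintro rfl
    simp [ha] at hneg
  have hsph : ∀ v : Fin n → E, v ≠ 0 →
      ((‖v‖⁻¹ : ℝ) : ℂ) • v ∈ Metric.sphere (0 : Fin n → E) 1 := by
    intro v hv
    rw [mem_sphere_zero_iff_norm, norm_smul, Complex.norm_real, norm_inv, norm_norm,
      inv_mul_cancel₀ (norm_ne_zero_iff.2 hv)]
  have hne : ∀ v ∈ Metric.sphere (0 : Fin n → E) 1, v ≠ 0 := fun v hv => by
    rintro rfl
    simp at hv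
  have : ProperSpace E := FiniteDimensional.proper_rclike ℂ E
  -- If `Z` is not positive, the quotient of the form of `Z` by that of the diagonal of `X` has a
  -- negative minimum, attained by homogeneity and compactness of the sphere.
  obtain ⟨v, hvS, hmin⟩ := (isCompact_sphere (0 : Fin n → E) 1).exists_isMinOn ⟨_, hsph v₀ hv₀⟩
    (f := fun v => (a v).re / (b v).re)
    ((Complex.continuous_re.comp hac).continuousOn.div (Complex.continuous_re.comp hbc).continuousOn
      fun v hv => (hbpos v (hne v hv)).ne')
  have hmin' : ∀ u : Fin n → E, u ≠ 0 → (a v).re / (b v).re ≤ (a u).re / (b u).re := by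
    intro u hu
    have h := hmin (hsph u hu)
    simp only [Set.mem_ofPred_eq, hasmul, hbsmul, Complex.re_ofReal_mul] at h
    rwa [mul_div_mul_left] at h
    have := norm_ne_zero_iff.2 hu
    positivity
  -- The least multiple of `X` that makes `Z` positive; the minimiser `v` is then a null vector of
  -- `Z + sX`.
  set s : ℝ := -((a v).re / (b v).re) with hs
  have hs0 : 0 < s := by
    have h1 := hmin' v₀ hv₀
    have h2 : (a v₀).re / (b v₀).re < 0 := div_neg_of_neg_of_pos hneg (hbpos v₀ hv₀)
    linarith
  have hW : IsPosMatrix fun i j => Z i j + (s : ℂ) • (if i = j then X else 0) := by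
    intro u
    rw [sum_inner_add_smul_diag]
    change 0 ≤ a u + s * b u
    have him := (Complex.le_def.1 (hb0 u)).2
    refine Complex.le_def.2 ⟨?_, ?_⟩
    · rw [Complex.add_re, Complex.re_ofReal_mul, Complex.zero_re]
      by_cases hu : u = 0
      · simp [hu, ha, hb]
      · have h1 := hmin' u hu
        rw [le_div_iff₀ (hbpos u hu)] at h1
        rw [hs]
        linarith
    · rw [Complex.add_im, Complex.im_ofReal_mul, ha_im, ← him]
      simp
  have hnull : ∑ i, ∑ j, ⟪v i, (Z i j + (s : ℂ) • (if i = j then X else 0)) (v j)⟫_ℂ = 0 := by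
    rw [sum_inner_add_smul_diag]
    change a v + s * b v = 0
    have him := (Complex.le_def.1 (hb0 v)).2
    apply Complex.ext
    · rw [Complex.add_re, Complex.re_ofReal_mul, hs, Complex.zero_re]
      have := (hbpos v (hne v hvS)).ne'
      field_simp
      ring
    · rw [Complex.add_im, Complex.im_ofReal_mul, ha_im, ← him]
      simp
  -- At the null vector `v` the form of `L (Z + sX)` is nonpositive, whereas `L Z` contributes at
  -- least zero and `s L X` strictly more than zero.
  have hfin := (Complex.le_def.1 (hL.sum_inner_nonpos hW hnull)).1
  have hLW : ∀ i j, L (Z i j + (s : ℂ) • (if i = j then X else 0)) =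
      L (Z i j) + (s : ℂ) • (if i = j then L X else 0) := by
    intro i j
    rw [map_add, map_smul]
    split_ifs <;> simp
  simp only [hLW] at hfin
  rw [sum_inner_add_smul_diag, Complex.add_re, Complex.re_ofReal_mul] at hfin
  have h1 := hLZ v
  obtain ⟨i, hi⟩ := Function.ne_iff.1 (hne v hvS)
  have h2 : 0 < ∑ i, (⟪v i, L X (v i)⟫_ℂ).re :=
    Finset.sum_pos' (fun i _ => (sq_nonneg _).trans (hLX _))
      ⟨i, Finset.mem_univ _, lt_of_lt_of_le (by have := norm_pos_iff.2 hi; positivity) (hLX (v i))⟩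
  rw [← Complex.re_sum] at h2
  have h3 := mul_pos hs0 h2
  rw [Complex.zero_re] at hfin
  linarith

theorem star_add_star_inner_im (S : E →L[ℂ] E) (x : E) : (⟪x, (S + star S) x⟫_ℂ).im = 0 := by
  rw [add_apply, inner_add_right, ContinuousLinearMap.star_eq_adjoint,
    ContinuousLinearMap.adjoint_inner_right, ← inner_conj_symm x (S x),
    Complex.add_im, Complex.conj_im, neg_add_cancel]

/-- A completely positive bijection maps the identity to a strictly positive operator. -/
theorem IsCP.inverse_one_pos {φ : Module.End ℂ (E →L[ℂ] E)} (hφ : IsUnit φ)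
    (hcp : IsCP (Ring.inverse φ)) {x : E} (hx : x ≠ 0) :
    0 < (⟪x, Ring.inverse φ 1 x⟫_ℂ).re := by
  -- Symmetrised so that `‖S‖ - S` is positive; applying the inverse gives `‖S‖ φ⁻¹(1) ≥ 2`.
  set S := φ 1 + star (φ 1) with hS
  have hinv : Ring.inverse φ S = (2 : ℂ) • 1 := by
    rw [hS, map_add, hcp.star_apply, inverse_map_apply hφ, star_one, two_smul]
  have hpos : ∀ y, 0 ≤ ⟪y, (((‖S‖ : ℝ) : ℂ) • (1 : E →L[ℂ] E) - S) y⟫_ℂ := by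
    intro y
    have h1 : (⟪y, S y⟫_ℂ).re ≤ ‖y‖ * (‖S‖ * ‖y‖) := (Complex.re_le_norm _).trans
      ((norm_inner_le_norm _ _).trans (mul_le_mul_of_nonneg_left (S.le_opNorm _) (norm_nonneg _)))
    have h2 := star_add_star_inner_im (φ 1) y
    rw [← hS] at h2
    rw [sub_apply, smul_apply, one_apply_eq_self, inner_sub_right, inner_smul_right,
      inner_self_eq_norm_sq_to_K]
    refine Complex.le_def.2 ⟨?_, ?_⟩
    · simp [← Complex.ofReal_pow]
      linarith
    · simp [← Complex.ofReal_pow, h2]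
  have h := (Complex.le_def.1 (hcp.inner_nonneg hpos x)).1
  rw [map_sub, map_smul, hinv, sub_apply, smul_apply, smul_apply, one_apply_eq_self,
    inner_sub_right, inner_smul_right, inner_smul_right, inner_self_eq_norm_sq_to_K] at h
  simp [← Complex.ofReal_pow] at h
  have hx' : 0 < ‖x‖ ^ 2 := by have := norm_pos_iff.2 hx; positivity
  by_contra hcon
  nlinarith [norm_nonneg S]

/-- A conditionally negative map that dominates an invertible map with completely positive inverse
is itself invertible with completely positive inverse. -/
theorem CondNeg.isUnit_and_isCP_inverse {L φ : Module.End ℂ (E →L[ℂ] E)} (hL : CondNeg L)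
    (hφ : IsUnit φ) (hcp : IsCP (Ring.inverse φ)) (h : IsCP (L - φ)) :
    IsUnit L ∧ IsCP (Ring.inverse L) := by
  -- This `X` is strictly positive and `L X ≥ φ X = 1`, as the minimum principle requires of its
  -- comparison element.
  set X := Ring.inverse φ 1 with hXdef
  have hone : ∀ x : E, 0 ≤ ⟪x, (1 : E →L[ℂ] E) x⟫_ℂ := fun x => zero_le_inner_self x
  have hX0 : ∀ x, 0 ≤ ⟪x, X x⟫_ℂ := hcp.inner_nonneg hone
  have hX : ∀ x, x ≠ 0 → 0 < (⟪x, X x⟫_ℂ).re := fun x hx => hcp.inverse_one_pos hφ hx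
  have hLX : ∀ x, ‖x‖ ^ 2 ≤ (⟪x, L X x⟫_ℂ).re := by
    intro x
    have h1 := (Complex.le_def.1 (h.inner_nonneg hX0 x)).1
    rw [LinearMap.sub_apply, hXdef, map_inverse_apply hφ, sub_apply, one_apply_eq_self,
      inner_sub_right, inner_self_eq_norm_sq_to_K] at h1
    simp [← Complex.ofReal_pow] at h1
    exact h1
  -- For self-adjoint `A` in the kernel, the principle applies to both `A` and `-A`. The general
  -- case follows by splitting into real and imaginary parts.
  have hself : ∀ A : E →L[ℂ] E, star A = A → L A = 0 → A = 0 := by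
    intro A hA hLA
    have h1 := hL.isPosMatrix_of_map hX0 hX hLX (n := 1) (Z := fun _ _ => A) (fun _ _ => hA)
      (by simp [hLA])
    have h2 := hL.isPosMatrix_of_map hX0 hX hLX (n := 1) (Z := fun _ _ => -A)
      (fun _ _ => by rw [star_neg, hA]) (by simp [hLA])
    refine ContinuousLinearMap.coe_injective ((inner_map_self_eq_zero (A : E →ₗ[ℂ] E)).1 fun x => ?_)
    have h3 := h1 fun _ => x
    have h4 := h2 fun _ => x
    simp at h3 h4
    rw [← inner_conj_symm, ContinuousLinearMap.coe_coe, le_antisymm h4 h3, map_zero]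
  have hinj : Function.Injective L := by
    rw [injective_iff_map_eq_zero]
    intro A hA
    have hA' : L (star A) = 0 := by rw [hL.1, hA, star_zero]
    have h1 := hself (A + star A) (by rw [star_add, star_star, add_comm])
      (by rw [map_add, hA, hA', add_zero])
    have h2 := hself (Complex.I • (A - star A))
      (by rw [star_smul, star_sub, star_star]; simp [← smul_neg])
      (by rw [map_smul, map_sub, hA, hA', sub_zero, smul_zero])
    have h3 := (smul_eq_zero.1 h2).resolve_left Complex.I_ne_zero
    have h4 : (2 : ℂ) • A = 0 := by
      rw [two_smul]
      calc A + A = (A + star A) + (A - star A) := by abel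
        _ = 0 := by rw [h1, h3, add_zero]
    exact (smul_eq_zero.1 h4).resolve_left two_ne_zero
  have hunit : IsUnit L := (LinearMap.isUnit_iff_ker_eq_bot L).2 (LinearMap.ker_eq_bot.2 hinj)
  refine ⟨hunit, fun n A hA => hL.isPosMatrix_of_map hX0 hX hLX (fun i j => hinj ?_) fun v => ?_⟩
  · rw [hL.1, map_inverse_apply hunit, map_inverse_apply hunit, hA.star_apply]
  · simp only [map_inverse_apply hunit]
    exact (Complex.le_def.1 (hA v)).1

/-- A map that is both completely positive and conditionally negative is a scalar. -/
theorem IsCP.exists_eq_smul_one {φ : Module.End ℂ (E →L[ℂ] E)} (hcp : IsCP φ) (hcn : CondNeg φ) :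
    ∃ c : ℂ, φ = c • 1 := by
  have hmul : ∀ A, φ A = φ 1 * A := by
    intro A
    ext f
    rw [mul_apply_eq_comp]
    refine ext_inner_left ℂ fun g => ?_
    rw [← sub_eq_zero, ← inner_sub_right]
    -- The family `(A, 1)` with vectors `(f, -A f)` satisfies the constraint, so its form is
    -- nonpositive and nonnegative at once.
    have h0 : ∑ i, ∑ j, ⟪(![f, -A f] : Fin 2 → E) i, φ (star ((![A, 1] : Fin 2 → _) i) *
        (![A, 1] : Fin 2 → _) j) ((![f, -A f] : Fin 2 → E) j)⟫_ℂ = 0 :=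
      le_antisymm (hcn.2 2 ![A, 1] ![f, -A f] (by simp [Fin.sum_univ_two]))
        (hcp 2 _ (isPosMatrix_star_mul ![A, 1]) _)
    have hS := (Complex.le_def.1 (hcp.inner_nonneg (B := 1) zero_le_inner_self g)).2
    -- Adding the vector `c z g`, with `|z| = 1`, to this null family changes the form by a term
    -- linear in `c` and one of order `c²`; positivity for all phases, with `c → 0`, kills the
    -- linear coefficient.
    have key : ∀ c : ℝ, 0 < c → 2 * ‖⟪g, φ A f - φ 1 (A f)⟫_ℂ‖ ≤ c * (⟪g, φ 1 g⟫_ℂ).re := by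
      intro c hc
      have h := (conj_of_forall_add_nonneg (a := c * ⟪g, φ A f - φ 1 (A f)⟫_ℂ)
        (b := c * ⟪f, φ (star A) g⟫_ℂ - c * ⟪A f, φ 1 g⟫_ℂ)
        (S := ((c ^ 2 : ℝ) : ℂ) * ⟪g, φ 1 g⟫_ℂ) (fun z hz => ?_) ?_).2
      · rw [norm_mul, Complex.norm_real, Real.norm_eq_abs, abs_of_pos hc,
          Complex.re_ofReal_mul] at h
        refine le_of_mul_le_mul_left ?_ hc
        linarith
      · have h3 := hcp 3 _ (isPosMatrix_star_mul ![A, 1, 1]) ![f, -A f, (c * z : ℂ) • g]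
        have hzz : starRingEnd ℂ z * z = 1 := by
          rw [mul_comm, Complex.mul_conj, Complex.normSq_eq_norm_sq, hz]; simp
        simp [Fin.sum_univ_two] at h0
        simp [Fin.sum_univ_three, inner_smul_left] at h3
        rw [inner_sub_right]
        convert h3 using 1
        push_cast
        linear_combination (-(c : ℂ) ^ 2 * ⟪g, φ 1 g⟫_ℂ) * hzz - h0
      · rw [Complex.im_ofReal_mul, ← hS]
        simp
    have hlim : Tendsto (fun c : ℝ => c * (⟪g, φ 1 g⟫_ℂ).re) (𝓝[>] 0) (𝓝 0) := by
      have : Tendsto (fun c : ℝ => c * (⟪g, φ 1 g⟫_ℂ).re) (𝓝 0) (𝓝 (0 * (⟪g, φ 1 g⟫_ℂ).re)) :=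
        tendsto_id.mul_const _
      rw [zero_mul] at this
      exact this.mono_left nhdsWithin_le_nhds
    have := ge_of_tendsto hlim (eventually_mem_nhdsWithin.mono fun c hc => key c hc)
    exact norm_le_zero_iff.1 (by linarith)
  -- Adjoints turn left multiplication by `φ 1` into right multiplication; commuting with the rank
  -- one operators then makes `φ 1` a scalar.
  have hcomm : ∀ A, φ 1 * A = A * φ 1 := by
    intro A
    have h1 : star (φ 1) = φ 1 := by rw [← hcp.star_apply, star_one]
    have h2 := hcp.star_apply (star A)
    rw [star_star, hmul, hmul (star A), star_mul, star_star, h1] at h2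
    exact h2
  by_cases hE : Nontrivial E
  swap
  · rw [not_nontrivial_iff_subsingleton] at hE
    exact ⟨0, Subsingleton.elim _ _⟩
  obtain ⟨e, he⟩ := exists_norm_eq E zero_le_one
  refine ⟨⟪e, φ 1 e⟫_ℂ, LinearMap.ext fun A => ?_⟩
  rw [hmul]
  ext x
  have h := DFunLike.congr_fun (hcomm (InnerProductSpace.rankOne ℂ (A x) e)) e
  simpa [InnerProductSpace.rankOne_apply, inner_self_eq_norm_sq_to_K, he] using h

end inverse
end QWeight

/-! ### Limits of inverses, of bounded families and of monotone families. -/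

namespace QWeight

section limits

/-- In finite dimension pointwise convergence is convergence of matrix entries, and the inverse is
the adjugate divided by the determinant. -/
theorem tendsto_ringInverse_apply {W : Type*} [NormedAddCommGroup W] [NormedSpace ℂ W]
    [FiniteDimensional ℂ W] {α : Type*} {l : Filter α} {N : α → Module.End ℂ W}
    {N' : Module.End ℂ W} (hN : ∀ᶠ t in l, IsUnit (N t)) (hN' : IsUnit N')
    (h : ∀ x, Tendsto (fun t => N t x) l (𝓝 (N' x))) (x : W) :
    Tendsto (fun t => Ring.inverse (N t) x) l (𝓝 (Ring.inverse N' x)) := by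
  let b := Module.finBasis ℂ W
  let T := LinearMap.toMatrixAlgEquiv b
  have hmat : ∀ {M : Module.End ℂ W}, IsUnit M → Ring.inverse M x =
      b.equivFun.symm ((T M)⁻¹.mulVec (b.equivFun x)) := by
    intro M hM
    have h1 : (T M)⁻¹ = T (Ring.inverse M) := Matrix.inv_eq_right_inv (by
      rw [← map_mul, Ring.mul_inverse_cancel _ hM, map_one])
    rw [h1, LinearEquiv.eq_symm_apply]
    exact (LinearMap.toMatrix_mulVec_repr b b (Ring.inverse M) x).symm
  have hT : Tendsto (fun t => T (N t)) l (𝓝 (T N')) := by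
    refine tendsto_pi_nhds.2 fun i => tendsto_pi_nhds.2 fun j => ?_
    simp only [T, LinearMap.toMatrixAlgEquiv_apply]
    exact ((b.coord i).continuous_of_finiteDimensional.tendsto _).comp (h (b j))
  have hdet : (T N').det ≠ 0 :=
    ((Matrix.isUnit_iff_isUnit_det _).1 (hN'.map T)).ne_zero
  have hinv : Tendsto (fun t => (T (N t))⁻¹) l (𝓝 (T N')⁻¹) := by
    simp only [Matrix.inv_def, Ring.inverse_eq_inv']
    exact (((continuous_id.matrix_det.tendsto _).comp hT).inv₀ hdet).smul
      ((continuous_id.matrix_adjugate.tendsto _).comp hT)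
  rw [hmat hN']
  refine Tendsto.congr' (hN.mono fun t ht => (hmat ht).symm) ?_
  refine (b.equivFun.symm.toLinearMap.continuous_of_finiteDimensional.tendsto _).comp ?_
  have hc : Continuous fun M : Matrix (Fin (Module.finrank ℂ W)) (Fin (Module.finrank ℂ W)) ℂ =>
      M.mulVec (b.equivFun x) :=
    continuous_id.matrix_mulVec continuous_const
  exact (hc.tendsto _).comp hinv

variable {E : Type*} [NormedAddCommGroup E] [InnerProductSpace ℂ E] [FiniteDimensional ℂ E]

/-- Bounded sets of `B(E)` are relatively compact, so every value converges along an ultrafilter;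
linearity follows from uniqueness of limits, without passing to subsequences. -/
theorem exists_ultrafilter_limit {α : Type*} (U : Ultrafilter α)
    {φ : α → Module.End ℂ (E →L[ℂ] E)} {R : ℝ} (h : ∀ᶠ t in U, ∀ A, ‖φ t A‖ ≤ R * ‖A‖) :
    ∃ χ : Module.End ℂ (E →L[ℂ] E), ∀ A, Tendsto (fun t => φ t A) U (𝓝 (χ A)) := by
  have : ProperSpace (E →L[ℂ] E) := FiniteDimensional.proper_rclike ℂ _
  have h1 : ∀ A, ∃ B, Tendsto (fun t => φ t A) U (𝓝 B) := by
    intro A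
    obtain ⟨B, _, hB⟩ := (isCompact_closedBall (0 : E →L[ℂ] E) (R * ‖A‖)).ultrafilter_le_nhds
      (U.map fun t => φ t A) (by
        rw [Filter.le_principal_iff]
        exact h.mono fun t ht => mem_closedBall_zero_iff.2 (ht A))
    exact ⟨B, hB⟩
  choose χ hχ using h1
  refine ⟨⟨⟨χ, fun A B => ?_⟩, fun c A => ?_⟩, hχ⟩
  · refine tendsto_nhds_unique (hχ (A + B)) (((hχ A).add (hχ B)).congr fun t => ?_)
    rw [map_add]
  · refine tendsto_nhds_unique (hχ (c • A)) (((hχ A).const_smul c).congr fun t => ?_)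
    rw [map_smul]

/-- A bounded family of maps that increases as `t → 0+` converges. -/
theorem exists_tendsto_of_antitone {φ : ℝ → Module.End ℂ (E →L[ℂ] E)}
    (hcp : ∀ t > 0, IsCP (φ t)) (hmono : ∀ s t, 0 < s → s ≤ t → IsCP (φ s - φ t)) {R : ℝ}
    (hR : ∀ᶠ t in 𝓝[>] (0 : ℝ), ‖φ t 1‖ ≤ R) :
    ∃ T : Module.End ℂ (E →L[ℂ] E), ∀ A, Tendsto (fun t => φ t A) (𝓝[>] 0) (𝓝 (T A)) := by
  let U : Ultrafilter ℝ := Ultrafilter.of (𝓝[>] 0)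
  have hU : (U : Filter ℝ) ≤ 𝓝[>] 0 := Ultrafilter.of_le _
  have hpos : ∀ᶠ t in 𝓝[>] (0 : ℝ), 0 < t := eventually_mem_nhdsWithin
  obtain ⟨T, hT⟩ := exists_ultrafilter_limit U (φ := φ) (R := R) (by
    filter_upwards [hU hR, hU hpos] with t h1 h2 A
    exact ((hcp t h2).norm_apply_le (χ := φ t) (by rw [sub_self]; exact IsCP.zero) A).trans
      (by gcongr))
  have hTcp : ∀ t > 0, IsCP (T - φ t) := by
    intro t ht
    refine IsCP.of_tendsto (l := (U : Filter ℝ)) (φ := fun s => φ s - φ t) ?_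
      fun A => (hT A).sub tendsto_const_nhds
    filter_upwards [hU hpos, hU (Ioc_mem_nhdsGT ht)] with s hs hst
    exact hmono s t hs hst.2
  refine ⟨T, fun A => ?_⟩
  rw [Metric.tendsto_nhds]
  intro ε hε
  have h1 : Tendsto (fun t => (T - φ t) 1) U (𝓝 0) := by
    have := (tendsto_const_nhds (x := T 1)).sub (hT 1)
    rwa [sub_self] at this
  have hε' : 0 < ε / (‖A‖ + 1) := by positivity
  -- One `t₀` with `(T - φ t₀) 1` small suffices: for `t ≤ t₀` the map `T - φ t` is dominated by `T
  -- - φ t₀`. This turns the ultrafilter limit into a genuine one.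
  obtain ⟨t₀, h2, ht₀⟩ := ((Metric.tendsto_nhds.1 h1 _ hε').and (hU hpos)).exists
  filter_upwards [Ioc_mem_nhdsGT ht₀] with t ht
  have h3 := (hTcp t ht.1).norm_apply_le (χ := T - φ t₀)
    (by rw [sub_sub_sub_cancel_left]; exact hmono t t₀ ht.1 ht.2) A
  rw [dist_zero_right] at h2
  rw [dist_comm, dist_eq_norm]
  calc ‖T A - φ t A‖ ≤ ‖(T - φ t₀) 1‖ * ‖A‖ := h3
    _ ≤ ε / (‖A‖ + 1) * ‖A‖ := by gcongr
    _ < ε / (‖A‖ + 1) * (‖A‖ + 1) := by gcongr; linarith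
    _ = ε := by field_simp

end limits
end QWeight

/-! ### Abstract cut-off systems and the reduced form of `ϑΛ`. -/

namespace QWeight

section condQuad

variable {E : Type*} [NormedAddCommGroup E] [InnerProductSpace ℂ E] [CompleteSpace E]

/-- The quadratic form that defines conditional negativity. -/
noncomputable def condQuad (φ : Module.End ℂ (E →L[ℂ] E)) {n : ℕ} (A : Fin n → (E →L[ℂ] E)) (f : Fin n → E) :
    ℂ := ∑ i, ∑ j, ⟪f i, φ (star (A i) * A j) (f j)⟫_ℂ

theorem condQuad_add (φ χ : Module.End ℂ (E →L[ℂ] E)) {n : ℕ} (A : Fin n → (E →L[ℂ] E))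
    (f : Fin n → E) : condQuad (φ + χ) A f = condQuad φ A f + condQuad χ A f := by
  simp only [condQuad, LinearMap.add_apply, add_apply, inner_add_right, Finset.sum_add_distrib]

theorem condQuad_sub (φ χ : Module.End ℂ (E →L[ℂ] E)) {n : ℕ} (A : Fin n → (E →L[ℂ] E))
    (f : Fin n → E) : condQuad (φ - χ) A f = condQuad φ A f - condQuad χ A f := by
  simp only [condQuad, LinearMap.sub_apply, sub_apply, inner_sub_right, Finset.sum_sub_distrib]

theorem IsCP.condQuad_nonneg {φ : Module.End ℂ (E →L[ℂ] E)} (hφ : IsCP φ) {n : ℕ}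
    (A : Fin n → (E →L[ℂ] E)) (f : Fin n → E) : 0 ≤ condQuad φ A f :=
  hφ n _ (isPosMatrix_star_mul A) f

theorem tendsto_condQuad {α : Type*} {l : Filter α} {φ : α → Module.End ℂ (E →L[ℂ] E)}
    {χ : Module.End ℂ (E →L[ℂ] E)} (h : ∀ A, Tendsto (fun t => φ t A) l (𝓝 (χ A))) {n : ℕ}
    (A : Fin n → (E →L[ℂ] E)) (f : Fin n → E) :
    Tendsto (fun t => condQuad (φ t) A f) l (𝓝 (condQuad χ A f)) :=
  tendsto_sum_inner (fun i j => h (star (A i) * A j)) f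

end condQuad

/-- The data needed to form generalized boundary representations: a decreasing family of
projections `P t`, a completely positive map `Λ` whose range commutes with them, and a space `V` of
operators that contains the cut-offs `P t * A * P t` for `t > 0`. -/
structure CutSystem (E G : Type*) [NormedAddCommGroup E] [InnerProductSpace ℂ E]
    [NormedAddCommGroup G] [InnerProductSpace ℂ G] [CompleteSpace G] where
  P : ℝ → (G →L[ℂ] G)
  Λ : (E →L[ℂ] E) →ₗ[ℂ] (G →L[ℂ] G)
  V : Submodule ℂ (G →L[ℂ] G)
  cut : ℝ → (G →L[ℂ] G) →ₗ[ℂ] V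
  star_P : ∀ t, star (P t) = P t
  P_mul_P : ∀ s t, s ≤ t → P s * P t = P t
  P_mul_Λ : ∀ t A, P t * Λ A = Λ A * P t
  coe_cut : ∀ t > 0, ∀ A, (cut t A : G →L[ℂ] G) = P t * A * P t
  Λ_cp : IsCP Λ

namespace CutSystem

variable {E G : Type*} [NormedAddCommGroup E] [InnerProductSpace ℂ E]
  [NormedAddCommGroup G] [InnerProductSpace ℂ G] [CompleteSpace G] (S : CutSystem E G)

/-- The restriction `A ↦ ω(P t * A * P t)`. -/
noncomputable def res (ω : S.V →ₗ[ℂ] (E →L[ℂ] E)) (t : ℝ) : (G →L[ℂ] G) →ₗ[ℂ] (E →L[ℂ] E) := ω ∘ₗ S.cut t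

/-- The composition of the restriction with `Λ`. -/
noncomputable def resΛ (ω : S.V →ₗ[ℂ] (E →L[ℂ] E)) (t : ℝ) : Module.End ℂ (E →L[ℂ] E) := S.res ω t ∘ₗ S.Λ

/-- The generalized boundary representation. -/
noncomputable def bdry (ω : S.V →ₗ[ℂ] (E →L[ℂ] E)) (t : ℝ) : (G →L[ℂ] G) →ₗ[ℂ] (E →L[ℂ] E) :=
  Ring.inverse (1 + S.resΛ ω t) ∘ₗ S.res ω t

/-- The algebraic part of the definition of a `q`-weight map. -/
structure IsQ (ω : S.V →ₗ[ℂ] (E →L[ℂ] E)) : Prop where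
  cp : IsCPOn ω
  invertible : ∀ t > 0, IsUnit (1 + S.resΛ ω t)
  bdry_cp : ∀ t > 0, IsCP (S.bdry ω t)
  bdry_contractive : ∀ t > 0, ∀ A, ‖S.bdry ω t A‖ ≤ ‖A‖

/-- Continuity of `ω` with respect to the cut-offs. -/
def IsRegular (ω : S.V →ₗ[ℂ] (E →L[ℂ] E)) : Prop :=
  ∀ A : S.V, Tendsto (fun s => ω (S.cut s A)) (𝓝[>] 0) (𝓝 (ω A))

variable {S}

theorem P_mul_P' {s t : ℝ} (h : s ≤ t) : S.P t * S.P s = S.P t := by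
  have := congrArg star (S.P_mul_P s t h)
  rwa [star_mul, S.star_P, S.star_P] at this

theorem cut_cut {s t : ℝ} (hs : 0 < s) (h : s ≤ t) (A : G →L[ℂ] G) :
    S.cut s (S.P t * A * S.P t) = S.cut t A := by
  apply Subtype.ext
  rw [S.coe_cut s hs, S.coe_cut t (hs.trans_le h)]
  calc S.P s * (S.P t * A * S.P t) * S.P s = S.P s * S.P t * A * (S.P t * S.P s) := by
        simp only [mul_assoc]
    _ = _ := by rw [S.P_mul_P s t h, P_mul_P' h]

theorem P_mul_Λ_mul_P (t : ℝ) (A : E →L[ℂ] E) : S.P t * S.Λ A * S.P t = S.Λ A * S.P t := by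
  rw [S.P_mul_Λ, mul_assoc, S.P_mul_P t t le_rfl]

/-- The difference of two cut-offs of `Λ` is a compression of `Λ`. -/
theorem sub_mul_Λ_mul_sub {s t : ℝ} (h : s ≤ t) (A : E →L[ℂ] E) :
    (S.P s - S.P t) * S.Λ A * (S.P s - S.P t) =
      S.P s * S.Λ A * S.P s - S.P t * S.Λ A * S.P t := by
  have h1 : (S.P s - S.P t) * S.Λ A = S.Λ A * (S.P s - S.P t) := by
    rw [sub_mul, mul_sub, S.P_mul_Λ, S.P_mul_Λ]
  have h2 : (S.P s - S.P t) * (S.P s - S.P t) = S.P s - S.P t := by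
    simp only [mul_sub, sub_mul, S.P_mul_P s s le_rfl, S.P_mul_P t t le_rfl, S.P_mul_P s t h,
      P_mul_P' h]
    abel
  rw [h1, P_mul_Λ_mul_P, P_mul_Λ_mul_P, mul_assoc, h2, mul_sub]

/-- Shows that the part of `Λ` removed by the cut-off is a compression of `Λ`, so a completely
positive map composed with it stays completely positive. `Λ A` itself may lie outside `V`. -/
theorem one_sub_mul_Λ_mul_one_sub (t : ℝ) (A : E →L[ℂ] E) :
    (1 - S.P t) * S.Λ A * (1 - S.P t) = S.Λ A - S.P t * S.Λ A * S.P t := by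
  have h1 : (1 - S.P t) * S.Λ A = S.Λ A * (1 - S.P t) := by
    rw [sub_mul, mul_sub, S.P_mul_Λ, one_mul, mul_one]
  have h2 : (1 - S.P t) * (1 - S.P t) = 1 - S.P t := by
    simp only [mul_sub, sub_mul, S.P_mul_P t t le_rfl, mul_one, one_mul]
    abel
  rw [h1, P_mul_Λ_mul_P, mul_assoc, h2, mul_sub, mul_one]

theorem isCPOn_res {ω : S.V →ₗ[ℂ] (E →L[ℂ] E)} (hω : IsCPOn ω) {t : ℝ} (ht : 0 < t) :
    IsCP (S.res ω t) := by
  intro n A hA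
  refine hω n _ ?_
  have := hA.conj_star (S.P t)
  simpa only [S.coe_cut t ht, S.star_P] using this

theorem isCP_resΛ {ω : S.V →ₗ[ℂ] (E →L[ℂ] E)} (hω : IsCPOn ω) {t : ℝ} (ht : 0 < t) :
    IsCP (S.resΛ ω t) := (isCPOn_res hω ht).comp S.Λ_cp

theorem isCP_resΛ_sub {ω : S.V →ₗ[ℂ] (E →L[ℂ] E)} (hω : IsCPOn ω) {s t : ℝ} (hs : 0 < s)
    (h : s ≤ t) : IsCP (S.resΛ ω s - S.resΛ ω t) := by
  intro n A hA
  have h1 := (S.Λ_cp n A hA).conj_star (S.P s - S.P t)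
  have h2 := hω n (fun i j => S.cut s (S.Λ (A i j)) - S.cut t (S.Λ (A i j))) (by
    simpa only [Submodule.coe_sub, S.coe_cut s hs, S.coe_cut t (hs.trans_le h), star_sub, S.star_P,
      sub_mul_Λ_mul_sub h] using h1)
  simp only [map_sub] at h2
  exact h2

theorem resΛ_sub (ω η : S.V →ₗ[ℂ] (E →L[ℂ] E)) (t : ℝ) :
    S.resΛ (ω - η) t = S.resΛ ω t - S.resΛ η t := rfl

/-- A regular `ω` is the pointwise limit of its cut-offs, so that properties closed under limits can
be checked for `t > 0`. -/
theorem IsRegular.isCPOn {ω : S.V →ₗ[ℂ] (E →L[ℂ] E)} (h : S.IsRegular ω)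
    (hcp : ∀ t > 0, IsCP (S.res ω t)) : IsCPOn ω := by
  intro n A hA
  refine IsPosMatrix.of_tendsto (l := 𝓝[>] (0 : ℝ))
    (A := fun t i j => S.res ω t (A i j)) ?_ fun i j => h (A i j)
  filter_upwards [eventually_mem_nhdsWithin] with t ht using hcp t ht n _ hA

theorem IsRegular.eq_zero {ω : S.V →ₗ[ℂ] (E →L[ℂ] E)} (h : S.IsRegular ω)
    (h0 : ∀ t > 0, ∀ A, S.res ω t A = 0) : ω = 0 := by
  ext1 A
  refine tendsto_nhds_unique (h A) ?_
  refine Tendsto.congr' ?_ tendsto_const_nhds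
  filter_upwards [eventually_mem_nhdsWithin] with t ht using (h0 t ht _).symm

theorem IsRegular.comp [FiniteDimensional ℂ E] {ω : S.V →ₗ[ℂ] (E →L[ℂ] E)} (h : S.IsRegular ω)
    (φ : Module.End ℂ (E →L[ℂ] E)) : S.IsRegular (φ ∘ₗ ω) := fun A =>
  (φ.continuous_of_finiteDimensional.tendsto _).comp (h A)

theorem IsRegular.sub {ω η : S.V →ₗ[ℂ] (E →L[ℂ] E)} (hω : S.IsRegular ω) (hη : S.IsRegular η) :
    S.IsRegular (ω - η) := fun A => (hω A).sub (hη A)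

/-- `ηΛ` exists for a bounded completely positive `η`. -/
theorem exists_tendsto_resΛ [FiniteDimensional ℂ E] {η : S.V →ₗ[ℂ] (E →L[ℂ] E)}
    (hη : IsCPOn η) {R : ℝ} (hR : ∀ᶠ t in 𝓝[>] (0 : ℝ), ‖S.resΛ η t 1‖ ≤ R) :
    ∃ T : Module.End ℂ (E →L[ℂ] E), ∀ A, Tendsto (fun t => S.resΛ η t A) (𝓝[>] 0) (𝓝 (T A)) :=
  exists_tendsto_of_antitone (fun _ ht => isCP_resΛ hη ht)
    (fun _ _ hs hst => isCP_resΛ_sub hη hs hst) hR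

theorem isCP_limit_sub [FiniteDimensional ℂ E] {η : S.V →ₗ[ℂ] (E →L[ℂ] E)} (hη : IsCPOn η)
    {T : Module.End ℂ (E →L[ℂ] E)}
    (hT : ∀ A, Tendsto (fun t => S.resΛ η t A) (𝓝[>] 0) (𝓝 (T A))) {t : ℝ} (ht : 0 < t) :
    IsCP (T - S.resΛ η t) := by
  refine IsCP.of_tendsto (l := 𝓝[>] (0 : ℝ)) (φ := fun s => S.resΛ η s - S.resΛ η t) ?_
    fun A => (hT A).sub tendsto_const_nhds
  filter_upwards [Ioc_mem_nhdsGT ht] with s hs using isCP_resΛ_sub hη hs.1 hs.2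

theorem isCP_limit {η : S.V →ₗ[ℂ] (E →L[ℂ] E)} (hη : IsCPOn η)
    {T : Module.End ℂ (E →L[ℂ] E)}
    (hT : ∀ A, Tendsto (fun t => S.resΛ η t A) (𝓝[>] 0) (𝓝 (T A))) : IsCP T := by
  refine IsCP.of_tendsto (l := 𝓝[>] (0 : ℝ)) (φ := fun s => S.resΛ η s) ?_ hT
  filter_upwards [eventually_mem_nhdsWithin] with s hs using isCP_resΛ hη hs

/-- `R` plays the role of `ρ_ϑ Λ`: it agrees with `ϑΛ` up to terms that do not contribute to
conditional negativity. -/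
structure IsReduced [CompleteSpace E] (S : CutSystem E G) (ϑ : S.V →ₗ[ℂ] (E →L[ℂ] E))
    (R : Module.End ℂ (E →L[ℂ] E)) : Prop where
  star_apply : ∀ A, R (star A) = star (R A)
  tendsto : ∀ (n : ℕ) (A : Fin n → (E →L[ℂ] E)) (f : Fin n → E), ∑ i, A i (f i) = 0 →
    Tendsto (fun s => condQuad (S.resΛ ϑ s) A f) (𝓝[>] 0) (𝓝 (condQuad R A f))

section main

variable [FiniteDimensional ℂ E] {ϑ η : S.V →ₗ[ℂ] (E →L[ℂ] E)}
  {R T ψ ψ' : Module.End ℂ (E →L[ℂ] E)}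

theorem IsReduced.tendsto_condQuad (hR : S.IsReduced ϑ R)
    (hT : ∀ A, Tendsto (fun t => S.resΛ η t A) (𝓝[>] 0) (𝓝 (T A))) (ψ' : Module.End ℂ (E →L[ℂ] E))
    {n : ℕ} {A : Fin n → (E →L[ℂ] E)} {f : Fin n → E} (hf : ∑ i, A i (f i) = 0) :
    Tendsto (fun s => condQuad (ψ' + S.resΛ (ϑ - η) s) A f) (𝓝[>] 0)
      (𝓝 (condQuad (ψ' + R - T) A f)) := by
  simp only [resΛ_sub, condQuad_add, condQuad_sub, add_sub_assoc]
  exact ((hR.tendsto n A f hf).sub (QWeight.tendsto_condQuad hT A f)).const_add _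

/-- On constrained families the form increases as the cut-off `s` tends to zero, and its limit is
that of `ψ' + R - T`; a nonpositive limit bounds all earlier values. -/
theorem IsReduced.condNeg_add_resΛ (hR : S.IsReduced ϑ R) (hη : IsCPOn η) (hsub : IsCPOn (ϑ - η))
    (hT : ∀ A, Tendsto (fun t => S.resΛ η t A) (𝓝[>] 0) (𝓝 (T A)))
    (h : CondNeg (ψ' + R - T)) {t : ℝ} (ht : 0 < t) : CondNeg (ψ' + S.resΛ (ϑ - η) t) := by
  refine ⟨fun A => ?_, fun n A f hf => ?_⟩
  -- `R` and `T` preserve adjoints, hence so does `ψ'`.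
  · have h1 := h.1 A
    rw [LinearMap.sub_apply, LinearMap.add_apply, LinearMap.sub_apply, LinearMap.add_apply,
      hR.star_apply, (isCP_limit hη hT).star_apply, star_sub, star_add] at h1
    rw [LinearMap.add_apply, LinearMap.add_apply, (isCP_resΛ hsub ht).star_apply, star_add,
      add_right_cancel (sub_left_injective h1)]
  · refine (ge_of_tendsto (hR.tendsto_condQuad hT ψ' hf) ?_).trans (h.2 n A f hf)
    filter_upwards [Ioc_mem_nhdsGT ht] with s hs
    have h1 := (isCP_resΛ_sub hsub hs.1 hs.2).condQuad_nonneg A f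
    rw [condQuad_sub, sub_nonneg] at h1
    change condQuad _ A f ≤ _
    rw [condQuad_add, condQuad_add]
    gcongr

theorem IsReduced.condNeg_of_forall (hR : S.IsReduced ϑ R) (hη : IsCPOn η)
    (hT : ∀ A, Tendsto (fun t => S.resΛ η t A) (𝓝[>] 0) (𝓝 (T A))) (hψ' : CondNeg ψ')
    (h : ∀ t > 0, CondNeg (ψ' + S.resΛ (ϑ - η) t)) : CondNeg (ψ' + R - T) := by
  refine ⟨fun A => ?_, fun n A f hf => ?_⟩
  · rw [LinearMap.sub_apply, LinearMap.add_apply, LinearMap.sub_apply, LinearMap.add_apply,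
      hR.star_apply, (isCP_limit hη hT).star_apply, star_sub, star_add, hψ'.1]
  · refine le_of_tendsto (hR.tendsto_condQuad hT ψ' hf) ?_
    filter_upwards [eventually_mem_nhdsWithin] with s hs using (h s hs).2 n A f hf

end main

end CutSystem

end QWeight

/-! ### Boundary representations, and part (a) for a cut-off system. -/

namespace QWeight

theorem ringInverse_apply_eq {W : Type*} [AddCommGroup W] [Module ℂ W] {M : Module.End ℂ W}
    (hM : IsUnit M) {x y : W} (h : M y = x) : Ring.inverse M x = y := by
  rw [← h, ← Module.End.mul_apply, Ring.inverse_mul_cancel _ hM, Module.End.one_apply]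

theorem isCP_mulLeftRight {G : Type*} [NormedAddCommGroup G] [InnerProductSpace ℂ G]
    [CompleteSpace G] {P : G →L[ℂ] G} (hP : star P = P) :
    IsCP (LinearMap.mulLeftRight ℂ (P, P)) := by
  intro n A hA
  simpa only [LinearMap.mulLeftRight_apply, hP] using hA.conj_star P

namespace CutSystem

variable {E G : Type*} [NormedAddCommGroup E] [InnerProductSpace ℂ E]
  [NormedAddCommGroup G] [InnerProductSpace ℂ G] [CompleteSpace G] {S : CutSystem E G}

theorem one_add_resΛ_comp {ψ : Module.End ℂ (E →L[ℂ] E)} (hψ : IsUnit ψ)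
    (ϑ : S.V →ₗ[ℂ] (E →L[ℂ] E)) (t : ℝ) :
    1 + S.resΛ (Ring.inverse ψ ∘ₗ ϑ) t = Ring.inverse ψ * (ψ + S.resΛ ϑ t) := by
  rw [mul_add, Ring.inverse_mul_cancel _ hψ]
  rfl

theorem bdry_comp {ψ : Module.End ℂ (E →L[ℂ] E)} (hψ : IsUnit ψ) {ϑ : S.V →ₗ[ℂ] (E →L[ℂ] E)}
    {t : ℝ} (hL : IsUnit (ψ + S.resΛ ϑ t)) :
    IsUnit (1 + S.resΛ (Ring.inverse ψ ∘ₗ ϑ) t) ∧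
      S.bdry (Ring.inverse ψ ∘ₗ ϑ) t = Ring.inverse (ψ + S.resΛ ϑ t) ∘ₗ S.res ϑ t := by
  have hu : IsUnit (1 + S.resΛ (Ring.inverse ψ ∘ₗ ϑ) t) := by
    rw [one_add_resΛ_comp hψ]
    exact hψ.ringInverse.mul hL
  refine ⟨hu, LinearMap.ext fun A => ?_⟩
  refine ringInverse_apply_eq hu ?_
  rw [one_add_resΛ_comp hψ, LinearMap.comp_apply, Module.End.mul_apply, map_inverse_apply hL]
  rfl

/-- With `M = 1 + ω|_tΛ` this is `M⁻¹(M - 1) = 1 - M⁻¹`. Read backwards, it shows that `M⁻¹` is the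
identity minus a completely positive map whenever the boundary representation is one. -/
theorem bdry_Λ {ω : S.V →ₗ[ℂ] (E →L[ℂ] E)} {t : ℝ} (hu : IsUnit (1 + S.resΛ ω t))
    (A : E →L[ℂ] E) : S.bdry ω t (S.Λ A) = A - Ring.inverse (1 + S.resΛ ω t) A := by
  refine ringInverse_apply_eq hu ?_
  rw [map_sub, map_inverse_apply hu, LinearMap.add_apply, Module.End.one_apply,
    add_sub_cancel_left]
  rfl

/-- An operator already cut off at `s` is unchanged by the cut-off at `t ≤ s`, so `t` enters only
through the inverse. -/
theorem bdry_P_mul_P {ω : S.V →ₗ[ℂ] (E →L[ℂ] E)} {s t : ℝ} (ht : 0 < t) (hts : t ≤ s)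
    (A : G →L[ℂ] G) : S.bdry ω t (S.P s * A * S.P s) =
      Ring.inverse (1 + S.resΛ ω t) (S.res ω s A) := by
  change Ring.inverse (1 + S.resΛ ω t) (ω (S.cut t (S.P s * A * S.P s))) = _
  rw [cut_cut ht hts]
  rfl

theorem condNeg_one_sub_bdry [FiniteDimensional ℂ E] {ω : S.V →ₗ[ℂ] (E →L[ℂ] E)} {t : ℝ}
    (h : IsCP (S.bdry ω t)) {Q : G →L[ℂ] G} (hQ : star Q = Q) :
    CondNeg (1 - S.bdry ω t ∘ₗ LinearMap.mulLeftRight ℂ (Q, Q) ∘ₗ S.Λ) :=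
  condNeg_one.sub_cp (h.comp ((isCP_mulLeftRight hQ).comp S.Λ_cp))

theorem norm_one_le_one {F : Type*} [NormedAddCommGroup F] [InnerProductSpace ℂ F] :
    ‖(1 : F →L[ℂ] F)‖ ≤ 1 := ContinuousLinearMap.norm_id_le

/-- The maps `ψ'⁻¹(ϑ - η)` are `q`-subordinates of `ψ⁻¹ϑ`. -/
theorem isQ_of_dominated [FiniteDimensional ℂ E] {ϑ η : S.V →ₗ[ℂ] (E →L[ℂ] E)}
    {R T ψ ψ' : Module.End ℂ (E →L[ℂ] E)} (hω : S.IsQ (Ring.inverse ψ ∘ₗ ϑ)) (hψ : IsUnit ψ)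
    (hψcp : IsCP (Ring.inverse ψ)) (hR : S.IsReduced ϑ R) (hψR : CondNeg (ψ + R))
    (hη : IsCPOn η) (hsub : IsCPOn (ϑ - η))
    (hT : ∀ A, Tendsto (fun t => S.resΛ η t A) (𝓝[>] 0) (𝓝 (T A)))
    (h1 : IsCP (ψ' - (ψ + T))) (h2 : CondNeg (ψ' + R - T)) :
    IsUnit ψ' ∧ S.IsQ (Ring.inverse ψ' ∘ₗ (ϑ - η)) ∧
      ∀ t > 0, IsCP (S.bdry (Ring.inverse ψ ∘ₗ ϑ) t - S.bdry (Ring.inverse ψ' ∘ₗ (ϑ - η)) t) := by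
  have hϑ : IsCPOn ϑ := by simpa using hsub.add hη
  have hL'cn : ∀ t > 0, CondNeg (ψ' + S.resΛ (ϑ - η) t) := fun t ht =>
    hR.condNeg_add_resΛ hη hsub hT h2 ht
  -- The same argument with `η = 0` and `T = 0`.
  have hLcn : ∀ t > 0, CondNeg (ψ + S.resΛ ϑ t) := by
    intro t ht
    have := hR.condNeg_add_resΛ (ψ' := ψ) (η := 0) (T := 0) (fun n A _ x => by simp)
      (by rwa [sub_zero]) (fun A => tendsto_const_nhds) (by rwa [sub_zero]) ht
    rwa [sub_zero] at this
  have hψ'ψ : IsCP (ψ' - ψ) := by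
    have := h1.add (isCP_limit hη hT)
    rwa [sub_add_eq_sub_sub, sub_add_cancel] at this
  have hψ'cn : CondNeg ψ' := by
    have := (hL'cn 1 one_pos).sub_cp (isCP_resΛ hsub one_pos)
    rwa [add_sub_cancel_right] at this
  obtain ⟨hψ', hψ'cp⟩ := hψ'cn.isUnit_and_isCP_inverse hψ hψcp hψ'ψ
  have hL' : ∀ t > 0, IsUnit (ψ' + S.resΛ (ϑ - η) t) ∧
      IsCP (Ring.inverse (ψ' + S.resΛ (ϑ - η) t)) := fun t ht =>
    (hL'cn t ht).isUnit_and_isCP_inverse hψ' hψ'cp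
      (by rw [add_sub_cancel_left]; exact isCP_resΛ hsub ht)
  have hL : ∀ t > 0, IsUnit (ψ + S.resΛ ϑ t) ∧ IsCP (Ring.inverse (ψ + S.resΛ ϑ t)) :=
    fun t ht => (hLcn t ht).isUnit_and_isCP_inverse hψ hψcp
      (by rw [add_sub_cancel_left]; exact isCP_resΛ hϑ ht)
  have hLL' : ∀ t > 0, IsCP ((ψ' + S.resΛ (ϑ - η) t) - (ψ + S.resΛ ϑ t)) := by
    intro t ht
    have := h1.add (isCP_limit_sub hη hT ht)
    rw [resΛ_sub]
    convert this using 1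
    abel
  have hdiff : ∀ t > 0,
      IsCP (S.bdry (Ring.inverse ψ ∘ₗ ϑ) t - S.bdry (Ring.inverse ψ' ∘ₗ (ϑ - η)) t) := by
    intro t ht
    rw [(bdry_comp hψ (hL t ht).1).2, (bdry_comp hψ' (hL' t ht).1).2]
    -- The difference is `(L⁻¹ - L'⁻¹) ϑ|_t + L'⁻¹ η|_t`, with `L` and `L'` the two maps just
    -- inverted.
    have h3 := (IsCP.inverse_sub_inverse (hL t ht).1 (hL' t ht).1 (hL t ht).2 (hL' t ht).2
      (hLL' t ht)).comp (isCPOn_res hϑ ht)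
    have h4 := (hL' t ht).2.comp (isCPOn_res hη ht)
    have h5 : S.res (ϑ - η) t = S.res ϑ t - S.res η t := rfl
    convert h3.add h4 using 1
    rw [h5, LinearMap.sub_comp, LinearMap.comp_sub]
    abel
  have hbcp : ∀ t > 0, IsCP (S.bdry (Ring.inverse ψ' ∘ₗ (ϑ - η)) t) := by
    intro t ht
    rw [(bdry_comp hψ' (hL' t ht).1).2]
    exact (hL' t ht).2.comp (isCPOn_res hsub ht)
  refine ⟨hψ', ⟨hψ'cp.isCPOn_comp hsub, fun t ht => (bdry_comp hψ' (hL' t ht).1).1, hbcp,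
    fun t ht A => ?_⟩, hdiff⟩
  calc _ ≤ ‖S.bdry (Ring.inverse ψ ∘ₗ ϑ) t 1‖ * ‖A‖ := (hbcp t ht).norm_apply_le (hdiff t ht) A
    _ ≤ 1 * ‖A‖ := by
      gcongr
      exact (hω.bdry_contractive t ht 1).trans norm_one_le_one
    _ = ‖A‖ := one_mul _

end CutSystem

end QWeight

/-! ### Part (b) for a cut-off system: blow-up along an ultrafilter. -/

namespace QWeight

namespace CutSystem

variable {E G : Type*} [NormedAddCommGroup E] [InnerProductSpace ℂ E] [FiniteDimensional ℂ E]
  [NormedAddCommGroup G] [InnerProductSpace ℂ G] [CompleteSpace G] {S : CutSystem E G}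
  {ϑ ω' : S.V →ₗ[ℂ] (E →L[ℂ] E)} {ψ : Module.End ℂ (E →L[ℂ] E)} {w : ℝ → ℝ}

/-- The rescaled inverses `w_t (ι + ω|_tΛ)⁻¹` converge to the coefficient map. -/
theorem tendsto_smul_inverse (hω : S.IsQ (Ring.inverse ψ ∘ₗ ϑ)) (hψ : IsUnit ψ)
    (hw : Tendsto w (𝓝[>] 0) atTop)
    (hϑw : ∀ A, Tendsto (fun t => ((w t)⁻¹ : ℂ) • S.resΛ ϑ t A) (𝓝[>] 0) (𝓝 A))
    (A : E →L[ℂ] E) :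
    Tendsto (fun t => (w t : ℂ) • Ring.inverse (1 + S.resΛ (Ring.inverse ψ ∘ₗ ϑ) t) A) (𝓝[>] 0)
      (𝓝 (ψ A)) := by
  have hpos : ∀ᶠ t in 𝓝[>] (0 : ℝ), 0 < t := eventually_mem_nhdsWithin
  have hw0 : ∀ᶠ t in 𝓝[>] (0 : ℝ), (w t : ℂ) ≠ 0 := by
    filter_upwards [hw.eventually_gt_atTop 0] with t ht
    exact_mod_cast ht.ne'
  have hwinv : Tendsto (fun t => ((w t)⁻¹ : ℂ)) (𝓝[>] 0) (𝓝 0) := by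
    have := (Complex.continuous_ofReal.tendsto 0).comp (tendsto_inv_atTop_zero.comp hw)
    simpa [Function.comp_def] using this
  have hu : ∀ᶠ t in 𝓝[>] (0 : ℝ),
      IsUnit (((w t)⁻¹ : ℂ) • (1 + S.resΛ (Ring.inverse ψ ∘ₗ ϑ) t)) := by
    filter_upwards [hpos, hw0] with t ht h0
    exact (hω.invertible t ht).smul (Units.mk0 _ (inv_ne_zero h0))
  have hlim : ∀ A, Tendsto (fun t => (((w t)⁻¹ : ℂ) • (1 + S.resΛ (Ring.inverse ψ ∘ₗ ϑ) t)) A)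
      (𝓝[>] 0) (𝓝 (Ring.inverse ψ A)) := by
    -- The term `w_t⁻¹ ι` vanishes, so the rescaled maps tend to `ψ⁻¹`; their inverses therefore
    -- tend to `ψ`.
    intro A
    have h1 : Tendsto (fun t => ((w t)⁻¹ : ℂ) • A) (𝓝[>] 0) (𝓝 0) := by
      simpa using hwinv.smul_const A
    have h2 := ((Ring.inverse ψ).continuous_of_finiteDimensional.tendsto _).comp (hϑw A)
    have h3 := h1.add h2
    rw [zero_add] at h3
    refine h3.congr fun t => ?_
    rw [Function.comp_apply, map_smul, LinearMap.smul_apply, LinearMap.add_apply, smul_add]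
    rfl
  have h := tendsto_ringInverse_apply hu hψ.ringInverse hlim A
  rw [ringInverse_apply_eq hψ.ringInverse (inverse_map_apply hψ A)] at h
  refine h.congr' ?_
  filter_upwards [hpos, hw0, hu] with t ht h0 hu'
  refine ringInverse_apply_eq hu' ?_
  rw [LinearMap.smul_apply, map_smul, map_inverse_apply (hω.invertible t ht), smul_smul,
    inv_mul_cancel₀ h0, one_smul]

/-- Every non-zero `q`-subordinate of `ψ⁻¹ϑ` is of the form `ψ'⁻¹(ϑ - η)`. -/
theorem exists_of_subordinate {R : Module.End ℂ (E →L[ℂ] E)}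
    (hω : S.IsQ (Ring.inverse ψ ∘ₗ ϑ)) (hω' : S.IsQ ω')
    (hsub : ∀ t > 0, IsCP (S.bdry (Ring.inverse ψ ∘ₗ ϑ) t - S.bdry ω' t)) (hne : ω' ≠ 0)
    (hregϑ : S.IsRegular ϑ) (hregω' : S.IsRegular ω')
    (hψ : IsUnit ψ) (hψcp : IsCP (Ring.inverse ψ)) (hR : S.IsReduced ϑ R)
    (hw : Tendsto w (𝓝[>] 0) atTop)
    (hϑw : ∀ A, Tendsto (fun t => ((w t)⁻¹ : ℂ) • S.resΛ ϑ t A) (𝓝[>] 0) (𝓝 A))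
    (h1Λ : 1 - S.Λ 1 ∈ S.V) :
    ∃ (η : S.V →ₗ[ℂ] (E →L[ℂ] E)) (T ψ' : Module.End ℂ (E →L[ℂ] E)),
      η = ϑ - ψ' ∘ₗ ω' ∧ IsCPOn η ∧ IsCPOn (ϑ - η) ∧
      (∃ C : ℝ, ∀ A : S.V, ‖η A‖ ≤ C * ‖(A : G →L[ℂ] G)‖) ∧
      (∀ A, Tendsto (fun t => S.resΛ η t A) (𝓝[>] 0) (𝓝 (T A))) ∧
      IsCP (ψ' - (ψ + T)) ∧ CondNeg (ψ' + R - T) ∧ IsUnit ψ' ∧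
      ω' = Ring.inverse ψ' ∘ₗ (ϑ - η) := by
  set ω := Ring.inverse ψ ∘ₗ ϑ with hωdef
  have hpos : ∀ᶠ t in 𝓝[>] (0 : ℝ), 0 < t := eventually_mem_nhdsWithin
  have hw0 : ∀ᶠ t in 𝓝[>] (0 : ℝ), 0 < w t := hw.eventually_gt_atTop 0
  let U : Ultrafilter ℝ := Ultrafilter.of (𝓝[>] 0)
  have hU : (U : Filter ℝ) ≤ 𝓝[>] 0 := Ultrafilter.of_le _
  let N : ℝ → Module.End ℂ (E →L[ℂ] E) := fun t =>
    (w t : ℂ) • Ring.inverse (1 + S.resΛ ω' t)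
  let Ψ : ℝ → Module.End ℂ (E →L[ℂ] E) := fun t => (w t : ℂ) • Ring.inverse (1 + S.resΛ ω t)
  have hΨ : ∀ A, Tendsto (fun t => Ψ t A) (𝓝[>] 0) (𝓝 (ψ A)) :=
    tendsto_smul_inverse hω hψ hw hϑw
  let D : ℝ → (G →L[ℂ] G) →ₗ[ℂ] (E →L[ℂ] E) := fun t => (w t : ℂ) • (S.bdry ω t - S.bdry ω' t)
  have hD : ∀ᶠ t in 𝓝[>] (0 : ℝ), IsCP (D t) := by
    filter_upwards [hpos, hw0] with t ht hwt using (hsub t ht).smul hwt.le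
  have hB' : ∀ᶠ t in 𝓝[>] (0 : ℝ), IsCP ((w t : ℂ) • S.bdry ω' t) := by
    filter_upwards [hpos, hw0] with t ht hwt using (hω'.bdry_cp t ht).smul hwt.le
  let C : ℝ → Module.End ℂ (E →L[ℂ] E) := fun t => D t ∘ₗ S.Λ
  have hC : ∀ᶠ t in 𝓝[>] (0 : ℝ), IsCP (C t) := hD.mono fun t ht => ht.comp S.Λ_cp
  have hNC : ∀ᶠ t in 𝓝[>] (0 : ℝ), N t = Ψ t + C t := by
    filter_upwards [hpos] with t ht
    refine LinearMap.ext fun A => ?_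
    change (w t : ℂ) • Ring.inverse (1 + S.resΛ ω' t) A = (w t : ℂ) •
      Ring.inverse (1 + S.resΛ ω t) A + (w t : ℂ) • (S.bdry ω t (S.Λ A) - S.bdry ω' t (S.Λ A))
    rw [bdry_Λ (hω.invertible t ht), bdry_Λ (hω'.invertible t ht), ← smul_add]
    congr 1
    abel
  have hNcn : ∀ᶠ t in 𝓝[>] (0 : ℝ), CondNeg (N t) := by
    filter_upwards [hpos, hw0] with t ht hwt
    have : N t = (w t : ℂ) • (1 - S.bdry ω' t ∘ₗ S.Λ) := by
      refine LinearMap.ext fun A => ?_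
      change (w t : ℂ) • Ring.inverse (1 + S.resΛ ω' t) A =
        (w t : ℂ) • (A - S.bdry ω' t (S.Λ A))
      rw [bdry_Λ (hω'.invertible t ht), sub_sub_cancel]
    rw [this]
    exact (condNeg_one.sub_cp ((hω'.bdry_cp t ht).comp S.Λ_cp)).smul hwt.le
  -- Away from the origin the rescaled boundary representation recovers `ψ ω|_s = ϑ|_s`.
  have hBlim : ∀ s > 0, ∀ A, Tendsto (fun t => (w t : ℂ) • S.bdry ω t (S.P s * A * S.P s))
      (𝓝[>] 0) (𝓝 (S.res ϑ s A)) := by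
    intro s hs A
    have h := hΨ (S.res ω s A)
    have h2 : ψ (S.res ω s A) = S.res ϑ s A := map_inverse_apply hψ _
    rw [h2] at h
    refine h.congr' ?_
    filter_upwards [Ioc_mem_nhdsGT hs] with t ht
    rw [bdry_P_mul_P ht.1 ht.2]
    rfl
  have hB'N : ∀ s > 0, ∀ A, ∀ᶠ t in 𝓝[>] (0 : ℝ),
      (w t : ℂ) • S.bdry ω' t (S.P s * A * S.P s) = N t (S.res ω' s A) := by
    intro s hs A
    filter_upwards [Ioc_mem_nhdsGT hs] with t ht
    rw [bdry_P_mul_P ht.1 ht.2]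
    rfl
  -- Otherwise divide by `‖C t 1‖`. The convergent part `Ψ t` disappears, so the normalised `C t`
  -- and `N t` share a limit, which is a non-zero scalar.
  have hCbd : ∃ c : ℝ, ∀ᶠ t in U, ‖C t 1‖ ≤ c := by
    by_contra hcon
    simp only [not_exists] at hcon
    have hctop : Tendsto (fun t => ‖C t 1‖) U atTop := by
      refine tendsto_atTop.2 fun c => ?_
      exact (Ultrafilter.eventually_not.2 (hcon c)).mono fun t ht => (not_le.1 ht).le
    have hcinv : Tendsto (fun t => ((‖C t 1‖⁻¹ : ℝ) : ℂ)) U (𝓝 0) := by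
      simpa [Function.comp_def] using
        (Complex.continuous_ofReal.tendsto 0).comp (tendsto_inv_atTop_zero.comp hctop)
    have hc0 : ∀ᶠ t in U, 0 < ‖C t 1‖ := hctop.eventually_gt_atTop 0
    obtain ⟨C', hC'⟩ := exists_ultrafilter_limit U
      (φ := fun t => ((‖C t 1‖⁻¹ : ℝ) : ℂ) • C t) (R := 1) (by
        filter_upwards [hU hC, hc0] with t ht h0 A
        rw [LinearMap.smul_apply, norm_smul, Complex.norm_real, norm_inv, norm_norm, one_mul,
          inv_mul_le_iff₀ h0]
        exact ht.norm_apply_le (χ := C t) (by rw [sub_self]; exact IsCP.zero) A)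
    have hC'1 : ‖C' 1‖ = 1 := by
      refine tendsto_nhds_unique (hC' 1).norm (tendsto_const_nhds.congr' ?_)
      filter_upwards [hc0] with t h0
      rw [LinearMap.smul_apply, norm_smul, Complex.norm_real, norm_inv, norm_norm,
        inv_mul_cancel₀ h0.ne']
    have hC'cp : IsCP C' := IsCP.of_tendsto (l := (U : Filter ℝ)) (by
      filter_upwards [hU hC] with t ht using ht.smul (by positivity)) hC'
    have hNlim : ∀ A, Tendsto (fun t => (((‖C t 1‖⁻¹ : ℝ) : ℂ) • N t) A) U (𝓝 (C' A)) := by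
      intro A
      have h1 := hcinv.smul ((hΨ A).mono_left hU)
      rw [zero_smul] at h1
      have h2 := h1.add (hC' A)
      rw [zero_add] at h2
      refine h2.congr' ?_
      filter_upwards [hU hNC] with t ht
      rw [ht]
      exact (smul_add _ _ _).symm
    have hC'cn : CondNeg C' := CondNeg.of_tendsto (l := (U : Filter ℝ)) (by
      filter_upwards [hU hNcn] with t ht using ht.smul (by positivity)) hNlim
    obtain ⟨c, hc⟩ := hC'cp.exists_eq_smul_one hC'cn
    have hc0' : c ≠ 0 := by
      rintro rfl
      rw [hc] at hC'1
      simp at hC'1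
    -- The normalised `N t` applied to `ω'|_s(A)` tends to `c ω'|_s(A)`, but it is dominated by the
    -- normalised `w_t π_t^#` on operators cut off at `s`, which tends to zero because `w_t π_t^#`
    -- stays bounded there.
    refine hne (hregω'.eq_zero fun s hs A => ?_)
    have h1 := hNlim (S.res ω' s A)
    rw [hc, LinearMap.smul_apply, Module.End.one_apply] at h1
    have hlim0 : Tendsto (fun t => (((‖C t 1‖⁻¹ : ℝ) : ℂ) • N t) (S.res ω' s A)) U (𝓝 0) := by
      have hb := ((hcinv.smul ((hBlim s hs 1).mono_left hU)).norm).mul_const ‖A‖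
      rw [zero_smul, norm_zero, zero_mul] at hb
      refine squeeze_zero_norm' ?_ hb
      filter_upwards [hU hpos, hU (hB'N s hs A), hU hB', hU hD] with t ht h2 h3 h4
      have hP := isCP_mulLeftRight (S.star_P s)
      have h5 := (h3.comp hP).norm_apply_le
        (χ := ((w t : ℂ) • S.bdry ω t) ∘ₗ LinearMap.mulLeftRight ℂ (S.P s, S.P s)) 
          ((h4.comp hP).congr fun A => smul_sub (w t : ℂ) (S.bdry ω t (S.P s * A * S.P s))
            (S.bdry ω' t (S.P s * A * S.P s))) A
      simp only [LinearMap.comp_apply, LinearMap.mulLeftRight_apply, LinearMap.smul_apply] at h5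
      rw [LinearMap.smul_apply, ← h2]
      refine (norm_smul_le _ _).trans ((mul_le_mul_of_nonneg_left h5 (norm_nonneg _)).trans_eq ?_)
      rw [← mul_assoc, ← norm_smul]
    exact (smul_eq_zero.1 (tendsto_nhds_unique h1 hlim0)).resolve_left hc0'
  obtain ⟨c, hc⟩ := hCbd
  obtain ⟨C', hC'⟩ := exists_ultrafilter_limit U (φ := C) (R := c) (by
    filter_upwards [hU hC, hc] with t ht h0 A
    exact (ht.norm_apply_le (χ := C t) (by rw [sub_self]; exact IsCP.zero) A).trans (by gcongr))
  have hC'cp : IsCP C' := IsCP.of_tendsto (l := (U : Filter ℝ)) (hU hC) hC'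
  set ψ' := ψ + C' with hψ'def
  have hNlim : ∀ A, Tendsto (fun t => N t A) U (𝓝 (ψ' A)) := by
    intro A
    refine (((hΨ A).mono_left hU).add (hC' A)).congr' ?_
    filter_upwards [hU hNC] with t ht
    rw [ht, LinearMap.add_apply]
  have hψ'cn : CondNeg ψ' := CondNeg.of_tendsto (l := (U : Filter ℝ)) (hU hNcn) hNlim
  have hψ' : IsUnit ψ' := (hψ'cn.isUnit_and_isCP_inverse hψ hψcp
    (by rw [hψ'def, add_sub_cancel_left]; exact hC'cp)).1
  set η := ϑ - ψ' ∘ₗ ω' with hηdef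
  have hϑη : ϑ - η = ψ' ∘ₗ ω' := sub_sub_cancel _ _
  have hB'lim : ∀ s > 0, ∀ A, Tendsto (fun t => (w t : ℂ) • S.bdry ω' t (S.P s * A * S.P s)) U
      (𝓝 (ψ' (S.res ω' s A))) := fun s hs A =>
    (hNlim (S.res ω' s A)).congr' (by
      filter_upwards [hU (hB'N s hs A)] with t ht using ht.symm)
  have hDlim : ∀ s > 0, ∀ A, Tendsto (fun t => D t (S.P s * A * S.P s)) U
      (𝓝 (S.res η s A)) := by
    intro s hs A
    refine (((hBlim s hs A).mono_left hU).sub (hB'lim s hs A)).congr fun t => ?_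
    rw [← smul_sub]
    rfl
  have hregη : S.IsRegular η := hregϑ.sub (hregω'.comp ψ')
  have hη : IsCPOn η := hregη.isCPOn fun s hs => IsCP.of_tendsto (l := (U : Filter ℝ))
    (φ := fun t => D t ∘ₗ LinearMap.mulLeftRight ℂ (S.P s, S.P s)) (by
      filter_upwards [hU hD] with t ht using ht.comp (isCP_mulLeftRight (S.star_P s)))
    (hDlim s hs)
  have hϑηcp : IsCPOn (ϑ - η) := by
    rw [hϑη]
    refine (hregω'.comp ψ').isCPOn fun s hs => IsCP.of_tendsto (l := (U : Filter ℝ))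
      (φ := fun t => ((w t : ℂ) • S.bdry ω' t) ∘ₗ LinearMap.mulLeftRight ℂ (S.P s, S.P s)) (by
        filter_upwards [hU hB'] with t ht using ht.comp (isCP_mulLeftRight (S.star_P s)))
      (hB'lim s hs)
  have hQ : ∀ s, star (1 - S.P s) = 1 - S.P s := fun s => by rw [star_sub, star_one, S.star_P]
  -- As `t` tends to zero, `C t` minus its part cut off at `s` is `D t` applied to a compression of
  -- `Λ` by `1 - P s`. This bounds `η|_sΛ` uniformly in `s`.
  have hdom : ∀ s > 0, IsCP ((ψ' - ψ) - S.resΛ η s) := by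
    intro s hs
    refine IsCP.of_tendsto (l := (U : Filter ℝ))
      (φ := fun t => D t ∘ₗ LinearMap.mulLeftRight ℂ (1 - S.P s, 1 - S.P s) ∘ₗ S.Λ) (by
        filter_upwards [hU hD] with t ht using
          ht.comp ((isCP_mulLeftRight (hQ s)).comp S.Λ_cp)) fun A => ?_
    have h1 := (hC' A).sub (hDlim s hs (S.Λ A))
    rw [hψ'def, add_sub_cancel_left]
    refine h1.congr fun t => ?_
    simp only [LinearMap.comp_apply, LinearMap.mulLeftRight_apply, one_sub_mul_Λ_mul_one_sub,
      map_sub]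
    rfl
  have hbd1 : ∀ s > 0, ‖S.resΛ η s 1‖ ≤ ‖(ψ' - ψ) 1‖ := by
    intro s hs
    refine ((isCP_resΛ hη hs).norm_apply_le (hdom s hs) 1).trans ?_
    exact mul_le_of_le_one_right (norm_nonneg _) norm_one_le_one
  obtain ⟨T, hT⟩ := exists_tendsto_resΛ hη (hpos.mono fun s hs => hbd1 s hs)
  refine ⟨η, T, ψ', rfl, hη, hϑηcp, ?_, hT, ?_, ?_, hψ', ?_⟩
  -- Boundedness of `η` reduces to bounding `η|_s(1)`. It splits as `η|_sΛ(1) + η|_s(1 - Λ(1))`: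
  -- domination controls the first term, and the second converges by regularity.
  · set e : S.V := ⟨1 - S.Λ 1, h1Λ⟩ with he
    refine ⟨‖(ψ' - ψ) 1‖ + (‖η e‖ + 1), fun A => ?_⟩
    refine le_of_tendsto (hregη A).norm ?_
    filter_upwards [hpos, ((hregη e).norm).eventually (gt_mem_nhds (lt_add_one ‖η e‖))]
      with s hs h1
    have h2 : S.res η s 1 = S.resΛ η s 1 + η (S.cut s e) := by
      change η (S.cut s 1) = η (S.cut s (S.Λ 1)) + η (S.cut s (1 - S.Λ 1))
      rw [← map_add, ← map_add, add_sub_cancel]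
    have h3 := (isCPOn_res hη hs).norm_apply_le (χ := S.res η s)
      (by rw [sub_self]; exact IsCP.zero) A
    refine h3.trans (mul_le_mul_of_nonneg_right ?_ (norm_nonneg _))
    rw [h2]
    exact (norm_add_le _ _).trans (add_le_add (hbd1 s hs) h1.le)
  · refine IsCP.of_tendsto (l := 𝓝[>] (0 : ℝ)) (φ := fun s => (ψ' - ψ) - S.resΛ η s)
      (hpos.mono hdom) fun A => ?_
    rw [sub_add_eq_sub_sub]
    exact tendsto_const_nhds.sub (hT A)
  · refine hR.condNeg_of_forall hη hT hψ'cn fun s hs => ?_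
    -- Adding `w_t π'_t^#(P s * Λ A * P s)` to `N t A` leaves only the compression by `1 - P s`
    -- inside `π'_t^#`, so the approximants are still the identity minus a completely positive map,
    -- rescaled.
    refine CondNeg.of_tendsto (l := (U : Filter ℝ)) (φ := fun t => (w t : ℂ) •
      (1 - S.bdry ω' t ∘ₗ LinearMap.mulLeftRight ℂ (1 - S.P s, 1 - S.P s) ∘ₗ S.Λ)) (by
        filter_upwards [hU hpos, hU hw0] with t ht hwt using
          (condNeg_one_sub_bdry (hω'.bdry_cp t ht) (hQ s)).smul hwt.le) fun A => ?_
    rw [hϑη]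
    refine ((hNlim A).add (hB'lim s hs (S.Λ A))).congr' ?_
    filter_upwards [hU hpos] with t ht
    simp only [LinearMap.smul_apply, LinearMap.sub_apply, LinearMap.comp_apply,
      LinearMap.mulLeftRight_apply, one_sub_mul_Λ_mul_one_sub, map_sub, Module.End.one_apply]
    rw [bdry_Λ (hω'.invertible t ht)]
    change (w t : ℂ) • Ring.inverse (1 + S.resΛ ω' t) A + _ = _
    rw [← smul_add]
    congr 1
    abel
  · rw [hϑη]
    refine LinearMap.ext fun A => ?_
    exact (inverse_map_apply hψ' _).symm

end CutSystem

end QWeight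

/-! ### Multiplication operators on the half-line and strong convergence of the cut-offs. -/

namespace QWeight

section operators

variable {p : ℕ}

theorem inner_smul_right' {E : Type*} [NormedAddCommGroup E] [InnerProductSpace ℂ E] (c : ℂ)
    (x y : E) : ⟪x, c • y⟫_ℂ = c * ⟪x, y⟫_ℂ := inner_smul_right _ _ _

theorem inner_mulOp {m : ℝ → ℂ} (hm : MemLp m ⊤ halfLine) (F G : H p) :
    ⟪F, mulOp p m hm G⟫_ℂ = ∫ x, m x * ⟪F x, G x⟫_ℂ ∂halfLine := by
  rw [L2.inner_def]
  refine integral_congr_ae ?_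
  filter_upwards [coeFn_mulOp hm G] with x hx
  rw [hx]
  exact inner_smul_right _ _ _

theorem star_mulOp {m : ℝ → ℂ} (hm : MemLp m ⊤ halfLine) (h : ∀ x, starRingEnd ℂ (m x) = m x) :
    star (mulOp p m hm) = mulOp p m hm := by
  refine ContinuousLinearMap.ext fun F => ext_inner_left ℂ fun G => ?_
  rw [ContinuousLinearMap.star_eq_adjoint, ContinuousLinearMap.adjoint_inner_right,
    ← inner_conj_symm, inner_mulOp, inner_mulOp, ← integral_conj]
  refine integral_congr_ae (ae_of_all _ fun x => ?_)
  simp only [map_mul, inner_conj_symm, h]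

theorem mulOp_mul_mulOp {m n k : ℝ → ℂ} (hm : MemLp m ⊤ halfLine) (hn : MemLp n ⊤ halfLine)
    (hk : MemLp k ⊤ halfLine) (h : ∀ x, 0 < x → m x * n x = k x) :
    mulOp p m hm * mulOp p n hn = mulOp p k hk := by
  refine ContinuousLinearMap.ext fun F => Lp.ext ?_
  filter_upwards [coeFn_mulOp hm (mulOp p n hn F), coeFn_mulOp hn F, coeFn_mulOp hk F, ae_pos]
    with x h1 h2 h3 hx
  rw [mul_apply_eq_comp, h1, h2, h3, smul_smul, h x hx]

theorem mulOp_mul_comm {m n : ℝ → ℂ} (hm : MemLp m ⊤ halfLine) (hn : MemLp n ⊤ halfLine) :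
    mulOp p m hm * mulOp p n hn = mulOp p n hn * mulOp p m hm := by
  refine ContinuousLinearMap.ext fun F => Lp.ext ?_
  filter_upwards [coeFn_mulOp hm (mulOp p n hn F), coeFn_mulOp hn F,
    coeFn_mulOp hn (mulOp p m hm F), coeFn_mulOp hm F] with x h1 h2 h3 h4
  rw [mul_apply_eq_comp, mul_apply_eq_comp, h1, h2, h3, h4, smul_smul, smul_smul, mul_comm]

theorem mulOp_mul_compLpL {m : ℝ → ℂ} (hm : MemLp m ⊤ halfLine) (A : BK p) :
    mulOp p m hm * A.compLpL 2 halfLine = A.compLpL 2 halfLine * mulOp p m hm := by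
  refine ContinuousLinearMap.ext fun F => Lp.ext ?_
  filter_upwards [coeFn_mulOp hm (A.compLpL 2 halfLine F), A.coeFn_compLpL (p := 2) F,
    A.coeFn_compLpL (p := 2) (mulOp p m hm F), coeFn_mulOp hm F] with x h1 h2 h3 h4
  rw [mul_apply_eq_comp, mul_apply_eq_comp, h1, h2, h3, h4]
  exact (A.map_smul _ _).symm

theorem compLpL_mul (A B : BK p) :
    (A * B).compLpL 2 halfLine = A.compLpL 2 halfLine * B.compLpL 2 halfLine := by
  refine ContinuousLinearMap.ext fun F => Lp.ext ?_
  filter_upwards [(A * B).coeFn_compLpL (p := 2) F, B.coeFn_compLpL (p := 2) F,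
    A.coeFn_compLpL (p := 2) (B.compLpL 2 halfLine F)] with x h1 h2 h3
  rw [mul_apply_eq_comp, h1, h3, h2]
  rfl

theorem star_compLpL (A : BK p) :
    star (A.compLpL 2 halfLine) = (star A).compLpL 2 halfLine := by
  refine ContinuousLinearMap.ext fun F => ext_inner_left ℂ fun G => ?_
  rw [ContinuousLinearMap.star_eq_adjoint, ContinuousLinearMap.adjoint_inner_right,
    L2.inner_def, L2.inner_def]
  refine integral_congr_ae ?_
  filter_upwards [A.coeFn_compLpL (p := 2) G, (star A).coeFn_compLpL (p := 2) F] with x h1 h2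
  rw [h1, h2]
  exact (ContinuousLinearMap.adjoint_inner_right A (G x) (F x)).symm

theorem coeFn_Lam (A : BK p) (F : H p) :
    Lam p A F =ᵐ[halfLine] fun x => expFn x • A (F x) := by
  filter_upwards [coeFn_mulOp memLp_expFn (A.compLpL 2 halfLine F), A.coeFn_compLpL (p := 2) F]
    with x h1 h2
  change mulOp p expFn memLp_expFn (A.compLpL 2 halfLine F) x = _
  rw [h1, h2]

/-- The form is the integral over `x` of `e^{-x}` times the form of the matrix `A` at the values `F
i x`. -/
theorem isCP_Lam : IsCP (Lam p) := by
  intro n A hA F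
  have h1 : ∀ i j, ⟪F i, Lam p (A i j) (F j)⟫_ℂ =
      ∫ x, ⟪F i x, Lam p (A i j) (F j) x⟫_ℂ ∂halfLine := fun i j => L2.inner_def _ _
  simp only [h1]
  have h2 : ∀ i j, Integrable (fun x => ⟪F i x, Lam p (A i j) (F j) x⟫_ℂ) halfLine :=
    fun i j => L2.integrable_inner _ _
  rw [Finset.sum_congr rfl fun i _ => (integral_finsetSum _ fun j _ => h2 i j).symm,
    ← integral_finsetSum _ fun i _ => integrable_finsetSum _ fun j _ => h2 i j]
  refine integral_nonneg_of_ae ?_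
  have h3 : ∀ᵐ x ∂halfLine, ∀ i j, Lam p (A i j) (F j) x = expFn x • A i j (F j x) :=
    ae_all_iff.2 fun i => ae_all_iff.2 fun j => coeFn_Lam (A i j) (F j)
  filter_upwards [h3] with x hx
  simp only [hx, inner_smul_right', ← Finset.mul_sum]
  exact mul_nonneg (Complex.zero_le_real.2 (Real.exp_pos _).le) (hA fun i => F i x)

theorem conj_cutFn (t x : ℝ) : starRingEnd ℂ (cutFn t x) = cutFn t x := by
  unfold cutFn
  by_cases hx : x ∈ Set.Ioi t <;> simp [hx]

theorem conj_invSqrtFn (t x : ℝ) : starRingEnd ℂ (invSqrtFn t x) = invSqrtFn t x := by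
  unfold invSqrtFn
  by_cases hx : x ∈ Set.Ioi t <;> simp only [hx, Set.indicator_of_mem, Set.indicator_of_notMem,
    not_false_eq_true, Complex.conj_ofReal, map_zero]

theorem sqrtFn_mul_invSqrtFn {t x : ℝ} (hx : 0 < x) : sqrtFn x * invSqrtFn t x = cutFn t x := by
  unfold sqrtFn invSqrtFn cutFn
  by_cases hxt : x ∈ Set.Ioi t
  · rw [Set.indicator_of_mem hxt, Set.indicator_of_mem hxt, ← Complex.ofReal_mul,
      mul_inv_cancel₀, Complex.ofReal_one]
    have := Real.exp_lt_one_iff.2 (show -x < 0 by linarith)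
    exact (Real.sqrt_pos.2 (by linarith)).ne'
  · rw [Set.indicator_of_notMem hxt, Set.indicator_of_notMem hxt, mul_zero]

theorem cutFn_mul_cutFn {s t : ℝ} (h : s ≤ t) (x : ℝ) : cutFn s x * cutFn t x = cutFn t x := by
  unfold cutFn
  by_cases hx : x ∈ Set.Ioi t
  · have hx' : x ∈ Set.Ioi s := lt_of_le_of_lt h hx
    simp [Set.indicator_of_mem hx, Set.indicator_of_mem hx']
  · simp [Set.indicator_of_notMem hx]

theorem star_cutProj (t : ℝ) : star (cutProj p t) = cutProj p t :=
  star_mulOp _ (conj_cutFn t)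

theorem coe_cut {t : ℝ} (ht : 0 < t) (A : BH p) :
    (cut p t A : BH p) = cutProj p t * A * cutProj p t := by
  rw [cut, dif_pos ht]
  rfl

/-- The cut-off system of the half-line. -/
noncomputable def cutSystem (p : ℕ) : CutSystem (K p) (H p) where
  P := cutProj p
  Λ := Lam p
  V := frakA p
  cut := cut p
  star_P := star_cutProj
  P_mul_P s t h := mulOp_mul_mulOp _ _ _ fun x _ => cutFn_mul_cutFn h x
  P_mul_Λ t A := by
    change mulOp p (cutFn t) (memLp_cutFn t) *
      (mulOp p expFn memLp_expFn * A.compLpL 2 halfLine) =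
      (mulOp p expFn memLp_expFn * A.compLpL 2 halfLine) * mulOp p (cutFn t) (memLp_cutFn t)
    rw [← mul_assoc, mulOp_mul_comm, mul_assoc, mul_assoc, mulOp_mul_compLpL]
  coe_cut t ht A := coe_cut ht A
  Λ_cp := isCP_Lam

/-- Multiplication by `(1 - e^{-x})^{-1/2}` on `(t, ∞)`. -/
noncomputable def invSqrtOp (p : ℕ) {t : ℝ} (ht : 0 < t) : BH p :=
  mulOp p (invSqrtFn t) (memLp_invSqrtFn ht)

theorem star_invSqrtOp {t : ℝ} (ht : 0 < t) : star (invSqrtOp p ht) = invSqrtOp p ht :=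
  star_mulOp _ (conj_invSqrtFn t)

theorem sqrtOp_mul_invSqrtOp {t : ℝ} (ht : 0 < t) : sqrtOp p * invSqrtOp p ht = cutProj p t :=
  mulOp_mul_mulOp _ _ _ fun _ hx => sqrtFn_mul_invSqrtFn hx

theorem invSqrtOp_mul_sqrtOp {t : ℝ} (ht : 0 < t) : invSqrtOp p ht * sqrtOp p = cutProj p t := by
  rw [← sqrtOp_mul_invSqrtOp ht]
  exact mulOp_mul_comm _ _

theorem coe_toA (B : BH p) : (toA p B : BH p) = sqrtOp p * B * sqrtOp p := rfl

/-- On `(t, ∞)` the factor `(1 - e^{-x})^{1/2}` has a bounded inverse; this explicit preimage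
transfers normality from `ω ∘ₗ toA p` to `ω|_t`. -/
theorem cut_eq_toA {t : ℝ} (ht : 0 < t) (A : BH p) :
    cut p t A = toA p (invSqrtOp p ht * A * invSqrtOp p ht) := by
  apply Subtype.ext
  rw [coe_cut ht, coe_toA]
  conv_lhs => rw [← invSqrtOp_mul_sqrtOp ht]; enter [1, 1]; rw [invSqrtOp_mul_sqrtOp ht,
    ← sqrtOp_mul_invSqrtOp ht]
  simp only [mul_assoc]

theorem cut_toA {t : ℝ} (ht : 0 < t) (B : BH p) :
    cut p t (toA p B) = toA p (cutProj p t * B * cutProj p t) := by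
  apply Subtype.ext
  rw [coe_cut ht, coe_toA, coe_toA]
  have h : cutProj p t * sqrtOp p = sqrtOp p * cutProj p t := mulOp_mul_comm _ _
  calc cutProj p t * (sqrtOp p * B * sqrtOp p) * cutProj p t
      = (cutProj p t * sqrtOp p) * B * (sqrtOp p * cutProj p t) := by simp only [mul_assoc]
    _ = _ := by
      rw [← h]
      nth_rewrite 1 [h]
      simp only [mul_assoc]

theorem inner_star_mul_mul {G : Type*} [NormedAddCommGroup G] [InnerProductSpace ℂ G]
    [CompleteSpace G] {M : G →L[ℂ] G} (hM : star M = M) (A : G →L[ℂ] G) (x y : G) :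
    ⟪x, (M * A * M) y⟫_ℂ = ⟪M x, A (M y)⟫_ℂ := by
  nth_rewrite 1 [← hM]
  simp only [mul_assoc, mul_apply_eq_comp, ContinuousLinearMap.star_eq_adjoint,
    ContinuousLinearMap.adjoint_inner_right]

theorem cutProj_mul_cutProj (t : ℝ) : cutProj p t * cutProj p t = cutProj p t :=
  (cutSystem p).P_mul_P t t le_rfl

theorem norm_cutProj_apply_le (t : ℝ) (F : H p) : ‖cutProj p t F‖ ≤ ‖F‖ := by
  have h1 : ‖cutProj p t F‖ ^ 2 ≤ ‖F‖ * ‖cutProj p t F‖ := by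
    have h2 := inner_star_mul_mul (star_cutProj t) 1 F F
    rw [mul_one, cutProj_mul_cutProj,
      one_apply_eq_self, inner_self_eq_norm_sq_to_K] at h2
    have h3 := norm_inner_le_norm (𝕜 := ℂ) F (cutProj p t F)
    rw [h2] at h3
    simpa using h3
  by_contra hcon
  push Not at hcon
  nlinarith [norm_nonneg F]

theorem norm_cutProj_le (t : ℝ) : ‖cutProj p t‖ ≤ 1 :=
  ContinuousLinearMap.opNorm_le_bound _ zero_le_one fun F => by
    rw [one_mul]; exact norm_cutProj_apply_le t F

theorem tendsto_inner_cutProj (F : H p) :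
    Tendsto (fun t => ⟪F, cutProj p t F⟫_ℂ) (𝓝[>] 0) (𝓝 ⟪F, F⟫_ℂ) := by
  simp only [cutProj, inner_mulOp]
  rw [L2.inner_def]
  refine tendsto_integral_filter_of_dominated_convergence (fun x => ‖⟪F x, F x⟫_ℂ‖) ?_ ?_ ?_ ?_
  · exact Eventually.of_forall fun t =>
      (memLp_cutFn t).aestronglyMeasurable.mul (L2.integrable_inner F F).aestronglyMeasurable
  · refine Eventually.of_forall fun t => ae_of_all _ fun x => ?_
    unfold cutFn
    by_cases hx : x ∈ Set.Ioi t <;> simp [hx]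
  · exact (L2.integrable_inner F F).norm
  · filter_upwards [ae_pos] with x hx
    refine tendsto_const_nhds.congr' ?_
    filter_upwards [Ioo_mem_nhdsGT hx] with t ht
    have : x ∈ Set.Ioi t := ht.2
    rw [cutFn, Set.indicator_of_mem this, one_mul]

/-- For an orthogonal projection, `‖P F - F‖² = ⟪F, F⟫ - ⟪F, P F⟫`, so weak convergence is enough.
-/
theorem tendsto_cutProj (F : H p) : Tendsto (fun t => cutProj p t F) (𝓝[>] 0) (𝓝 F) := by
  rw [tendsto_iff_norm_sub_tendsto_zero]
  have h1 : ∀ t, ‖cutProj p t F - F‖ ^ 2 = ‖⟪F, F⟫_ℂ - ⟪F, cutProj p t F⟫_ℂ‖ := by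
    intro t
    have h2 := inner_star_mul_mul (star_cutProj t) 1 F F
    rw [mul_one, cutProj_mul_cutProj,
      one_apply_eq_self] at h2
    have h3 : ⟪cutProj p t F - F, cutProj p t F - F⟫_ℂ = ⟪F, F⟫_ℂ - ⟪F, cutProj p t F⟫_ℂ := by
      have h4 : ⟪cutProj p t F, F⟫_ℂ = ⟪F, cutProj p t F⟫_ℂ := by
        rw [← ContinuousLinearMap.adjoint_inner_right, ← ContinuousLinearMap.star_eq_adjoint,
          star_cutProj]
      rw [inner_sub_left, inner_sub_right, inner_sub_right, h4, ← h2]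
      ring
    rw [← h3, inner_self_eq_norm_sq_to_K]
    simp
  have h2 : Tendsto (fun t => ‖cutProj p t F - F‖ ^ 2) (𝓝[>] 0) (𝓝 0) := by
    simp only [h1]
    have := ((tendsto_const_nhds (x := ⟪F, F⟫_ℂ)).sub (tendsto_inner_cutProj F)).norm
    rwa [sub_self, norm_zero] at this
  have h3 := (Real.continuous_sqrt.tendsto 0).comp h2
  simpa [Function.comp_def, Real.sqrt_sq (norm_nonneg _)] using h3

theorem tendsto_tsum_inner_cutProj {J : Type*} {F G : J → H p}
    (hF : Summable fun k => ‖F k‖ ^ 2) (hG : Summable fun k => ‖G k‖ ^ 2) (B : BH p) :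
    Tendsto (fun t => ∑' k, ⟪F k, (cutProj p t * B * cutProj p t) (G k)⟫_ℂ) (𝓝[>] 0)
      (𝓝 (∑' k, ⟪F k, B (G k)⟫_ℂ)) := by
  simp only [inner_star_mul_mul (star_cutProj _)]
  refine tendsto_tsum_of_dominated_convergence ((hF.add hG).mul_left ‖B‖) (fun k => ?_) ?_
  · exact (tendsto_cutProj (F k)).inner ((B.continuous.tendsto _).comp (tendsto_cutProj (G k)))
  · refine Eventually.of_forall fun t k => ?_
    have h1 : ‖⟪cutProj p t (F k), B (cutProj p t (G k))⟫_ℂ‖ ≤ ‖F k‖ * (‖B‖ * ‖G k‖) :=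
      (norm_inner_le_norm _ _).trans (mul_le_mul (norm_cutProj_apply_le t _)
        ((B.le_opNorm _).trans (mul_le_mul_of_nonneg_left (norm_cutProj_apply_le t _)
          (norm_nonneg _))) (norm_nonneg _) (norm_nonneg _))
    nlinarith [mul_nonneg (norm_nonneg B) (sq_nonneg (‖F k‖ - ‖G k‖)),
      mul_nonneg (norm_nonneg B) (sq_nonneg (‖F k‖ + ‖G k‖))]

end operators
end QWeight

/-! ### Normality of functionals and regularity of `b`-weight maps. -/

namespace QWeight

section normal

variable {G : Type*} [NormedAddCommGroup G] [InnerProductSpace ℂ G]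

/-- Normal functionals on `B(G)`. -/
def IsNormalFunctional (φ : (G →L[ℂ] G) → ℂ) : Prop :=
  ∃ F F' : ℕ → G, (Summable fun k => ‖F k‖ ^ 2) ∧ (Summable fun k => ‖F' k‖ ^ 2) ∧
    ∀ A : G →L[ℂ] G, HasSum (fun k => ⟪F k, A (F' k)⟫_ℂ) (φ A)

theorem IsNormalFunctional.zero : IsNormalFunctional fun _ : G →L[ℂ] G => (0 : ℂ) :=
  ⟨0, 0, by simp [summable_zero], by simp [summable_zero], fun A => by simp [hasSum_zero]⟩

theorem IsNormalFunctional.add {φ χ : (G →L[ℂ] G) → ℂ} (hφ : IsNormalFunctional φ)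
    (hχ : IsNormalFunctional χ) : IsNormalFunctional fun A => φ A + χ A := by
  obtain ⟨F, F', hF, hF', h⟩ := hφ
  obtain ⟨F₁, F₁', hF₁, hF₁', h₁⟩ := hχ
  let e := Equiv.natSumNatEquivNat.symm
  refine ⟨fun k => Sum.elim F F₁ (e k), fun k => Sum.elim F' F₁' (e k), ?_, ?_, fun A => ?_⟩
  · exact (e.summable_iff (f := fun k => ‖Sum.elim F F₁ k‖ ^ 2)).2 (Summable.sum _ hF hF₁)
  · exact (e.summable_iff (f := fun k => ‖Sum.elim F' F₁' k‖ ^ 2)).2 (Summable.sum _ hF' hF₁')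
  · exact (e.hasSum_iff (f := fun k => ⟪Sum.elim F F₁ k, A (Sum.elim F' F₁' k)⟫_ℂ)).2
      (HasSum.sum (h A) (h₁ A))

theorem IsNormalFunctional.const_mul {φ : (G →L[ℂ] G) → ℂ} (hφ : IsNormalFunctional φ) (c : ℂ) :
    IsNormalFunctional fun A => c * φ A := by
  obtain ⟨F, F', hF, hF', h⟩ := hφ
  refine ⟨F, fun k => c • F' k, hF, ?_, fun A => ?_⟩
  · simpa only [norm_smul, mul_pow] using hF'.mul_left _
  · simpa only [map_smul, inner_smul_right] using (h A).mul_left c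

theorem IsNormalFunctional.sum {ι : Type*} (s : Finset ι) {φ : ι → (G →L[ℂ] G) → ℂ}
    (hφ : ∀ i, IsNormalFunctional (φ i)) : IsNormalFunctional fun A => ∑ i ∈ s, φ i A := by
  classical
  induction s using Finset.induction_on with
  | empty => simpa using IsNormalFunctional.zero
  | insert i s hi ih => simpa only [Finset.sum_insert hi] using (hφ i).add ih

/-- Precomposition of a normal functional with `A ↦ M * A * M`. -/
theorem IsNormalFunctional.conj [CompleteSpace G] {φ : (G →L[ℂ] G) → ℂ}
    (hφ : IsNormalFunctional φ) {M : G →L[ℂ] G} (hM : star M = M) :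
    IsNormalFunctional fun A => φ (M * A * M) := by
  obtain ⟨F, F', hF, hF', h⟩ := hφ
  have hsum : ∀ F : ℕ → G, (Summable fun k => ‖F k‖ ^ 2) → Summable fun k => ‖M (F k)‖ ^ 2 :=
    fun F hF => (hF.mul_left (‖M‖ ^ 2)).of_nonneg_of_le (fun k => by positivity) fun k => by
      rw [← mul_pow]; gcongr; exact M.le_opNorm _
  exact ⟨_, _, hsum F hF, hsum F' hF', fun A => by
    simpa only [inner_star_mul_mul hM] using h (M * A * M)⟩

end normal

section matrixElements

variable {E : Type*} [NormedAddCommGroup E] [InnerProductSpace ℂ E] {ι : Type*} [Fintype ι]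
  (b : OrthonormalBasis ι ℂ E)

theorem eq_sum_rankOne (B : E →L[ℂ] E) :
    B = ∑ i, ∑ j, ⟪b i, B (b j)⟫_ℂ • InnerProductSpace.rankOne ℂ (b i) (b j) := by
  ext x
  simp only [sum_apply, smul_apply, InnerProductSpace.rankOne_apply]
  rw [Finset.sum_comm]
  conv_lhs => rw [← b.sum_repr' x]
  rw [map_sum]
  refine Finset.sum_congr rfl fun j _ => ?_
  rw [map_smul]
  conv_lhs => rw [← b.sum_repr' (B (b j)), Finset.smul_sum]
  exact Finset.sum_congr rfl fun i _ => smul_comm _ _ _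

/-- Matrix elements of `χ B` are fixed finite combinations of those of `B`; hence composing with `χ`
preserves normality. -/
theorem inner_map_eq_sum (χ : Module.End ℂ (E →L[ℂ] E)) (B : E →L[ℂ] E) (f g : E) :
    ⟪f, χ B g⟫_ℂ = ∑ i, ∑ j,
      ⟪f, χ (InnerProductSpace.rankOne ℂ (b i) (b j)) g⟫_ℂ * ⟪b i, B (b j)⟫_ℂ := by
  conv_lhs => rw [eq_sum_rankOne b B]
  simp only [map_sum, map_smul, sum_apply, smul_apply, inner_sum,
    inner_smul_right, mul_comm]

theorem tendsto_of_tendsto_inner {α : Type*} {l : Filter α} {B : α → (E →L[ℂ] E)}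
    {C : E →L[ℂ] E} (h : ∀ i j, Tendsto (fun t => ⟪b i, B t (b j)⟫_ℂ) l (𝓝 ⟪b i, C (b j)⟫_ℂ)) :
    Tendsto B l (𝓝 C) := by
  rw [eq_sum_rankOne b C]
  refine Tendsto.congr (fun t => (eq_sum_rankOne b (B t)).symm) ?_
  exact tendsto_finsetSum _ fun i _ => tendsto_finsetSum _ fun j _ => (h i j).smul_const _

theorem isNormalFunctional_comp (b : OrthonormalBasis ι ℂ E) {G : Type*} [NormedAddCommGroup G] [InnerProductSpace ℂ G]
    {φ : (G →L[ℂ] G) → (E →L[ℂ] E)}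
    (hφ : ∀ f g, IsNormalFunctional fun A => ⟪f, φ A g⟫_ℂ) (χ : Module.End ℂ (E →L[ℂ] E))
    (f g : E) : IsNormalFunctional fun A => ⟪f, χ (φ A) g⟫_ℂ := by
  rw [funext fun A => inner_map_eq_sum b χ (φ A) f g]
  exact IsNormalFunctional.sum _ fun i => IsNormalFunctional.sum _ fun j =>
    (hφ (b i) (b j)).const_mul _

theorem isNormalFunctional_sub {G : Type*} [NormedAddCommGroup G] [InnerProductSpace ℂ G]
    {φ χ : (G →L[ℂ] G) → (E →L[ℂ] E)}
    (hφ : ∀ f g, IsNormalFunctional fun A => ⟪f, φ A g⟫_ℂ)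
    (hχ : ∀ f g, IsNormalFunctional fun A => ⟪f, χ A g⟫_ℂ)
    (f g : E) : IsNormalFunctional fun A => ⟪f, (φ A - χ A) g⟫_ℂ := by
  have := (hφ f g).add ((hχ f g).const_mul (-1))
  simpa only [sub_apply, inner_sub_right, neg_one_mul, ← sub_eq_add_neg] using this

end matrixElements

section weights

variable {p : ℕ} {ω η : WeightMap p}

theorem IsNormalMap.comp {φ : BH p →ₗ[ℂ] BK p} (hφ : IsNormalMap φ)
    (χ : Module.End ℂ (BK p)) : IsNormalMap (χ ∘ₗ φ) :=
  isNormalFunctional_comp (φ := fun A => φ A) (EuclideanSpace.basisFun (Fin p) ℂ) hφ χ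

theorem IsNormalMap.sub {φ χ : BH p →ₗ[ℂ] BK p} (hφ : IsNormalMap φ) (hχ : IsNormalMap χ) :
    IsNormalMap (φ - χ) :=
  isNormalFunctional_sub (φ := fun A => φ A) (χ := fun A => χ A) hφ hχ

theorem IsBWeightMap.comp (hω : IsBWeightMap ω) (χ : Module.End ℂ (BK p)) :
    IsBWeightMap (χ ∘ₗ ω) :=
  IsNormalMap.comp (φ := ω ∘ₗ toA p) hω χ

theorem IsBWeightMap.sub (hω : IsBWeightMap ω) (hη : IsBWeightMap η) :
    IsBWeightMap (ω - η) :=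
  IsNormalMap.sub (φ := ω ∘ₗ toA p) (χ := η ∘ₗ toA p) hω hη

theorem IsBWeightMap.isNormalMap_restr (hω : IsBWeightMap ω) {t : ℝ} (ht : 0 < t) :
    IsNormalMap (restr ω t) := by
  intro f g
  have h : IsNormalFunctional fun A => ⟪f, (ω ∘ₗ toA p) A g⟫_ℂ := hω f g
  have h' := h.conj (star_invSqrtOp ht)
  have : ∀ A, restr ω t A = (ω ∘ₗ toA p) (invSqrtOp p ht * A * invSqrtOp p ht) := fun A =>
    congrArg ω (cut_eq_toA ht A)
  simp only [← this] at h'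
  exact h'

/-- Normality writes matrix elements as absolutely convergent series, to which strong convergence of
the projections and dominated convergence apply. -/
theorem IsBWeightMap.isRegular (hω : IsBWeightMap ω) : (cutSystem p).IsRegular ω := by
  intro A
  obtain ⟨B, rfl⟩ : ∃ B, toA p B = A := LinearMap.surjective_rangeRestrict _ A
  refine tendsto_of_tendsto_inner (EuclideanSpace.basisFun (Fin p) ℂ) fun i j => ?_
  obtain ⟨F, F', hF, hF', h⟩ := hω (EuclideanSpace.basisFun (Fin p) ℂ i)
    (EuclideanSpace.basisFun (Fin p) ℂ j)
  have h1 := tendsto_tsum_inner_cutProj hF hF' B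
  rw [(h B).tsum_eq] at h1
  refine h1.congr' ?_
  filter_upwards [eventually_mem_nhdsWithin] with t ht
  rw [(h _).tsum_eq]
  change _ = ⟪_, ω (cut p t (toA p B)) _⟫_ℂ
  rw [cut_toA ht]
  rfl

end weights

end QWeight

/-! ### Series representations and the `g`- and `h`-parts of the kernel. -/

namespace QWeight

section series

variable {E G J : Type*} [NormedAddCommGroup E] [InnerProductSpace ℂ E]
  [NormedAddCommGroup G] [InnerProductSpace ℂ G]

theorem inner_sum_smul_sum_smul {ι : Type*} [Fintype ι] (B : G →L[ℂ] G) (c d : ι → ℂ)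
    (x y : ι → G) : ⟪∑ i, c i • x i, B (∑ j, d j • y j)⟫_ℂ =
      ∑ i, ∑ j, starRingEnd ℂ (c i) * (d j * ⟪x i, B (y j)⟫_ℂ) := by
  rw [sum_inner]
  refine Finset.sum_congr rfl fun i _ => ?_
  rw [map_sum, inner_sum]
  refine Finset.sum_congr rfl fun j _ => ?_
  rw [map_smul, inner_smul_left, inner_smul_right]

/-- A series representation of a sesquilinear form has to be checked on a basis only. -/
theorem hasSum_inner_of_basis {ι : Type*} [Fintype ι] (b : OrthonormalBasis ι ℂ E)
    {V : J → E →ₗ[ℂ] G} {B : G →L[ℂ] G} {C : E →L[ℂ] E}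
    (h : ∀ i j, HasSum (fun k => ⟪V k (b i), B (V k (b j))⟫_ℂ) ⟪b i, C (b j)⟫_ℂ) (f g : E) :
    HasSum (fun k => ⟪V k f, B (V k g)⟫_ℂ) ⟪f, C g⟫_ℂ := by
  rw [← b.sum_repr' f, ← b.sum_repr' g]
  simp only [map_sum (V _), map_smul (V _), inner_sum_smul_sum_smul]
  exact hasSum_sum fun i _ => hasSum_sum fun j _ => ((h i j).mul_left _).mul_left _

/-- A map with a series representation is completely positive. -/
theorem isCP_of_hasSum {φ : (G →L[ℂ] G) →ₗ[ℂ] (E →L[ℂ] E)} {V : J → E →ₗ[ℂ] G}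
    (h : ∀ B f g, HasSum (fun k => ⟪V k f, B (V k g)⟫_ℂ) ⟪f, φ B g⟫_ℂ) : IsCP φ := by
  intro n A hA x
  exact (hasSum_sum fun i _ => hasSum_sum fun j _ => h (A i j) (x i) (x j)).nonneg
    fun k => hA fun i => V k (x i)

theorem mul_le_sq_div_add {a b r : ℝ} (hr : 0 < r) : a * b ≤ a ^ 2 / r + r * b ^ 2 := by
  have h2 : a ^ 2 / r + r * b ^ 2 - a * b = ((a - r * b) ^ 2 + a ^ 2 + (r * b) ^ 2) / (2 * r) := by
    field_simp; ring
  have h3 : 0 ≤ ((a - r * b) ^ 2 + a ^ 2 + (r * b) ^ 2) / (2 * r) := by positivity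
  linarith

/-- The terms mixing large vectors `x, y` with bounded perturbations `a, b` are split with a free
weight `r`, to be chosen later to balance the two contributions. -/
theorem norm_sub_le_of_hasSum {x y a b : J → G} (B : G →L[ℂ] G) {r X Y P Q : ℝ} (hr : 0 < r)
    (hx : HasSum (fun k => ‖x k‖ ^ 2) X) (hy : HasSum (fun k => ‖y k‖ ^ 2) Y)
    (ha : HasSum (fun k => ‖a k‖ ^ 2) P) (hb : HasSum (fun k => ‖b k‖ ^ 2) Q) {s s' : ℂ}
    (h : HasSum (fun k => ⟪x k + a k, B (y k + b k)⟫_ℂ) s)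
    (h' : HasSum (fun k => ⟪x k, B (y k)⟫_ℂ) s') :
    ‖s - s'‖ ≤ ‖B‖ * ((X + Y) / r + (r + 1) * (P + Q)) := by
  refine (h.sub h').norm_le_of_bounded
    ((((hx.add hy).div_const r).add ((ha.add hb).mul_left (r + 1))).mul_left ‖B‖) fun k => ?_
  have e1 : ⟪x k + a k, B (y k + b k)⟫_ℂ - ⟪x k, B (y k)⟫_ℂ =
      ⟪x k, B (b k)⟫_ℂ + ⟪a k, B (y k)⟫_ℂ + ⟪a k, B (b k)⟫_ℂ := by
    rw [map_add, inner_add_left, inner_add_right, inner_add_right]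
    ring
  have e2 : ∀ u v : G, ‖⟪u, B v⟫_ℂ‖ ≤ ‖B‖ * (‖u‖ * ‖v‖) := fun u v =>
    (norm_inner_le_norm _ _).trans
      ((mul_le_mul_of_nonneg_left (B.le_opNorm v) (norm_nonneg u)).trans_eq (by ring))
  rw [e1]
  refine norm_add₃_le.trans (((add_le_add (add_le_add (e2 _ _) (e2 _ _)) (e2 _ _))).trans ?_)
  rw [← mul_add, ← mul_add]
  refine mul_le_mul_of_nonneg_left ?_ (norm_nonneg B)
  have e3 := mul_le_sq_div_add (a := ‖x k‖) (b := ‖b k‖) hr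
  have e4 := mul_le_sq_div_add (a := ‖y k‖) (b := ‖a k‖) hr
  rw [add_div]
  nlinarith [sq_nonneg (‖a k‖ - ‖b k‖), sq_nonneg (‖a k‖), sq_nonneg (‖b k‖)]

theorem inner_smul_smul (c d : ℂ) (f g : E) :
    ⟪c • f, d • g⟫_ℂ = starRingEnd ℂ c * d * ⟪f, g⟫_ℂ := by
  rw [inner_smul_left, inner_smul_right, mul_assoc]

end series

theorem inner_eq_integral_mul {p : ℕ} {F F' : H p} {c d : ℝ → ℂ} {f f' : K p}
    (hF : F =ᵐ[halfLine] fun x => c x • f) (hF' : F' =ᵐ[halfLine] fun x => d x • f') :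
    ⟪F, F'⟫_ℂ = (∫ x, starRingEnd ℂ (c x) * d x ∂halfLine) * ⟪f, f'⟫_ℂ := by
  rw [L2.inner_def, ← integral_mul_const]
  refine integral_congr_ae ?_
  filter_upwards [hF, hF'] with x h1 h2
  rw [h1, h2]
  exact inner_smul_smul _ _ _ _

theorem inner_self_eq_ofReal {E : Type*} [NormedAddCommGroup E] [InnerProductSpace ℂ E] (x : E) :
    ⟪x, x⟫_ℂ = ((‖x‖ ^ 2 : ℝ) : ℂ) := by
  rw [inner_self_eq_norm_sq_to_K]
  simp

theorem conj_mul_self_eq (c : ℂ) : starRingEnd ℂ c * c = ((‖c‖ ^ 2 : ℝ) : ℂ) := by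
  rw [← Complex.normSq_eq_conj_mul_self, Complex.normSq_eq_norm_sq]

namespace Kernel

variable {p : ℕ} {J : Type} (D : Kernel p J)

/-- The vector `(I - Λ)^{1/2} (f ⊗ g_k)`. -/
noncomputable def gMap (k : J) : K p →ₗ[ℂ] H p where
  toFun f := (ContinuousLinearMap.toSpanSingleton ℂ f).compLp (D.g_memLp k).toLp
  map_add' f f' := by
    rw [ContinuousLinearMap.toSpanSingleton_add, ContinuousLinearMap.add_compLp]
  map_smul' c f := by
    rw [ContinuousLinearMap.toSpanSingleton_smul, ContinuousLinearMap.smul_compLp]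
    rfl

/-- The vector `∑ᵢ fᵢ h_{ik}`. -/
noncomputable def hMap (k : J) : K p →ₗ[ℂ] H p where
  toFun f := ∑ i, f i • D.h i k
  map_add' f f' := by
    simp only [PiLp.add_apply, add_smul, Finset.sum_add_distrib]
  map_smul' c f := by
    simp only [PiLp.smul_apply, smul_eq_mul, mul_smul, Finset.smul_sum, RingHom.id_apply]

theorem hMap_basisFun (k : J) (i : Fin p) :
    D.hMap k (EuclideanSpace.basisFun (Fin p) ℂ i) = D.h i k := by
  change ∑ j, (EuclideanSpace.basisFun (Fin p) ℂ i) j • D.h j k = _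
  rw [Finset.sum_eq_single i]
  · simp
  · intro j _ hj
    simp [hj]
  · simp

theorem coeFn_gMap (k : J) (f : K p) :
    D.gMap k f =ᵐ[halfLine] fun x => (sqrtFn x * D.g k x) • f := by
  filter_upwards [(ContinuousLinearMap.toSpanSingleton ℂ f).coeFn_compLp (D.g_memLp k).toLp,
    (D.g_memLp k).coeFn_toLp] with x h1 h2
  change (ContinuousLinearMap.toSpanSingleton ℂ f).compLp (D.g_memLp k).toLp x = _
  rw [h1, h2]
  rfl

theorem inner_gMap_self (k : J) (f : K p) : ‖D.gMap k f‖ ^ 2 =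
    (∫ x, (1 - Real.exp (-x)) * ‖D.g k x‖ ^ 2 ∂halfLine) * ‖f‖ ^ 2 := by
  have h := inner_eq_integral_mul (D.coeFn_gMap k f) (D.coeFn_gMap k f)
  have h2 : ∫ x, starRingEnd ℂ (sqrtFn x * D.g k x) * (sqrtFn x * D.g k x) ∂halfLine =
      ((∫ x, (1 - Real.exp (-x)) * ‖D.g k x‖ ^ 2 ∂halfLine : ℝ) : ℂ) := by
    rw [← integral_complex_ofReal]
    refine integral_congr_ae ?_
    filter_upwards [ae_pos] with x hx
    rw [conj_mul_self_eq, norm_mul, mul_pow, sqrtFn, Complex.norm_real, Real.norm_eq_abs, sq_abs,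
      Real.sq_sqrt]
    have := Real.exp_lt_one_iff.2 (show -x < 0 by linarith)
    linarith
  rw [h2, inner_self_eq_ofReal, inner_self_eq_ofReal] at h
  exact_mod_cast h

/-- The vector `f ⊗ E(t, ∞) g_k`. -/
noncomputable def gCut {t : ℝ} (ht : 0 < t) (k : J) : K p →ₗ[ℂ] H p :=
  (invSqrtOp p ht : H p →ₗ[ℂ] H p) ∘ₗ D.gMap k

theorem coeFn_gCut {t : ℝ} (ht : 0 < t) (k : J) (f : K p) :
    D.gCut ht k f =ᵐ[halfLine] fun x => (cutFn t x * D.g k x) • f := by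
  filter_upwards [coeFn_mulOp (memLp_invSqrtFn ht) (D.gMap k f), D.coeFn_gMap k f, ae_pos]
    with x h1 h2 hx
  change mulOp p (invSqrtFn t) (memLp_invSqrtFn ht) (D.gMap k f) x = _
  rw [h1, h2, smul_smul, ← sqrtFn_mul_invSqrtFn hx]
  congr 1
  ring

theorem compLpL_gCut {t : ℝ} (ht : 0 < t) (k : J) (A : BK p) (f : K p) :
    A.compLpL 2 halfLine (D.gCut ht k f) = D.gCut ht k (A f) := by
  refine Lp.ext ?_
  filter_upwards [A.coeFn_compLpL (p := 2) (D.gCut ht k f), D.coeFn_gCut ht k f,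
    D.coeFn_gCut ht k (A f)] with x h1 h2 h3
  rw [h1, h2, h3]
  exact A.map_smul _ _

/-- `Λ(A)` acts on `f ⊗ g` only through `f`, up to the scalar factor `e^{-x}`. Summed over `k`,
these terms form the leading part `w_t A` of `ϑ|_tΛ(A)`. -/
theorem inner_gCut_Lam {t : ℝ} (ht : 0 < t) (k : J) (A : BK p) (f f' : K p) :
    ⟪D.gCut ht k f, Lam p A (D.gCut ht k f')⟫_ℂ =
      ((∫ x in Set.Ioi t, Real.exp (-x) * ‖D.g k x‖ ^ 2 : ℝ) : ℂ) * ⟪f, A f'⟫_ℂ := by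
  have h1 : Lam p A (D.gCut ht k f') =ᵐ[halfLine]
      fun x => (expFn x * (cutFn t x * D.g k x)) • A f' := by
    filter_upwards [coeFn_Lam A (D.gCut ht k f'), D.coeFn_gCut ht k f'] with x h1 h2
    rw [h1, h2]
    exact (congrArg (expFn x • ·) (A.map_smul _ _)).trans (smul_smul _ _ _)
  rw [inner_eq_integral_mul (D.coeFn_gCut ht k f) h1]
  congr 1
  have h2 : halfLine.restrict (Set.Ioi t) = volume.restrict (Set.Ioi t) := by
    rw [halfLine, Measure.restrict_restrict measurableSet_Ioi,
      Set.inter_eq_left.2 (Set.Ioi_subset_Ioi ht.le)]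
  rw [← integral_complex_ofReal, ← h2, ← integral_indicator measurableSet_Ioi]
  refine integral_congr_ae (ae_of_all _ fun x => ?_)
  by_cases hx : x ∈ Set.Ioi t
  · simp only [cutFn, Set.indicator_of_mem hx, one_mul]
    rw [mul_left_comm, conj_mul_self_eq, expFn]
    push_cast
    rfl
  · simp only [cutFn, Set.indicator_of_notMem hx, zero_mul, mul_zero]

/-- Split `1 = e^{-x} + (1 - e^{-x})`: the first weight gives the summand of `w_t`, the second is
controlled independently of `t`. -/
theorem norm_gCut_sq_le {t : ℝ} (ht : 0 < t) (k : J) (f : K p) : ‖D.gCut ht k f‖ ^ 2 ≤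
    ((∫ x in Set.Ioi t, Real.exp (-x) * ‖D.g k x‖ ^ 2) +
      ∫ x, (1 - Real.exp (-x)) * ‖D.g k x‖ ^ 2 ∂halfLine) * ‖f‖ ^ 2 := by
  have h1 := D.inner_gCut_Lam ht k 1 f f
  have h2 := inner_star_mul_mul (star_mulOp memLp_sqrtFn fun x => Complex.conj_ofReal _) 1
    (D.gCut ht k f) (D.gCut ht k f)
  have h3 : sqrtOp p (D.gCut ht k f) = cutProj p t (D.gMap k f) :=
    DFunLike.congr_fun (sqrtOp_mul_invSqrtOp ht) (D.gMap k f)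
  change ⟪_, (sqrtOp p * 1 * sqrtOp p) _⟫_ℂ = ⟪sqrtOp p _, sqrtOp p _⟫_ℂ at h2
  rw [sqrtOp_mul_sqrtOp, h3, sub_apply, inner_sub_right, h1, one_apply_eq_self, one_apply_eq_self,
    inner_self_eq_ofReal, inner_self_eq_ofReal, inner_self_eq_ofReal] at h2
  have h4 : ‖D.gCut ht k f‖ ^ 2 - (∫ x in Set.Ioi t, Real.exp (-x) * ‖D.g k x‖ ^ 2) * ‖f‖ ^ 2 =
      ‖cutProj p t (D.gMap k f)‖ ^ 2 := by exact_mod_cast h2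
  have h5 : ‖cutProj p t (D.gMap k f)‖ ^ 2 ≤ ‖D.gMap k f‖ ^ 2 :=
    pow_le_pow_left₀ (norm_nonneg _) (norm_cutProj_apply_le t _) 2
  rw [D.inner_gMap_self] at h5
  linarith

end Kernel

end QWeight

/-! ### Reduction of `ϑΛ` to `ρ_ϑΛ` on constrained families. -/

namespace QWeight

namespace Kernel

variable {p : ℕ} {J : Type} (D : Kernel p J)

theorem hasSum_rho (B : BH p) (f g : K p) :
    HasSum (fun k => ⟪D.hMap k f, B (D.hMap k g)⟫_ℂ) ⟪f, D.rho B g⟫_ℂ := by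
  refine hasSum_inner_of_basis (EuclideanSpace.basisFun (Fin p) ℂ) (fun i j => ?_) f g
  simp only [hMap_basisFun]
  have h : ⟪EuclideanSpace.basisFun (Fin p) ℂ i,
      D.rho B (EuclideanSpace.basisFun (Fin p) ℂ j)⟫_ℂ = ∑' k, ⟪D.h i k, B (D.h j k)⟫_ℂ := by
    rw [EuclideanSpace.basisFun_inner, EuclideanSpace.basisFun_apply]
    change (Matrix.toEuclideanCLM (𝕜 := ℂ)
      (Matrix.of fun i j => ∑' k, ⟪D.h i k, B (D.h j k)⟫_ℂ) (EuclideanSpace.single j 1)) i = _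
    rw [Matrix.ofLp_toEuclideanCLM]
    simp
  rw [h]
  exact (D.summable_inner B i j).hasSum

theorem isCP_rho : IsCP D.rho := isCP_of_hasSum D.hasSum_rho

theorem tendsto_rho_cutProj (B : BH p) :
    Tendsto (fun t => D.rho (cutProj p t * B * cutProj p t)) (𝓝[>] 0) (𝓝 (D.rho B)) := by
  refine tendsto_of_tendsto_inner (EuclideanSpace.basisFun (Fin p) ℂ) fun i j => ?_
  have h := tendsto_tsum_inner_cutProj (D.h_summable i) (D.h_summable j) B
  simp only [← hMap_basisFun] at h
  rw [(D.hasSum_rho B _ _).tsum_eq] at h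
  exact h.congr fun t => (D.hasSum_rho _ _ _).tsum_eq

section

variable {D} {ϑ : WeightMap p}

theorem Represents.hasSum_restr (h : D.Represents ϑ) {t : ℝ} (ht : 0 < t) (A : BH p) (f g : K p) :
    HasSum (fun k => ⟪D.gCut ht k f + cutProj p t (D.hMap k f),
      A (D.gCut ht k g + cutProj p t (D.hMap k g))⟫_ℂ) ⟪f, restr ϑ t A g⟫_ℂ := by
  refine hasSum_inner_of_basis (V := fun k => D.gCut ht k + (cutProj p t : H p →ₗ[ℂ] H p) ∘ₗ D.hMap k)
    (EuclideanSpace.basisFun (Fin p) ℂ) (fun i j => ?_) f g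
  have h1 := h (invSqrtOp p ht * A * invSqrtOp p ht) i j
  simp only [inner_star_mul_mul (star_invSqrtOp ht)] at h1
  rw [← cut_eq_toA ht] at h1
  have h2 : ∀ i k, invSqrtOp p ht (D.vec i k) =
      D.gCut ht k (EuclideanSpace.basisFun (Fin p) ℂ i) +
        cutProj p t (D.hMap k (EuclideanSpace.basisFun (Fin p) ℂ i)) := by
    intro i k
    rw [hMap_basisFun, vec, map_add, ← invSqrtOp_mul_sqrtOp ht, EuclideanSpace.basisFun_apply]
    rfl
  simp only [h2] at h1
  simp only [EuclideanSpace.basisFun_apply] at h1 ⊢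
  exact h1

end

/-- `Λ(A_i^* A_j)` factors through the amplifications of `A_i` and `A_j`, so the form sees only the
vector `∑ A_i F_i`. -/
theorem sum_inner_Lam {n : ℕ} (A : Fin n → BK p) (F : Fin n → H p) :
    ∑ i, ∑ j, ⟪F i, Lam p (star (A i) * A j) (F j)⟫_ℂ =
      ⟪∑ i, (A i).compLpL 2 halfLine (F i), mulOp p expFn memLp_expFn
        (∑ i, (A i).compLpL 2 halfLine (F i))⟫_ℂ := by
  rw [sum_inner]
  refine Finset.sum_congr rfl fun i _ => ?_
  rw [map_sum, inner_sum]
  refine Finset.sum_congr rfl fun j _ => ?_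
  change ⟪F i, (mulOp p expFn memLp_expFn * (star (A i) * A j).compLpL 2 halfLine) (F j)⟫_ℂ = _
  rw [compLpL_mul, ← mul_assoc, mulOp_mul_compLpL, ← star_compLpL, mul_assoc, mul_apply_eq_comp,
    ContinuousLinearMap.star_eq_adjoint, ContinuousLinearMap.adjoint_inner_right]
  rfl

theorem sum_compLpL_gCut {t : ℝ} (ht : 0 < t) (k : J) {n : ℕ} {A : Fin n → BK p} {f : Fin n → K p}
    (h : ∑ i, A i (f i) = 0) : ∑ i, (A i).compLpL 2 halfLine (D.gCut ht k (f i)) = 0 := by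
  simp only [compLpL_gCut]
  rw [← map_sum, h, map_zero]

/-- The constraint kills the `g`-part of `∑ A_i F_i` for every `k`, leaving exactly the series of
the cut-off `ρ_ϑ`. -/
theorem condQuad_restr {ϑ : WeightMap p} (hϑ : D.Represents ϑ) {t : ℝ} (ht : 0 < t) {n : ℕ}
    {A : Fin n → BK p} {f : Fin n → K p} (h : ∑ i, A i (f i) = 0) :
    condQuad (restr ϑ t ∘ₗ Lam p) A f =
      ∑ i, ∑ j, ⟪f i, D.rho (cutProj p t * Lam p (star (A i) * A j) * cutProj p t) (f j)⟫_ℂ := by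
  have h1 := hasSum_sum (s := Finset.univ) fun i _ => hasSum_sum (s := Finset.univ) fun j _ =>
    hϑ.hasSum_restr ht (Lam p (star (A i) * A j)) (f i) (f j)
  have h2 := hasSum_sum (s := Finset.univ) fun i _ => hasSum_sum (s := Finset.univ) fun j _ =>
    D.hasSum_rho (cutProj p t * Lam p (star (A i) * A j) * cutProj p t) (f i) (f j)
  simp only [inner_star_mul_mul (star_cutProj t), sum_inner_Lam] at h1 h2
  simp only [map_add, Finset.sum_add_distrib, D.sum_compLpL_gCut ht _ h, zero_add] at h1
  exact h1.unique h2

theorem isReduced {ϑ : WeightMap p} (hϑ : D.Represents ϑ) :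
    (cutSystem p).IsReduced ϑ (D.rho ∘ₗ Lam p) := by
  refine ⟨fun A => (D.isCP_rho.comp isCP_Lam).star_apply A, fun n A f h => ?_⟩
  have h1 : Tendsto (fun t => ∑ i, ∑ j,
      ⟪f i, D.rho (cutProj p t * Lam p (star (A i) * A j) * cutProj p t) (f j)⟫_ℂ) (𝓝[>] 0)
      (𝓝 (condQuad (D.rho ∘ₗ Lam p) A f)) :=
    tendsto_sum_inner (fun i j => D.tendsto_rho_cutProj (Lam p (star (A i) * A j))) f
  refine h1.congr' ?_
  filter_upwards [eventually_mem_nhdsWithin] with t ht using (D.condQuad_restr hϑ ht h).symm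

theorem norm_basisFun (i : Fin p) : ‖EuclideanSpace.basisFun (Fin p) ℂ i‖ = 1 :=
  (EuclideanSpace.basisFun (Fin p) ℂ).norm_eq_one i

/-- Each summand is bounded by a constant depending on `t` times `(g_k, (I - Λ) g_k)`, so the `tsum`
defining `w` is a genuine sum and not the default value. -/
theorem hasSum_w {t : ℝ} (ht : 0 < t) (hp : 0 < p) :
    HasSum (fun k => ∫ x in Set.Ioi t, Real.exp (-x) * ‖D.g k x‖ ^ 2) (D.w t) := by
  refine Summable.hasSum ?_
  -- A unit vector turns the scalar integrals into inner products in `H p`; it exists because `p >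
  -- 0`.
  let e := EuclideanSpace.basisFun (Fin p) ℂ ⟨0, hp⟩
  refine Summable.of_nonneg_of_le (fun k => ?_) (fun k => ?_)
    (D.g_summable.mul_left (‖Lam p 1‖ * ‖invSqrtOp p ht‖ ^ 2))
  · exact integral_nonneg fun x => by positivity
  · have h1 := D.inner_gCut_Lam ht k 1 e e
    rw [one_apply_eq_self, inner_self_eq_ofReal, norm_basisFun, one_pow, Complex.ofReal_one,
      mul_one] at h1
    have h2 : ‖⟪D.gCut ht k e, Lam p 1 (D.gCut ht k e)⟫_ℂ‖ ≤
        ‖D.gCut ht k e‖ * (‖Lam p 1‖ * ‖D.gCut ht k e‖) :=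
      (norm_inner_le_norm _ _).trans
        (mul_le_mul_of_nonneg_left ((Lam p 1).le_opNorm _) (norm_nonneg _))
    rw [h1, Complex.norm_real] at h2
    have h3 : ‖D.gCut ht k e‖ ≤ ‖invSqrtOp p ht‖ * ‖D.gMap k e‖ := (invSqrtOp p ht).le_opNorm _
    have h4 := D.inner_gMap_self k e
    rw [norm_basisFun, one_pow, mul_one] at h4
    calc _ ≤ ‖D.gCut ht k e‖ * (‖Lam p 1‖ * ‖D.gCut ht k e‖) := (Real.le_norm_self _).trans h2
      _ = ‖Lam p 1‖ * ‖D.gCut ht k e‖ ^ 2 := by ring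
      _ ≤ ‖Lam p 1‖ * (‖invSqrtOp p ht‖ * ‖D.gMap k e‖) ^ 2 := by gcongr
      _ = _ := by rw [mul_pow, h4, mul_assoc]

end Kernel

end QWeight

/-! ### Leading asymptotics of `ϑ|_tΛ`. -/

namespace QWeight

namespace Kernel

variable {p : ℕ} {J : Type} {D : Kernel p J} {ϑ : WeightMap p}

theorem Represents.norm_sub_le (hϑ : D.Represents ϑ) (hp : 0 < p) {t : ℝ} (ht : 0 < t) (A : BK p)
    (i j : Fin p) {r : ℝ} (hr : 0 < r) :
    ‖⟪EuclideanSpace.basisFun (Fin p) ℂ i,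
        restr ϑ t (Lam p A) (EuclideanSpace.basisFun (Fin p) ℂ j)⟫_ℂ -
      (D.w t : ℂ) * ⟪EuclideanSpace.basisFun (Fin p) ℂ i,
        A (EuclideanSpace.basisFun (Fin p) ℂ j)⟫_ℂ‖ ≤
    ‖Lam p A‖ * (2 * (D.w t + ∑' k, ∫ x, (1 - Real.exp (-x)) * ‖D.g k x‖ ^ 2 ∂halfLine) / r +
      (r + 1) * (∑' k, ‖D.h i k‖ ^ 2 + ∑' k, ‖D.h j k‖ ^ 2)) := by
  have hg : ∀ i k, ‖D.gCut ht k (EuclideanSpace.basisFun (Fin p) ℂ i)‖ ^ 2 ≤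
      (∫ x in Set.Ioi t, Real.exp (-x) * ‖D.g k x‖ ^ 2) +
      ∫ x, (1 - Real.exp (-x)) * ‖D.g k x‖ ^ 2 ∂halfLine := fun i k => by
    simpa only [norm_basisFun, one_pow, mul_one] using D.norm_gCut_sq_le ht k
      (EuclideanSpace.basisFun (Fin p) ℂ i)
  have hsum := (D.hasSum_w ht hp).add D.g_summable.hasSum
  have hgs : ∀ i, Summable fun k => ‖D.gCut ht k (EuclideanSpace.basisFun (Fin p) ℂ i)‖ ^ 2 :=
    fun i => Summable.of_nonneg_of_le (fun k => by positivity) (hg i) hsum.summable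
  have hgl : ∀ i, ∑' k, ‖D.gCut ht k (EuclideanSpace.basisFun (Fin p) ℂ i)‖ ^ 2 ≤
      D.w t + ∑' k, ∫ x, (1 - Real.exp (-x)) * ‖D.g k x‖ ^ 2 ∂halfLine := fun i =>
    hasSum_le (hg i) (hgs i).hasSum hsum
  have hh : ∀ i k, ‖cutProj p t (D.hMap k (EuclideanSpace.basisFun (Fin p) ℂ i))‖ ^ 2 ≤
      ‖D.h i k‖ ^ 2 := fun i k => by
    rw [hMap_basisFun]
    exact pow_le_pow_left₀ (norm_nonneg _) (norm_cutProj_apply_le t _) 2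
  have hhs : ∀ i, Summable fun k =>
      ‖cutProj p t (D.hMap k (EuclideanSpace.basisFun (Fin p) ℂ i))‖ ^ 2 :=
    fun i => Summable.of_nonneg_of_le (fun k => by positivity) (hh i) (D.h_summable i)
  have hhl : ∀ i, ∑' k, ‖cutProj p t (D.hMap k (EuclideanSpace.basisFun (Fin p) ℂ i))‖ ^ 2 ≤
      ∑' k, ‖D.h i k‖ ^ 2 := fun i => (hhs i).tsum_le_tsum (hh i) (D.h_summable i)
  have h' := (Complex.hasSum_ofReal.2 (D.hasSum_w ht hp)).mul_right
    ⟪EuclideanSpace.basisFun (Fin p) ℂ i, A (EuclideanSpace.basisFun (Fin p) ℂ j)⟫_ℂ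
  simp only [← D.inner_gCut_Lam ht] at h'
  refine (norm_sub_le_of_hasSum (Lam p A) hr (hgs i).hasSum (hgs j).hasSum (hhs i).hasSum
    (hhs j).hasSum (hϑ.hasSum_restr ht (Lam p A) _ _) h').trans ?_
  have e1 := hgl i
  have e2 := hgl j
  gcongr ‖Lam p A‖ * (?_ / r + (r + 1) * (?_ + ?_))
  · linarith
  · exact hhl i
  · exact hhl j

theorem Represents.tendsto_inv_w_smul (hϑ : D.Represents ϑ) (hp : 0 < p)
    (hw : Tendsto D.w (𝓝[>] 0) atTop) (A : BK p) :
    Tendsto (fun t => ((D.w t : ℂ))⁻¹ • restr ϑ t (Lam p A)) (𝓝[>] 0) (𝓝 A) := by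
  refine tendsto_of_tendsto_inner (EuclideanSpace.basisFun (Fin p) ℂ) fun i j => ?_
  set d := ∑' k, ∫ x, (1 - Real.exp (-x)) * ‖D.g k x‖ ^ 2 ∂halfLine with hd
  set q := ∑' k, ‖D.h i k‖ ^ 2 + ∑' k, ‖D.h j k‖ ^ 2 with hq
  have hd0 : 0 ≤ d := tsum_nonneg fun k => integral_nonneg_of_ae (by
    filter_upwards [ae_pos] with x hx
    have := Real.exp_lt_one_iff.2 (show -x < 0 by linarith)
    exact mul_nonneg (by linarith) (sq_nonneg _))
  have hq0 : 0 ≤ q := add_nonneg (tsum_nonneg fun k => sq_nonneg _) (tsum_nonneg fun k => sq_nonneg _)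
  have hlim : Tendsto (fun t => ‖Lam p A‖ * (2 * (1 + d) + 2 * q) * (√(D.w t))⁻¹) (𝓝[>] 0) (𝓝 0) := by
    have := (tendsto_inv_atTop_zero.comp (Real.tendsto_sqrt_atTop.comp hw)).const_mul
      (‖Lam p A‖ * (2 * (1 + d) + 2 * q))
    rwa [mul_zero] at this
  rw [tendsto_iff_norm_sub_tendsto_zero]
  refine squeeze_zero' (Eventually.of_forall fun t => norm_nonneg _) ?_ hlim
  filter_upwards [eventually_mem_nhdsWithin, hw.eventually_ge_atTop 1] with t ht hwt
  have ht : 0 < t := ht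
  have hw0 : 0 < D.w t := by linarith
  -- With this weight the error in `ϑ|_tΛ(A) - w_t A` is of order `√w_t`, hence negligible after
  -- division by `w_t`.
  set r := √(D.w t) with hr
  have hr1 : 1 ≤ r := Real.one_le_sqrt.2 hwt
  have hrw : D.w t = r ^ 2 := (Real.sq_sqrt hw0.le).symm
  have hr0 : 0 < r := by linarith
  have h1 := hϑ.norm_sub_le hp ht A i j hr0
  rw [← hd, ← hq] at h1
  have h2 : ⟪EuclideanSpace.basisFun (Fin p) ℂ i, (((D.w t : ℂ))⁻¹ • restr ϑ t (Lam p A))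
        (EuclideanSpace.basisFun (Fin p) ℂ j)⟫_ℂ -
      ⟪EuclideanSpace.basisFun (Fin p) ℂ i, A (EuclideanSpace.basisFun (Fin p) ℂ j)⟫_ℂ =
      ((D.w t)⁻¹ : ℝ) * (⟪EuclideanSpace.basisFun (Fin p) ℂ i,
        restr ϑ t (Lam p A) (EuclideanSpace.basisFun (Fin p) ℂ j)⟫_ℂ -
      (D.w t : ℂ) * ⟪EuclideanSpace.basisFun (Fin p) ℂ i,
        A (EuclideanSpace.basisFun (Fin p) ℂ j)⟫_ℂ) := by
    have h3 : (D.w t : ℂ) ≠ 0 := Complex.ofReal_ne_zero.2 hw0.ne'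
    have h4 : ∀ (B : BK p) (c : ℂ) (f g : K p), ⟪f, (c • B) g⟫_ℂ = c * ⟪f, B g⟫_ℂ :=
      fun B c f g => inner_smul_right f (B g) c
    rw [h4, mul_sub, ← mul_assoc, Complex.ofReal_inv, inv_mul_cancel₀ h3, one_mul]
  rw [h2, norm_mul, Complex.norm_real, Real.norm_eq_abs, abs_of_pos (inv_pos.2 hw0)]
  calc (D.w t)⁻¹ * _ ≤ (D.w t)⁻¹ * (‖Lam p A‖ * (2 * (D.w t + d) / r + (r + 1) * q)) := by gcongr
    _ = ‖Lam p A‖ * ((2 * (1 + d / r ^ 2) + (1 + r⁻¹) * q) * r⁻¹) := by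
      rw [hrw]
      field_simp
    _ ≤ ‖Lam p A‖ * ((2 * (1 + d) + 2 * q) * r⁻¹) := by
      have h5 : d / r ^ 2 ≤ d := div_le_self hd0 (one_le_pow₀ hr1)
      have h6 : r⁻¹ ≤ 1 := inv_le_one_of_one_le₀ hr1
      gcongr
      linarith
    _ = _ := by ring

end Kernel

/-! ### Transfer from the cut-off system to `q`-weight maps. -/

variable {p : ℕ} {ω ω' η : WeightMap p}

theorem IsQWeightMap.isQ (h : IsQWeightMap ω) : (cutSystem p).IsQ ω :=
  ⟨h.cp, h.invertible, h.bdryRep_cp, h.bdryRep_contractive⟩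

/-- Normality of `π_t^#` comes for free: `ω|_t` is normal, and the inverse acts on the
finite-dimensional side. -/
theorem IsQWeightMap.of_isQ (h : (cutSystem p).IsQ ω) (hb : IsBWeightMap ω) : IsQWeightMap ω where
  bweight := hb
  cp := h.cp
  invertible := h.invertible
  bdryRep_cp := h.bdry_cp
  bdryRep_contractive := h.bdry_contractive
  bdryRep_normal _ ht := (hb.isNormalMap_restr ht).comp _

theorem IsBoundedMap.norm_restr_Lam_one_le (h : IsBoundedMap η) :
    ∃ R : ℝ, ∀ᶠ t in 𝓝[>] (0 : ℝ), ‖restr η t (Lam p 1)‖ ≤ R := by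
  obtain ⟨C, hC⟩ := h
  refine ⟨|C| * ‖Lam p 1‖, ?_⟩
  filter_upwards [eventually_mem_nhdsWithin] with t ht
  have h1 : ‖(cut p t (Lam p 1) : BH p)‖ ≤ ‖Lam p 1‖ := by
    rw [coe_cut ht]
    calc _ ≤ ‖cutProj p t‖ * ‖Lam p 1‖ * ‖cutProj p t‖ :=
          (norm_mul_le _ _).trans (mul_le_mul_of_nonneg_right (norm_mul_le _ _) (norm_nonneg _))
      _ ≤ 1 * ‖Lam p 1‖ * 1 := by gcongr <;> exact norm_cutProj_le t
      _ = _ := by ring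
  exact (hC _).trans ((mul_le_mul_of_nonneg_right (le_abs_self C) (norm_nonneg _)).trans
    (mul_le_mul_of_nonneg_left h1 (abs_nonneg C)))

section pair

variable {J : Type} {ψ : Module.End ℂ (BK p)} {ϑ : WeightMap p} {D : Kernel p J}

theorem IsCoefficientPair.isBWeightMap (h : IsCoefficientPair ω ψ ϑ D) (hω : IsBWeightMap ω) :
    IsBWeightMap ϑ := by
  have h1 : ϑ = ψ ∘ₗ ω := by
    ext1 A
    rw [h.eq]
    exact (map_inverse_apply h.invertible _).symm
  rw [h1]
  exact hω.comp ψ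

theorem IsCoefficientPair.isQSubordinate (h : IsCoefficientPair ω ψ ϑ D) (hω : IsQWeightMap ω)
    (hη : IsBoundedSubweight η ϑ) {T ψ' : Module.End ℂ (BK p)} (hT : IsCompLam η T)
    (h1 : IsCP (ψ' - (ψ + T))) (h2 : IsCondNeg (ψ' + D.rho ∘ₗ Lam p - T)) :
    IsUnit ψ' ∧ IsQSubordinate (Ring.inverse ψ' ∘ₗ (ϑ - η)) ω := by
  have hω' := hω.isQ
  rw [h.eq] at hω'
  obtain ⟨hu, hq, hs⟩ := CutSystem.isQ_of_dominated (S := cutSystem p) hω' h.invertible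
    h.inverse_cp (D.isReduced h.represents) (isCondNeg_iff.1 h.condNeg_add) hη.cp hη.sub_cp hT h1
    (isCondNeg_iff.1 h2)
  refine ⟨hu, .of_isQ hq (((h.isBWeightMap hω.bweight).sub hη.bweight).comp _), hω, ?_⟩
  rw [h.eq]
  exact hs

theorem IsCoefficientPair.exists_of_isQSubordinate (h : IsCoefficientPair ω ψ ϑ D) (hp : 0 < p)
    (hω' : IsQSubordinate ω' ω) (hne : ω' ≠ 0) :
    ∃ (η : WeightMap p) (T ψ' : Module.End ℂ (BK p)), IsBoundedSubweight η ϑ ∧ IsCompLam η T ∧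
      IsCP (ψ' - (ψ + T)) ∧ IsCondNeg (ψ' + D.rho ∘ₗ Lam p - T) ∧ IsUnit ψ' ∧
      ω' = Ring.inverse ψ' ∘ₗ (ϑ - η) := by
  have hω := hω'.right.isQ
  have hsub := hω'.sub_cp
  rw [h.eq] at hω hsub
  have hϑ := h.isBWeightMap hω'.right.bweight
  obtain ⟨η, T, ψ', hη, hcp, hsubcp, hbdd, hT, h1, h2, hu, heq⟩ :=
    CutSystem.exists_of_subordinate (S := cutSystem p) hω hω'.left.isQ hsub hne hϑ.isRegular
      hω'.left.bweight.isRegular h.invertible h.inverse_cp (D.isReduced h.represents) h.tendsto_w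
      (h.represents.tendsto_inv_w_smul hp h.tendsto_w) (oneSubLam p).2
  refine ⟨η, T, ψ', ⟨?_, hbdd, hcp, hsubcp⟩, hT, h1, isCondNeg_iff.2 h2, hu, heq⟩
  rw [hη]
  exact hϑ.sub (hω'.left.bweight.comp ψ')

end pair

end QWeight

theorem theorem4p9 (p : ℕ) (hp : 0 < p) {J : Type} [Countable J]
    (ω ϑ : QWeight.WeightMap p) (ψ : Module.End ℂ (QWeight.BK p)) (D : QWeight.Kernel p J)
    (hω : QWeight.IsQWeightMap ω) (hindex : QWeight.IsIndexZero ω)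
    (hrange : Function.Surjective ω) (hpair : QWeight.IsCoefficientPair ω ψ ϑ D) :
    (∀ η : QWeight.WeightMap p, QWeight.IsBoundedSubweight η ϑ →
      ∃ T : Module.End ℂ (QWeight.BK p), QWeight.IsCompLam η T ∧
        ∀ ψ' : Module.End ℂ (QWeight.BK p),
          QWeight.IsCP (ψ' - (ψ + T)) →
          QWeight.IsCondNeg (ψ' + D.rho ∘ₗ QWeight.Lam p - T) →
          IsUnit ψ' ∧ QWeight.IsQSubordinate (Ring.inverse ψ' ∘ₗ (ϑ - η)) ω) ∧
    (∀ ω' : QWeight.WeightMap p, QWeight.IsQSubordinate ω' ω → ω' ≠ 0 →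
      ∃ (η : QWeight.WeightMap p) (T ψ' : Module.End ℂ (QWeight.BK p)),
        QWeight.IsBoundedSubweight η ϑ ∧ QWeight.IsCompLam η T ∧
        QWeight.IsCP (ψ' - (ψ + T)) ∧
        QWeight.IsCondNeg (ψ' + D.rho ∘ₗ QWeight.Lam p - T) ∧
        IsUnit ψ' ∧ ω' = Ring.inverse ψ' ∘ₗ (ϑ - η)) := by
  refine ⟨fun η hη => ?_, fun ω' hω' hne => hpair.exists_of_isQSubordinate hp hω' hne⟩
  obtain ⟨R, hR⟩ := hη.bounded.norm_restr_Lam_one_le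
  obtain ⟨T, hT⟩ := QWeight.CutSystem.exists_tendsto_resΛ (S := QWeight.cutSystem p) hη.cp hR
  exact ⟨T, hT, fun ψ' h1 h2 => hpair.isQSubordinate hω hη hT h1 h2⟩
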